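/- **Problem.** Let $\mathcal N$ be a finite set with $n$ elements, $f:2^{\mathcal N}\to\mathbb R_{\ge 0}$ a submodular function (not necessarily monotone), $(\mathcal N,\mathcal I_1),\dots,(\mathcal N,\mathcal I_k)$ matroids, and $c_1,\dots,c_m:\mathcal N\to\mathbb R_{\ge0}$ cost functions, $m\ge1$. A set $S\subseteq\mathcal N$ is feasible if $S\in\mathcal I:=\bigcap_i\mathcal I_i$ and $c_j(S):=\sum_{e\in S}c_j(e)\le 1$ for all $j\in[m]$. The task is to maximize $f$ over the feasible sets; let $S_{\mathrm{OPT}}$ be any optimal solution, $\mathrm{OPT}=f(S_{\mathrm{OPT}})$ and $r=|S_{\mathrm{OPT}}|$. Put $P=\max\{\lceil\sqrt{1+m}\rceil,k\}$. The algorithms access $f$ through a value oracle and $\mathcal I$ through a membership oracle. **Algorithm SPROUT** (parameters $C\ge1$, $\ell\ge 1$, $\delta,\epsilon,\beta,\gamma$). For each feasible $A\subseteq\mathcal N$ with $|A|=C$, let $z(S)=f(A\cup S)-f(A)$, $\mathcal N'=\{e\notin A: C z(\{e\})\le f(A)\}$, $\mathcal I'=\{S\subseteq\mathcal N': S\cup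 A\in\mathcal I\}$, $c'_j(e)=c_j(e)/(1-c_j(A))\in[0,\infty]$ (with $0/0=0$ and $x/0=\infty$ for $x>0$), and let $V$ be the maximum of $z(\{e\})$ over the $e\in\mathcal N'$ with $\{e\}\in\mathcal I'$ and $c'_j(e)\le1$ for all $j$ ($V=0$ if there is no such $e$). Start with $b_1=1$, $b_0=\lceil\log_2|\mathcal N'|/\delta\rceil$ ($b_0=0$ if $\mathcal N'=\emptyset$). While $|b_1-b_0|>1$: put $b=\lfloor(b_1+b_0+1)/2\rfloor$ and $\rho=\beta V(1+\delta)^b+\gamma f(A)/C$, run KnapsackSGS with density ratio $\rho$, which returns a set $S_K$ and a bit $E$, and set $b_E=b$. Let $S_A$ be a set of largest $z$-value among the sets $S_K$ found ($S_A=\emptyset$ if there are none). SPROUT returns a set $A\cup S_A$ of largest $f$-value over all these $A$. **KnapsackSGS.** Start with $\ell$ empty sets $S^1,\dots,S^\ell$, all elements of $\mathcal N'$ unused, $E=0$ and $\tau=V$. While $\tau>\epsilon V/n$: go through all pairs $(a,i)$ of an element and an index $i\in[\ell]$; if $a\in\mathcal N'$ is still unused, $S^i\cup\{a\}\in\mathcal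 I'$ and $z(S^i\cup\{a\})-z(S^i)\ge\max\{\tau,\rho\sum_j c'_j(a)\}$, then add $a$ to $S^i$ and mark it used if $c'_j(S^i\cup\{a\})\le1$ for all $j$, and set $E=1$ otherwise; after each pass replace $\tau$ by $(1-\epsilon)\tau$. Return an $S^i$ of largest $z$-value, and $E$. **Theorem 1.** There are absolute constants $K,d$ such that the following holds for all instances as above, whatever the order in which the sets $A$ and the pairs $(a,i)$ are enumerated. 1. Let $C\ge1$, $0<\epsilon<1$, $\delta=\epsilon$, $\ell=P+1$, $\beta=\frac{(1-\epsilon)(1-1/\ell-\epsilon)}{P+1+m(1-\epsilon)}$, $\gamma=\frac{P+1}{P+1+m(1-\epsilon)}$. SPROUT makes at most $K\,\frac{Pn^{C+1}}{\epsilon}\bigl(1+\log\frac n\epsilon\bigr)^d$ oracle calls and at most $K\,\frac{Pmn^{C+1}}{\epsilon}\bigl(1+\log\frac n\epsilon\bigr)^d$ arithmetic operations, that is, $\tilde O(Pn^{C+1}/\epsilon)$ and $\tilde O(Pmn^{C+1}/\epsilon)$. Any set it returns is feasible, and if $r\ge C$, it returns a feasible set $S$ with $$f(S)\ \ge\ \left(\frac{(1-\epsilon)^2(1-2\epsilon)}{k+m+3+2\sqrt{m+1}}+\frac{(C-\epsilon)(P+1)+(C-1)m(1-\epsilon)-C(1-\epsilon)^3}{r\,(P+1+m(1-\epsilon))}\right)\mathrm{OPT}.$$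 2. Let $C=1$, $0<\epsilon<1$ and $r\ge 1$. With the parameters of part 1 for the error parameter $\epsilon/8$ in place of $\epsilon$, SPROUT returns a feasible set $S$ with $(1+\epsilon)(k+m+3+2\sqrt{m+1})\,f(S)\ge\mathrm{OPT}$. Its numbers of oracle calls and of arithmetic operations, for every $r\ge 0$, are at most $K\,\frac{Pn^{2}}{\epsilon}(1+\log\frac n\epsilon)^d$ and $K\,\frac{Pmn^{2}}{\epsilon}(1+\log\frac n\epsilon)^d$. 3. Let $f$ be monotone, $C=1$, $0<\epsilon<1$, $1\le\ell\le k+1$, $\delta=\epsilon$, $\beta=\frac{(1-\epsilon)^2}{k+1+m(1-\epsilon)}$, $\gamma=\frac{k+1}{k+1+m(1-\epsilon)}$. If $r\ge1$, SPROUT returns a feasible set $S$ with $f(S)\ge\frac{(1-\epsilon)^3}{k+m+1}\mathrm{OPT}$; run with the error parameter $\epsilon/8$ in place of $\epsilon$, it returns a feasible $S$ with $(1+\epsilon)(k+m+1)f(S)\ge\mathrm{OPT}$. Both runs obey the bounds of part 2 on oracle calls and arithmetic operations. -/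

import Mathlib

open scoped NNReal ENNReal

noncomputable section

namespace Sprout

/-! ### The problem

The ground set is `Fin n`; every finite ground set is of this form after numbering its elements. -/

/-- Diminishing returns: `f(e | A) ≥ f(e | B)` whenever `A ⊆ B` and `e ∉ B`. -/
def IsSubmodular {n : ℕ} (f : Finset (Fin n) → ℝ) : Prop :=
  ∀ A B : Finset (Fin n), A ⊆ B → ∀ e, e ∉ B → f (insert e B) - f B ≤ f (insert e A) - f A

/-- `S` is independent in each of the `k` matroids and respects each of the `m` knapsacks
(all budgets are normalized to `1`). -/
def Feasible {n k m : ℕ} (M : Fin k → Matroid (Fin n)) (c : Fin m → Fin n → ℝ≥0)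
    (S : Finset (Fin n)) : Prop :=
  (∀ i, (M i).Indep (S : Set (Fin n))) ∧ ∀ j, ∑ e ∈ S, c j e ≤ 1

/-- `O` is an optimal solution of the maximization problem. -/
def IsOptimal {n k m : ℕ} (f : Finset (Fin n) → ℝ) (M : Fin k → Matroid (Fin n))
    (c : Fin m → Fin n → ℝ≥0) (O : Finset (Fin n)) : Prop :=
  Feasible M c O ∧ ∀ S, Feasible M c S → f S ≤ f O

/-! ### Programs with oracle access and their cost

A program does not see the objective function or the matroids: it can only query a value oracle
for `f` and a membership oracle for the intersection of the matroids.  Arithmetic operations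
(including comparisons) are charged explicitly. -/

/-- Programs over the ground set `Fin n` that return an element of `β`. -/
inductive Prog (n : ℕ) (β : Type) : Type
  | ret (b : β) : Prog n β
  | value (S : Finset (Fin n)) (next : ℝ → Prog n β) : Prog n β
  | member (S : Finset (Fin n)) (next : Bool → Prog n β) : Prog n β
  | arith (ops : ℕ) (next : Prog n β) : Prog n β

namespace Prog

variable {n : ℕ} {β γ : Type}

/-- Sequential composition. -/
def bind : Prog n β → (β → Prog n γ) → Prog n γ
  | ret b, g => g b
  | value S next, g => value S fun x => bind (next x) g
  | member S next, g => member S fun x => bind (next x) g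
  | arith t next, g => arith t (bind next g)

instance : Monad (Prog n) where
  pure := ret
  bind := bind

/-- One call of the value oracle. -/
def queryValue (S : Finset (Fin n)) : Prog n ℝ := value S ret

/-- One call of the membership oracle. -/
def queryMember (S : Finset (Fin n)) : Prog n Bool := member S ret

/-- Pay for `t` arithmetic operations. -/
def charge (t : ℕ) : Prog n Unit := arith t (ret ())

/-- The result of a program when the oracles answer according to `f` and `mem`. -/
def eval (f : Finset (Fin n) → ℝ) (mem : Finset (Fin n) → Bool) : Prog n β → β
  | ret b => b
  | value S next => eval f mem (next (f S))
  | member S next => eval f mem (next (mem S))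
  | arith _ next => eval f mem next

/-- The number of oracle calls (value and membership) made during the execution. -/
def oracleCalls (f : Finset (Fin n) → ℝ) (mem : Finset (Fin n) → Bool) : Prog n β → ℕ
  | ret _ => 0
  | value S next => 1 + oracleCalls f mem (next (f S))
  | member S next => 1 + oracleCalls f mem (next (mem S))
  | arith _ next => oracleCalls f mem next

/-- The number of arithmetic operations performed during the execution. -/
def arithOps (f : Finset (Fin n) → ℝ) (mem : Finset (Fin n) → Bool) : Prog n β → ℕ
  | ret _ => 0
  | value S next => arithOps f mem (next (f S))
  | member S next => arithOps f mem (next (mem S))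
  | arith t next => t + arithOps f mem next

end Prog

open Prog

open Classical in
/-- The membership oracle of the intersection of the matroids `M i`. -/
def memOracle {n k : ℕ} (M : Fin k → Matroid (Fin n)) (S : Finset (Fin n)) : Bool :=
  decide (∀ i, (M i).Indep (S : Set (Fin n)))

open Classical in
/-- A member of the list `L` with the largest score (`none` if `L` is empty). -/
def argmax {n : ℕ} (score : Finset (Fin n) → Prog n ℝ) (L : List (Finset (Fin n))) :
    Prog n (Option (Finset (Fin n))) := do
  let r ← L.foldlM (init := (none : Option (Finset (Fin n) × ℝ))) fun best S => do
    let v ← score S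
    charge 1
    match best with
    | none => pure (some (S, v))
    | some (T, w) => if w < v then pure (some (S, v)) else pure (some (T, w))
  pure (r.map Prod.fst)

/-! ### The subroutine `KnapsackSGS` -/

/-- The state of `KnapsackSGS`: the `ℓ` candidate solutions, their knapsack loads, the elements
not yet used, and the indicator `E` of a knapsack violation. -/
structure SGSState (n m ℓ : ℕ) where
  sol : Fin ℓ → Finset (Fin n)
  load : Fin ℓ → Fin m → ℝ≥0∞
  avail : Finset (Fin n)
  viol : Bool

open Classical in
/-- Treatment of one pair `(a, i)` at threshold `τ` and density ratio `ρ`. Here `z` and `mem`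
evaluate the objective and the independence of the instance, and `c'` are the costs. -/
def sgsStep {n m ℓ : ℕ} (z : Finset (Fin n) → Prog n ℝ) (mem : Finset (Fin n) → Prog n Bool)
    (c' : Fin m → Fin n → ℝ≥0∞) (ρ τ : ℝ) (s : SGSState n m ℓ) (q : Fin n × Fin ℓ) :
    Prog n (SGSState n m ℓ) :=
  if q.1 ∈ s.avail then do
    let b ← mem (insert q.1 (s.sol q.2))
    let v ← z (insert q.1 (s.sol q.2))
    let w ← z (s.sol q.2)
    charge (m + 4)
    if b = true ∧ τ ≤ v - w ∧ ENNReal.ofReal ρ * ∑ j, c' j q.1 ≤ ENNReal.ofReal (v - w) then do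
      charge (2 * m)
      if ∀ j, s.load q.2 j + c' j q.1 ≤ 1 then
        pure
          { sol := Function.update s.sol q.2 (insert q.1 (s.sol q.2))
            load := Function.update s.load q.2 fun j => s.load q.2 j + c' j q.1
            avail := s.avail.erase q.1
            viol := s.viol }
      else pure { s with viol := true }
    else pure s
  else pure s

open Classical in
/-- The loop `while τ > ε 𝒱 / n`: one pass over all pairs, then `τ` is multiplied by `1 - ε`.
The first argument bounds the number of passes. -/
def sgsLoop {n m ℓ : ℕ} (z : Finset (Fin n) → Prog n ℝ) (mem : Finset (Fin n) → Prog n Bool)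
    (c' : Fin m → Fin n → ℝ≥0∞) (pairs : List (Fin n × Fin ℓ)) (ε V ρ : ℝ) :
    ℕ → ℝ → SGSState n m ℓ → Prog n (SGSState n m ℓ)
  | 0, _, s => pure s
  | r + 1, τ, s => do
    charge 4
    if ε * V / n < τ then do
      let s' ← pairs.foldlM (sgsStep z mem c' ρ τ) s
      sgsLoop z mem c' pairs ε V ρ r ((1 - ε) * τ) s'
    else pure s

/-- The exact number of passes of the loop: the first `r` for which `τ = (1 - ε) ^ r 𝒱` no longer
satisfies the loop condition. -/
def sgsPasses (n : ℕ) (ε V : ℝ) : ℕ := sInf {r : ℕ | (1 - ε) ^ r * V ≤ ε * V / n}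

/-- `KnapsackSGS`: returns the best of the `ℓ` candidate solutions and the indicator `E`.
The fuel of the loop is one more than its number of passes, so that it never runs out. -/
def knapsackSGS {n m ℓ : ℕ} (z : Finset (Fin n) → Prog n ℝ) (mem : Finset (Fin n) → Prog n Bool)
    (c' : Fin m → Fin n → ℝ≥0∞) (N' : Finset (Fin n)) (pairs : List (Fin n × Fin ℓ))
    (ε V ρ : ℝ) : Prog n (Finset (Fin n) × Bool) := do
  let s ← sgsLoop z mem c' pairs ε V ρ (sgsPasses n ε V + 1) V
    { sol := fun _ => ∅, load := fun _ _ => 0, avail := N', viol := false }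
  let S ← argmax z ((List.finRange ℓ).map s.sol)
  pure (S.getD ∅, s.viol)

/-! ### The algorithm `SPROUT` -/

/-- The numerical parameters of the algorithm. -/
structure Params where
  C : ℕ
  δ : ℝ
  ε : ℝ
  β : ℝ
  γ : ℝ

/-- The costs after the budgets have been decreased by the cost of `A` and normalized to `1`.
The quotient is taken in `[0, ∞]`, where `0 / 0 = 0` and `x / 0 = ∞` for `x > 0`. -/
def reducedCost {n m : ℕ} (c : Fin m → Fin n → ℝ≥0) (A : Finset (Fin n)) (j : Fin m) (e : Fin n) :
    ℝ≥0∞ :=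
  (c j e : ℝ≥0∞) / (1 - ∑ a ∈ A, (c j a : ℝ≥0∞))

open Classical in
/-- Computes the reduced ground set `{e ∉ A | C · z(e) ≤ f(A)}` and the maximum of `z` over its
feasible elements (`none` if there are none). -/
def scanGround {n m : ℕ} (z : Finset (Fin n) → Prog n ℝ) (mem : Finset (Fin n) → Prog n Bool)
    (c' : Fin m → Fin n → ℝ≥0∞) (A : Finset (Fin n)) (C : ℕ) (fA : ℝ) :
    Prog n (Finset (Fin n) × Option ℝ) :=
  (List.finRange n).foldlM (init := ((∅ : Finset (Fin n)), (none : Option ℝ))) fun st e =>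
    if e ∈ A then pure st
    else do
      let v ← z {e}
      charge 2
      if (C : ℝ) * v ≤ fA then do
        let b ← mem {e}
        charge (m + 1)
        if b = true ∧ ∀ j, c' j e ≤ 1 then
          pure (insert e st.1, some (max v (st.2.getD v)))
        else pure (insert e st.1, st.2)
      else pure st

/-- The binary search: while `|b₁ - b₀| > 1`, run the subroutine at the density ratio of index
`b = ⌊(b₁ + b₀ + 1) / 2⌋` and replace `b_E` by `b`.  Returns the list of all the sets that were
found.  The charge covers `b` multiplications for a power with exponent `b`, and a constant number
of other operations. -/
def binarySearch {n : ℕ} (sub : ℝ → Prog n (Finset (Fin n) × Bool)) (rho : ℕ → ℝ) (b₁ b₀ : ℕ) :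
    Prog n (List (Finset (Fin n))) :=
  if 1 < ((b₁ : ℤ) - (b₀ : ℤ)).natAbs then do
    charge ((b₁ + b₀ + 1) / 2 + 12)
    let r ← sub (rho ((b₁ + b₀ + 1) / 2))
    let rest ←
      if r.2 = true then binarySearch sub rho ((b₁ + b₀ + 1) / 2) b₀
      else binarySearch sub rho b₁ ((b₁ + b₀ + 1) / 2)
    pure (r.1 :: rest)
  else do
    charge 2
    pure []
termination_by ((b₁ : ℤ) - (b₀ : ℤ)).natAbs
decreasing_by all_goals omega

/-- The body of the main loop for a feasible set `A`: returns `A ∪ S_A`, where `S_A` is the best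
set found by the binary search (and is empty if the search has no step). -/
def extendSet {n m ℓ : ℕ} (c : Fin m → Fin n → ℝ≥0) (p : Params) (pairs : List (Fin n × Fin ℓ))
    (A : Finset (Fin n)) : Prog n (Finset (Fin n)) := do
  let fA ← queryValue A
  let z : Finset (Fin n) → Prog n ℝ := fun S => do
    let v ← queryValue (A ∪ S)
    charge 1
    pure (v - fA)
  let mem : Finset (Fin n) → Prog n Bool := fun S => queryMember (A ∪ S)
  charge (m * (A.card + 1) + m * n)
  let c' := reducedCost c A
  let st ← scanGround z mem c' A p.C fA
  let V := st.2.getD 0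
  charge 3
  let found ← binarySearch (knapsackSGS z mem c' st.1 pairs p.ε V)
    (fun b => p.β * V * (1 + p.δ) ^ b + p.γ * fA / p.C) 1
    ⌈Real.logb 2 (st.1.card : ℝ) / p.δ⌉₊
  let S ← argmax z found
  pure (A ∪ S.getD ∅)

open Classical in
/-- `SPROUT`.  The list `sets` gives the order in which the sets with `C` elements are enumerated,
and `pairs` the order in which the subroutine goes through the pairs of an element and the index
of a candidate solution.  The result is `none` if no set with `C` elements is feasible. -/
def sprout {n m ℓ : ℕ} (c : Fin m → Fin n → ℝ≥0) (p : Params) (sets : List (Finset (Fin n)))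
    (pairs : List (Fin n × Fin ℓ)) : Prog n (Option (Finset (Fin n))) := do
  let cands ← sets.foldlM (init := ([] : List (Finset (Fin n)))) fun acc A => do
    let b ← queryMember A
    charge (m * (A.card + 1))
    if b = true ∧ ∀ j, ∑ e ∈ A, c j e ≤ 1 then do
      let T ← extendSet c p pairs A
      pure (T :: acc)
    else pure acc
  argmax queryValue cands

/-- `sets` lists every set with `C` elements exactly once. -/
def ListsSets {n : ℕ} (C : ℕ) (sets : List (Finset (Fin n))) : Prop :=
  sets.Nodup ∧ ∀ A, A ∈ sets ↔ A.card = C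

/-- `pairs` lists every pair exactly once. -/
def ListsPairs {n ℓ : ℕ} (pairs : List (Fin n × Fin ℓ)) : Prop :=
  pairs.Nodup ∧ ∀ q, q ∈ pairs

/-! ### The choice of the parameters -/

/-- `P = max {⌈√(1 + m)⌉, k}`. -/
def numP (k m : ℕ) : ℕ := max ⌈√(1 + (m : ℝ))⌉₊ k

/-- Parameters for a general objective: `δ = ε`,
`β = (1 - ε)(1 - 1/ℓ - ε) / (p + 1 + m(1 - ε))` and `γ = (p + 1) / (p + 1 + m(1 - ε))`,
where `p = max {ℓ - 1, k}`. -/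
def generalParams (k m ℓ C : ℕ) (ε : ℝ) : Params where
  C := C
  δ := ε
  ε := ε
  β := (1 - ε) * (1 - 1 / (ℓ : ℝ) - ε) / ((max (ℓ - 1) k : ℕ) + 1 + m * (1 - ε))
  γ := ((max (ℓ - 1) k : ℕ) + 1) / ((max (ℓ - 1) k : ℕ) + 1 + m * (1 - ε))

/-- Parameters for a monotone objective: the same, without the loss of `1/ℓ` in `β`. -/
def monotoneParams (k m ℓ C : ℕ) (ε : ℝ) : Params where
  C := C
  δ := ε
  ε := ε
  β := (1 - ε) * (1 - ε) / ((max (ℓ - 1) k : ℕ) + 1 + m * (1 - ε))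
  γ := ((max (ℓ - 1) k : ℕ) + 1) / ((max (ℓ - 1) k : ℕ) + 1 + m * (1 - ε))

/-- `prog` makes at most `K · (base / ε) · (1 + log (n / ε)) ^ d` oracle calls and `m` times as
many arithmetic operations: the explicit form of the bounds `Õ(base / ε)` and `Õ(m · base / ε)`. -/
def CostBound {n k : ℕ} {β : Type} (f : Finset (Fin n) → ℝ) (M : Fin k → Matroid (Fin n))
    (m : ℕ) (ε K : ℝ) (d : ℕ) (base : ℝ) (prog : Prog n β) : Prop :=
  (prog.oracleCalls f (memOracle M) : ℝ) ≤ K * (base / ε) * (1 + Real.log (n / ε)) ^ d ∧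
  (prog.arithOps f (memOracle M) : ℝ) ≤ K * (m * base / ε) * (1 + Real.log (n / ε)) ^ d

end Sprout

end

/-! Fix an optimal set O and choose C of its elements greedily. The resulting A satisfies C·OPT ≤
r·f(A), and every other element of O has marginal value at most a = f(A)/C over A (`exists_share`),
so it survives in the reduced ground set. The enumeration meets this A, and only its branch needs
analysis. Write z for the residual objective and w for the gain of that branch over f(A).

For one density ρ the subroutine yields one of two inequalities (`knapsackSGS_spec`). If a knapsack
was violated, the overfull set has cost above 1 and density at least ρ, so it is worth at least ρ,
and removing its last element costs at most a: some candidate has value at least ρ − a. If no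
knapsack was violated, the run is a threshold greedy for the matroids alone, in which an element
pays the price ρ per unit of cost. Each addition can be charged with p = max(ℓ − 1, k) lost pairs of
an element of O and a candidate: a member of O is lost to the ℓ − 1 other candidates, and other
elements cause at most k conflicts each, by matroid exchange. The amortized count in `PotentialInv`
bounds (1 − ε) Σ z(Sⁱ ∪ O) by (p + 1 − ε) Σ z(Sⁱ) + ℓ(εV + (1 − ε)ρm). As the candidates are
disjoint, Σ f(O ∪ Sⁱ) ≥ (ℓ − 1) f(O) (`card_mul_le_sum_union`). So a share θ = 1 − 1/ℓ of f(O)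
survives averaging; for monotone f it is θ = 1.

The binary search ends at neighbouring indices, the lower with the first inequality and the upper
with the second. The variable parts of their densities differ only by the factor 1 + ε and can be
eliminated (`combine_densities`). The ends of the range are not tested: at the lower one the first
inequality is trivial, and at the upper one the density is so large that the first inequality alone
suffices (`bound_of_large_density`). Since C·OPT ≤ r·f(A), the terms in f(A) turn into the summand
with 1/r (`ratio_of_value`). With ℓ = P + 1 the leading ratio is essentially (P/(P + 1))/(P + 1 +
m), whose inverse is P + m + 2 + (m + 1)/P; this explains the choice of P near √(m + 1) unless k is
larger (`numP_balance`).

For the running time, with L = 1 + log(n/ε), there are at most n^C enumerated sets, O(L) search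
steps for each, O(L/ε) passes for each step, and nℓ pairs in a pass. -/

noncomputable section

namespace Sprout

open Prog

/-! ### Results and costs of composed programs -/

namespace Prog

variable {n : ℕ} {β γ : Type} (f : Finset (Fin n) → ℝ) (mem : Finset (Fin n) → Bool)

@[simp] theorem eval_pure (b : β) : (pure b : Prog n β).eval f mem = b := rfl

@[simp] theorem oracleCalls_pure (b : β) : (pure b : Prog n β).oracleCalls f mem = 0 := rfl

@[simp] theorem arithOps_pure (b : β) : (pure b : Prog n β).arithOps f mem = 0 := rfl

@[simp] theorem eval_queryValue (S : Finset (Fin n)) : (queryValue S).eval f mem = f S := rfl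

@[simp] theorem oracleCalls_queryValue (S : Finset (Fin n)) :
    (queryValue S).oracleCalls f mem = 1 := rfl

@[simp] theorem arithOps_queryValue (S : Finset (Fin n)) :
    (queryValue S).arithOps f mem = 0 := rfl

@[simp] theorem eval_queryMember (S : Finset (Fin n)) : (queryMember S).eval f mem = mem S := rfl

@[simp] theorem oracleCalls_queryMember (S : Finset (Fin n)) :
    (queryMember S).oracleCalls f mem = 1 := rfl

@[simp] theorem arithOps_queryMember (S : Finset (Fin n)) :
    (queryMember S).arithOps f mem = 0 := rfl

@[simp] theorem oracleCalls_charge (t : ℕ) : (charge t : Prog n Unit).oracleCalls f mem = 0 := rfl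

@[simp] theorem arithOps_charge (t : ℕ) : (charge t : Prog n Unit).arithOps f mem = t := rfl

@[simp] theorem eval_bind (p : Prog n β) (g : β → Prog n γ) :
    (p >>= g).eval f mem = (g (p.eval f mem)).eval f mem := by
  change (Prog.bind p g).eval f mem = _
  induction p with
  | ret b => rfl
  | value S next ih => exact ih (f S)
  | member S next ih => exact ih (mem S)
  | arith t next ih => exact ih

@[simp] theorem oracleCalls_bind (p : Prog n β) (g : β → Prog n γ) :
    (p >>= g).oracleCalls f mem =
      p.oracleCalls f mem + (g (p.eval f mem)).oracleCalls f mem := by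
  change (Prog.bind p g).oracleCalls f mem = _
  induction p with
  | ret b => simp [Prog.bind, oracleCalls, eval]
  | value S next ih => simp [Prog.bind, oracleCalls, eval, ih, add_assoc]
  | member S next ih => simp [Prog.bind, oracleCalls, eval, ih, add_assoc]
  | arith t next ih => simp [Prog.bind, oracleCalls, eval, ih]

@[simp] theorem arithOps_bind (p : Prog n β) (g : β → Prog n γ) :
    (p >>= g).arithOps f mem = p.arithOps f mem + (g (p.eval f mem)).arithOps f mem := by
  change (Prog.bind p g).arithOps f mem = _
  induction p with
  | ret b => simp [Prog.bind, arithOps, eval]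
  | value S next ih => simp [Prog.bind, arithOps, eval, ih]
  | member S next ih => simp [Prog.bind, arithOps, eval, ih]
  | arith t next ih => simp [Prog.bind, arithOps, eval, ih, add_assoc]

theorem eval_foldlM {σ α : Type} (step : σ → α → Prog n σ) (L : List α) (s : σ) :
    (L.foldlM step s).eval f mem = L.foldl (fun s a => (step s a).eval f mem) s := by
  induction L generalizing s with
  | nil => rfl
  | cons a L ih => simp [List.foldlM_cons, ih]

theorem oracleCalls_foldlM_le {σ α : Type} (step : σ → α → Prog n σ) (L : List α) (s : σ) (t : ℕ)
    (h : ∀ s, ∀ a ∈ L, (step s a).oracleCalls f mem ≤ t) :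
    (L.foldlM step s).oracleCalls f mem ≤ L.length * t := by
  induction L generalizing s with
  | nil => simp
  | cons a L ih =>
    have h1 := h s a (by simp)
    have h2 := ih ((step s a).eval f mem) fun s a ha => h s a (by simp [ha])
    simp only [List.foldlM_cons, oracleCalls_bind, List.length_cons, add_mul, one_mul]
    omega

theorem arithOps_foldlM_le {σ α : Type} (step : σ → α → Prog n σ) (L : List α) (s : σ) (t : ℕ)
    (h : ∀ s, ∀ a ∈ L, (step s a).arithOps f mem ≤ t) :
    (L.foldlM step s).arithOps f mem ≤ L.length * t := by
  induction L generalizing s with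
  | nil => simp
  | cons a L ih =>
    have h1 := h s a (by simp)
    have h2 := ih ((step s a).eval f mem) fun s a ha => h s a (by simp [ha])
    simp only [List.foldlM_cons, arithOps_bind, List.length_cons, add_mul, one_mul]
    omega

end Prog

/-- A property that holds initially, and is preserved by every step, holds after a fold. -/
theorem foldl_invariant {σ α : Type} (I : σ → Prop) (step : σ → α → σ) (L : List α) (s : σ)
    (h0 : I s) (h : ∀ s, ∀ a ∈ L, I s → I (step s a)) : I (L.foldl step s) := by
  induction L generalizing s with
  | nil => exact h0
  | cons a L ih =>
    exact ih _ (h s a (by simp) h0) fun s b hb => h s b (by simp [hb])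

/-- What a step establishes for its element, and later steps preserve, holds for all elements
after a fold. -/
theorem foldl_forall {σ α : Type} (I : σ → Prop) (Q : σ → α → Prop) (step : σ → α → σ) (L : List α)
    (s : σ) (h0 : I s) (hI : ∀ s a, I s → I (step s a)) (hQ : ∀ s a, I s → Q (step s a) a)
    (hpres : ∀ s a b, I s → Q s b → Q (step s a) b) : ∀ a ∈ L, Q (L.foldl step s) a := by
  induction L generalizing s with
  | nil => simp
  | cons a L ih =>
    intro b hb
    rcases List.mem_cons.1 hb with rfl | hb
    · exact (foldl_invariant (fun s => I s ∧ Q s b) step L _ ⟨hI _ _ h0, hQ _ _ h0⟩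
        fun s a _ hs => ⟨hI _ _ hs.1, hpres _ _ _ hs.1 hs.2⟩).2
    · exact ih _ (hI _ _ h0) b hb

/-! ### Selecting a set of largest score -/

section argmax

variable {n : ℕ} (f : Finset (Fin n) → ℝ) (mem : Finset (Fin n) → Bool)

/-- Folding a step that keeps the better one of two scored sets yields a set of largest score. -/
theorem foldl_best {α : Type} (sc : α → ℝ) (step : Option (α × ℝ) → α → Option (α × ℝ))
    (hnone : ∀ S, step none S = some (S, sc S))
    (hlt : ∀ T w S, w < sc S → step (some (T, w)) S = some (S, sc S))
    (hge : ∀ T w S, sc S ≤ w → step (some (T, w)) S = some (T, w)) (L : List α) :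
    (L.foldl step none = none ∧ L = []) ∨
      ∃ S ∈ L, L.foldl step none = some (S, sc S) ∧ ∀ T ∈ L, sc T ≤ sc S := by
  -- After the first element there is always an incumbent, so the induction runs over an arbitrary
  -- one.
  have key : ∀ (L : List α) (T₀ : α), ∃ S, L.foldl step (some (T₀, sc T₀)) = some (S, sc S) ∧
      (S = T₀ ∨ S ∈ L) ∧ sc T₀ ≤ sc S ∧ ∀ T ∈ L, sc T ≤ sc S := by
    intro L
    induction L with
    | nil => exact fun T₀ => ⟨T₀, rfl, Or.inl rfl, le_rfl, by simp⟩
    | cons S L ih =>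
      intro T₀
      rw [List.foldl_cons]
      rcases lt_or_ge (sc T₀) (sc S) with h | h
      · obtain ⟨R, h1, h2, h3, h4⟩ := ih S
        refine ⟨R, by rw [hlt _ _ _ h, h1], Or.inr ?_, h.le.trans h3, ?_⟩
        · rcases h2 with rfl | h2 <;> simp [*]
        · intro T hT
          rcases List.mem_cons.1 hT with rfl | hT
          exacts [h3, h4 T hT]
      · obtain ⟨R, h1, h2, h3, h4⟩ := ih T₀
        refine ⟨R, by rw [hge _ _ _ h, h1], h2.imp id fun h => List.mem_cons_of_mem _ h, h3, ?_⟩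
        intro T hT
        rcases List.mem_cons.1 hT with rfl | hT
        exacts [h.trans h3, h4 T hT]
  cases L with
  | nil => exact Or.inl ⟨rfl, rfl⟩
  | cons S L =>
    obtain ⟨R, h1, h2, h3, h4⟩ := key L S
    refine Or.inr ⟨R, ?_, by rw [List.foldl_cons, hnone, h1], ?_⟩
    · rcases h2 with rfl | h2 <;> simp [*]
    · intro T hT
      rcases List.mem_cons.1 hT with rfl | hT
      exacts [h3, h4 T hT]

theorem argmax_spec (score : Finset (Fin n) → Prog n ℝ) (sc : Finset (Fin n) → ℝ)
    (hsc : ∀ S, (score S).eval f mem = sc S) (L : List (Finset (Fin n))) :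
    ((argmax score L).eval f mem = none ∧ L = []) ∨
      ∃ S ∈ L, (argmax score L).eval f mem = some S ∧ ∀ T ∈ L, sc T ≤ sc S := by
  unfold argmax
  rw [eval_bind, eval_foldlM, eval_pure]
  have H : ∀ step, (∀ S, step none S = some (S, sc S)) →
      (∀ T w S, w < sc S → step (some (T, w)) S = some (S, sc S)) →
      (∀ T w S, sc S ≤ w → step (some (T, w)) S = some (T, w)) →
      ((L.foldl step none).map Prod.fst = none ∧ L = []) ∨
        ∃ S ∈ L, (L.foldl step none).map Prod.fst = some S ∧ ∀ T ∈ L, sc T ≤ sc S := by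
    intro step h1 h2 h3
    rcases foldl_best sc step h1 h2 h3 L with ⟨h, h'⟩ | ⟨S, hS, h, h'⟩
    · exact Or.inl ⟨by rw [h]; rfl, h'⟩
    · exact Or.inr ⟨S, hS, by rw [h]; rfl, h'⟩
  refine H _ ?_ ?_ ?_
  · intro S
    simp [hsc]
  · intro T w S h
    simp [hsc, h]
  · intro T w S h
    simp [hsc, not_lt.2 h]

theorem oracleCalls_argmax_le (score : Finset (Fin n) → Prog n ℝ) (L : List (Finset (Fin n)))
    (t : ℕ) (h : ∀ S, (score S).oracleCalls f mem ≤ t) :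
    (argmax score L).oracleCalls f mem ≤ L.length * t := by
  unfold argmax
  simp only [oracleCalls_bind, oracleCalls_pure, add_zero]
  refine oracleCalls_foldlM_le _ _ _ _ _ _ fun best S _ => ?_
  rcases best with _ | ⟨T, w⟩
  · simpa using h S
  · simp only [oracleCalls_bind, oracleCalls_charge]
    split_ifs <;> simpa using h S

theorem arithOps_argmax_le (score : Finset (Fin n) → Prog n ℝ) (L : List (Finset (Fin n)))
    (t : ℕ) (h : ∀ S, (score S).arithOps f mem ≤ t) :
    (argmax score L).arithOps f mem ≤ L.length * (t + 1) := by
  unfold argmax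
  simp only [arithOps_bind, arithOps_pure, add_zero]
  refine arithOps_foldlM_le _ _ _ _ _ _ fun best S _ => ?_
  rcases best with _ | ⟨T, w⟩
  · simpa using h S
  · simp only [arithOps_bind, arithOps_charge]
    split_ifs <;> simpa using h S

end argmax

/-! ### Submodular functions: averaging and greedy subsets -/

namespace IsSubmodular

variable {n : ℕ} {f : Finset (Fin n) → ℝ}

theorem union_sub_le (hf : IsSubmodular f) {A B : Finset (Fin n)} (hAB : A ⊆ B)
    (T : Finset (Fin n)) (hT : Disjoint T B) : f (B ∪ T) - f B ≤ f (A ∪ T) - f A := by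
  induction T using Finset.induction_on with
  | empty => simp
  | insert e T he ih =>
    rw [Finset.disjoint_insert_left] at hT
    have h1 := ih hT.2
    have h2 := hf (A ∪ T) (B ∪ T) (Finset.union_subset_union_left hAB) e (by simp [he, hT.1])
    rw [Finset.union_insert, Finset.union_insert]
    linarith

theorem union_add_inter_le (hf : IsSubmodular f) (A B : Finset (Fin n)) :
    f (A ∪ B) + f (A ∩ B) ≤ f A + f B := by
  have h := hf.union_sub_le (A := A ∩ B) (B := B) Finset.inter_subset_right (A \ B)
    Finset.sdiff_disjoint
  have h1 : B ∪ A \ B = A ∪ B := by rw [Finset.union_sdiff_self_eq_union, Finset.union_comm]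
  have h2 : A ∩ B ∪ A \ B = A := by
    rw [Finset.union_comm]; exact Finset.sdiff_union_inter A B
  rw [h1, h2] at h
  linarith

theorem union_sub_le_sum (hf : IsSubmodular f) (A B : Finset (Fin n)) :
    f (A ∪ B) - f A ≤ ∑ e ∈ B \ A, (f (insert e A) - f A) := by
  rw [← Finset.union_sdiff_self_eq_union]
  have h : ∀ T : Finset (Fin n), Disjoint T A →
      f (A ∪ T) - f A ≤ ∑ e ∈ T, (f (insert e A) - f A) := by
    intro T hT
    induction T using Finset.induction_on with
    | empty => simp
    | insert e T he ih =>
      rw [Finset.disjoint_insert_left] at hT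
      have h2 := hf A (A ∪ T) Finset.subset_union_left e (by simp [he, hT.1])
      rw [Finset.sum_insert he, Finset.union_insert]
      linarith [ih hT.2]
  exact h _ Finset.sdiff_disjoint

/-- Averaging over disjoint sets loses at most one copy of the objective. -/
theorem card_mul_le_sum_union (hf : IsSubmodular f) (hf0 : ∀ S, 0 ≤ f S) {ι : Type*}
    (I : Finset ι) (X : Finset (Fin n)) (S : ι → Finset (Fin n))
    (hS : ∀ i j, i ≠ j → Disjoint (S i) (S j)) :
    ((I.card : ℝ) - 1) * f X ≤ ∑ i ∈ I, f (X ∪ S i) := by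
  classical
  -- The induction needs the value of `X` joined with all the sets; only at the end is it dropped by
  -- nonnegativity. In the step, two sets that meet exactly in `X` are uncrossed.
  suffices h : I.card * f X + f (X ∪ I.biUnion S) ≤ ∑ i ∈ I, f (X ∪ S i) + f X by
    linarith [hf0 (X ∪ I.biUnion S)]
  induction I using Finset.induction_on with
  | empty => simp
  | insert i I hi ih =>
    have h := hf.union_add_inter_le (X ∪ S i) (X ∪ I.biUnion S)
    have h1 : (X ∪ S i) ∩ (X ∪ I.biUnion S) = X := by
      rw [← Finset.union_inter_distrib_left]
      have : S i ∩ I.biUnion S = ∅ := by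
        rw [← Finset.disjoint_iff_inter_eq_empty, Finset.disjoint_biUnion_right]
        exact fun j hj => hS i j fun h => hi (h ▸ hj)
      simp [this]
    have h2 : (X ∪ S i) ∪ (X ∪ I.biUnion S) = X ∪ (insert i I).biUnion S := by
      rw [Finset.biUnion_insert]
      ext; simp; tauto
    rw [h1, h2] at h
    rw [Finset.card_insert_of_notMem hi, Finset.sum_insert hi]
    push_cast
    linarith

/-- Greedily chosen subsets of `O`. -/
theorem exists_greedy (hf : IsSubmodular f) (O : Finset (Fin n)) (C : ℕ) (hC : C ≤ O.card) :
    ∃ A ⊆ O, A.card = C ∧ ∃ g, C * g ≤ f A - f ∅ ∧ ∀ e ∈ O \ A, f (insert e A) - f A ≤ g := by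
  induction C with
  | zero =>
    -- With nothing chosen, `0 * g` imposes no condition, so any upper bound for the finitely many
    -- marginals will do.
    obtain ⟨g, hg⟩ := ((Set.toFinite (O : Set (Fin n))).image
      fun e => f (insert e ∅) - f ∅).bddAbove
    refine ⟨∅, by simp, by simp, g, by simp, fun e he => hg ⟨e, ?_, rfl⟩⟩
    simpa using he
  | succ C ih =>
    obtain ⟨A, hA, hcard, g, hg, hle⟩ := ih (by omega)
    have hne : (O \ A).Nonempty := by
      rw [← Finset.card_pos, Finset.card_sdiff_of_subset hA]; omega
    obtain ⟨e, he, hmax⟩ := Finset.exists_max_image (O \ A) (fun e => f (insert e A) - f A) hne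
    rw [Finset.mem_sdiff] at he
    -- The new `g` is the increment just gained. It does not exceed the old one, so the earlier
    -- increments still pay for `C` copies of it.
    refine ⟨insert e A, Finset.insert_subset he.1 hA, by simp [he.2, hcard],
      f (insert e A) - f A, ?_, fun e' he' => ?_⟩
    · have h1 := hle e (by simp [he])
      have : (C : ℝ) * (f (insert e A) - f A) ≤ C * g := by gcongr
      push_cast
      linarith
    · rw [Finset.mem_sdiff, Finset.mem_insert, not_or] at he'
      have h1 := hmax e' (by simp [he'])
      have h2 := hf A (insert e A) (Finset.subset_insert _ _) e' (by simp [he'])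
      exact h2.trans h1

/-- A set of `C` elements of `O` that has a proportional share of the value of `O`, and in view
of which the other elements of `O` have small marginal values. -/
theorem exists_share (hf : IsSubmodular f) (hf0 : ∀ S, 0 ≤ f S) (O : Finset (Fin n)) (C : ℕ)
    (hC : C ≤ O.card) :
    ∃ A ⊆ O, A.card = C ∧ C * f O ≤ O.card * f A ∧
      ∀ e ∈ O \ A, C * (f (insert e A) - f A) ≤ f A := by
  obtain ⟨A, hA, hcard, g, hg, hle⟩ := hf.exists_greedy O C hC
  refine ⟨A, hA, hcard, ?_, fun e he => ?_⟩
  -- The missing `r - C` elements of `O` add at most `g` each, and `C * g ≤ f A`; hence `C (f O - f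
  -- A) ≤ (r - C) f A`.
  · have h1 := hf.union_sub_le_sum A O
    rw [Finset.union_eq_right.2 hA] at h1
    have h2 : ∑ e ∈ O \ A, (f (insert e A) - f A) ≤ (O.card - C : ℝ) * g := by
      refine (Finset.sum_le_card_nsmul _ _ g hle).trans ?_
      rw [Finset.card_sdiff_of_subset hA, nsmul_eq_mul, hcard, Nat.cast_sub hC]
    have h3 : (O.card - C : ℝ) * (C * g) ≤ (O.card - C : ℝ) * f A := by
      have : (C : ℝ) ≤ O.card := by exact_mod_cast hC
      exact mul_le_mul_of_nonneg_left (by linarith [hf0 ∅]) (by linarith)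
    have h4 : (C : ℝ) * (f O - f A) ≤ C * ((O.card - C : ℝ) * g) := by
      gcongr
      linarith
    nlinarith
  · have : (C : ℝ) * (f (insert e A) - f A) ≤ C * g := by gcongr; exact hle e he
    linarith [hf0 ∅]

end IsSubmodular

/-- Elements of an independent set `A ∪ O` that cannot be added to `A ∪ S`. -/
theorem card_blocked_le {n : ℕ} (M : Matroid (Fin n)) (A O S T : Finset (Fin n))
    (hAO : M.Indep (↑(A ∪ O) : Set (Fin n))) (hAS : M.Indep (↑(A ∪ S) : Set (Fin n)))
    (hdO : Disjoint A O) (hdS : Disjoint A S) (hT : T ⊆ O \ S)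
    (hdep : ∀ o ∈ T, ¬ M.Indep (↑(A ∪ insert o S) : Set (Fin n))) :
    T.card ≤ (S \ O).card := by
  classical
  -- Otherwise `A ∪ T ∪ (O ∩ S)`, independent as a part of `A ∪ O`, is larger than `A ∪ S`. The
  -- exchange axiom then adds to `A ∪ S` a new element, which can only come from `T`.
  by_contra! hlt
  have hTO : T ⊆ O := hT.trans Finset.sdiff_subset
  have hTS : Disjoint T S := by
    rw [Finset.disjoint_left]
    exact fun x hx => (Finset.mem_sdiff.1 (hT hx)).2
  have hJ : M.Indep (↑(A ∪ (T ∪ O ∩ S)) : Set (Fin n)) := by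
    refine hAO.subset ?_
    rw [Finset.coe_subset]
    exact Finset.union_subset_union_right (Finset.union_subset hTO Finset.inter_subset_left)
  have hcard : (A ∪ S).card < (A ∪ (T ∪ O ∩ S)).card := by
    rw [Finset.card_union_of_disjoint hdS, Finset.card_union_of_disjoint,
      Finset.card_union_of_disjoint, Finset.inter_comm]
    · have := Finset.card_sdiff_add_card_inter S O
      omega
    · exact hTS.mono_right Finset.inter_subset_right
    · exact hdO.mono_right (Finset.union_subset hTO Finset.inter_subset_left)
  obtain ⟨e, he, hind⟩ := hAS.augment hJ (by
    rw [Set.encard_coe_eq_coe_finsetCard, Set.encard_coe_eq_coe_finsetCard]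
    exact_mod_cast hcard)
  have he' : e ∈ T := by
    simp only [Set.mem_sdiff, Finset.mem_coe, Finset.mem_union, Finset.mem_inter] at he
    tauto
  apply hdep e he'
  rw [Finset.union_insert, Finset.coe_insert]
  exact hind

/-! ### The subroutine: structural invariant and violated knapsacks -/

section SGS

variable {n m ℓ : ℕ} {f : Finset (Fin n) → ℝ} {om : Finset (Fin n) → Bool}
  {z : Finset (Fin n) → Prog n ℝ} {mem : Finset (Fin n) → Prog n Bool}
  {zf : Finset (Fin n) → ℝ} {mf : Finset (Fin n) → Bool}
  {c' : Fin m → Fin n → ℝ≥0∞} {N' O : Finset (Fin n)} {ρ τ v₀ : ℝ}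

/-- The state after `a` has been added to the `i`-th candidate solution. -/
def SGSState.add (c' : Fin m → Fin n → ℝ≥0∞) (s : SGSState n m ℓ) (a : Fin n) (i : Fin ℓ) :
    SGSState n m ℓ where
  sol := Function.update s.sol i (insert a (s.sol i))
  load := Function.update s.load i fun j => s.load i j + c' j a
  avail := s.avail.erase a
  viol := s.viol

/-- The pair `(a, i)` passes the test of the subroutine. -/
def Passes (zf : Finset (Fin n) → ℝ) (mf : Finset (Fin n) → Bool) (c' : Fin m → Fin n → ℝ≥0∞)
    (ρ τ : ℝ) (s : SGSState n m ℓ) (a : Fin n) (i : Fin ℓ) : Prop :=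
  a ∈ s.avail ∧ mf (insert a (s.sol i)) = true ∧ τ ≤ zf (insert a (s.sol i)) - zf (s.sol i) ∧
    ENNReal.ofReal ρ * ∑ j, c' j a ≤ ENNReal.ofReal (zf (insert a (s.sol i)) - zf (s.sol i))

/-- The invariants below rest on this trichotomy alone: no change, an addition, or a recorded
violation that leaves the solutions and the available elements as they are. -/
theorem sgsStep_cases (hz : ∀ S, (z S).eval f om = zf S) (hm : ∀ S, (mem S).eval f om = mf S)
    (s : SGSState n m ℓ) (q : Fin n × Fin ℓ) :
    (¬ Passes zf mf c' ρ τ s q.1 q.2 ∧ (sgsStep z mem c' ρ τ s q).eval f om = s) ∨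
    (Passes zf mf c' ρ τ s q.1 q.2 ∧ (∀ j, s.load q.2 j + c' j q.1 ≤ 1) ∧
      (sgsStep z mem c' ρ τ s q).eval f om = s.add c' q.1 q.2) ∨
    (Passes zf mf c' ρ τ s q.1 q.2 ∧ (∃ j, 1 < s.load q.2 j + c' j q.1) ∧
      (sgsStep z mem c' ρ τ s q).eval f om = { s with viol := true }) := by
  unfold sgsStep Passes
  by_cases h1 : q.1 ∈ s.avail
  · by_cases h2 : mf (insert q.1 (s.sol q.2)) = true ∧
        τ ≤ zf (insert q.1 (s.sol q.2)) - zf (s.sol q.2) ∧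
        ENNReal.ofReal ρ * ∑ j, c' j q.1 ≤
          ENNReal.ofReal (zf (insert q.1 (s.sol q.2)) - zf (s.sol q.2))
    · rw [if_pos h1]
      simp only [eval_bind, hz, hm]
      rw [if_pos h2]
      simp only [eval_bind]
      by_cases h3 : ∀ j, s.load q.2 j + c' j q.1 ≤ 1
      · exact Or.inr (Or.inl ⟨⟨h1, h2⟩, h3, by rw [if_pos h3]; rfl⟩)
      · exact Or.inr (Or.inr ⟨⟨h1, h2⟩, by simpa using h3, by rw [if_neg h3]; rfl⟩)
    · refine Or.inl ⟨fun h => h2 h.2, ?_⟩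
      rw [if_pos h1]
      simp only [eval_bind, hz, hm]
      rw [if_neg h2]
      rfl
  · exact Or.inl ⟨fun h => h1 h.1, by rw [if_neg h1]; rfl⟩

/-- The structural invariant of the subroutine. -/
structure SGSInv (zf : Finset (Fin n) → ℝ) (mf : Finset (Fin n) → Bool)
    (c' : Fin m → Fin n → ℝ≥0∞) (N' : Finset (Fin n)) (ρ v₀ : ℝ) (s : SGSState n m ℓ) : Prop where
  sub : ∀ i, s.sol i ⊆ N'
  disj : ∀ i j, i ≠ j → Disjoint (s.sol i) (s.sol j)
  avail_sub : s.avail ⊆ N'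
  avail_disj : ∀ i, Disjoint (s.sol i) s.avail
  cover : ∀ e ∈ N', e ∉ s.avail → ∃ i, e ∈ s.sol i
  indep : ∀ i, mf (s.sol i) = true
  load_eq : ∀ i j, s.load i j = ∑ e ∈ s.sol i, c' j e
  load_le : ∀ i j, s.load i j ≤ 1
  nonneg : ∀ i, 0 ≤ zf (s.sol i)
  density : ∀ i, ENNReal.ofReal ρ * ∑ j, s.load i j ≤ ENNReal.ofReal (zf (s.sol i))
  viol : s.viol = true → ∃ i, ρ - v₀ ≤ zf (s.sol i)

theorem SGSInv.init (h0 : zf ∅ = 0) (hm0 : mf ∅ = true) :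
    SGSInv (ℓ := ℓ) zf mf c' N' ρ v₀
      { sol := fun _ => ∅, load := fun _ _ => 0, avail := N', viol := false } where
  sub := by simp
  disj := by simp
  avail_sub := subset_rfl
  avail_disj := by simp
  cover := fun e h h' => absurd h h'
  indep := fun _ => hm0
  load_eq := by simp
  load_le := by simp
  nonneg := by simp [h0]
  density := by simp
  viol := by simp

/-- The density inequality of the old set and that of the new marginal value add up. The knapsack
check plays no role, so this also applies to an element that is then rejected. -/
theorem Passes.density_add {s : SGSState n m ℓ} {a : Fin n} {i : Fin ℓ} (hτ : 0 ≤ τ)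
    (hp : Passes zf mf c' ρ τ s a i) (hs : SGSInv zf mf c' N' ρ v₀ s) :
    ENNReal.ofReal ρ * ∑ j, (s.load i j + c' j a) ≤
      ENNReal.ofReal (zf (insert a (s.sol i))) := by
  have h1 := add_le_add (hs.density i) hp.2.2.2
  rw [← ENNReal.ofReal_add (hs.nonneg i) (hτ.trans hp.2.2.1)] at h1
  rw [Finset.sum_add_distrib, mul_add]
  simpa using h1

theorem SGSInv.add {s : SGSState n m ℓ} {a : Fin n} {i : Fin ℓ} (hτ : 0 ≤ τ)
    (hs : SGSInv zf mf c' N' ρ v₀ s) (hp : Passes zf mf c' ρ τ s a i)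
    (hl : ∀ j, s.load i j + c' j a ≤ 1) : SGSInv zf mf c' N' ρ v₀ (s.add c' a i) := by
  have ha : a ∈ N' := hs.avail_sub hp.1
  have hna : ∀ j, a ∉ s.sol j := fun j h => Finset.disjoint_left.1 (hs.avail_disj j) h hp.1
  have hz0 : 0 ≤ zf (insert a (s.sol i)) := by linarith [hs.nonneg i, hp.2.2.1]
  constructor
  · intro j
    by_cases h : j = i
    · subst h; simpa [SGSState.add, Finset.insert_subset_iff, ha] using hs.sub j
    · simpa [SGSState.add, h] using hs.sub j
  · intro j j' hjj
    by_cases h : j = i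
    · subst h
      simpa [SGSState.add, hjj.symm, hna] using hs.disj _ _ hjj
    · by_cases h' : j' = i
      · subst h'
        simpa [SGSState.add, h, hna] using hs.disj _ _ hjj
      · simpa [SGSState.add, h, h'] using hs.disj _ _ hjj
  · exact (Finset.erase_subset _ _).trans hs.avail_sub
  · intro j
    have h2 := (hs.avail_disj j).mono_right (Finset.erase_subset a s.avail)
    by_cases h : j = i
    · subst h; simpa [SGSState.add] using h2
    · simpa [SGSState.add, h] using h2
  · intro e he he'
    by_cases h : e = a
    · exact ⟨i, by simp [SGSState.add, h]⟩
    · obtain ⟨j, hj⟩ := hs.cover e he (by simpa [SGSState.add, h] using he')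
      refine ⟨j, ?_⟩
      by_cases h : j = i
      · subst h; simp [SGSState.add, hj]
      · simp [SGSState.add, h, hj]
  · intro j
    by_cases h : j = i
    · subst h; simpa [SGSState.add] using hp.2.1
    · simpa [SGSState.add, h] using hs.indep j
  · intro j t
    by_cases h : j = i
    · subst h; simp [SGSState.add, Finset.sum_insert (hna j), hs.load_eq, add_comm]
    · simp [SGSState.add, h, hs.load_eq]
  · intro j t
    by_cases h : j = i
    · subst h; simpa [SGSState.add] using hl t
    · simpa [SGSState.add, h] using hs.load_le j t
  · intro j
    by_cases h : j = i
    · subst h; simpa [SGSState.add] using hz0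
    · simpa [SGSState.add, h] using hs.nonneg j
  · intro j
    by_cases h : j = i
    · subst h; simpa [SGSState.add] using hp.density_add hτ hs
    · simpa [SGSState.add, h] using hs.density j
  · intro hv
    obtain ⟨j, hj⟩ := hs.viol hv
    refine ⟨j, hj.trans ?_⟩
    by_cases h : j = i
    · subst h; simp only [SGSState.add, Function.update_self]; linarith [hp.2.2.1]
    · simp [SGSState.add, h]

/-- The rejected set costs more than 1, so at density ρ it is worth at least ρ. Without the new
element it loses one marginal value, which by submodularity is at most a singleton value, hence at
most `v₀`. -/
theorem SGSInv.violate {s : SGSState n m ℓ} {a : Fin n} {i : Fin ℓ} (hτ : 0 ≤ τ)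
    (hsub : IsSubmodular zf) (h0 : zf ∅ = 0) (hv : ∀ e ∈ N', zf {e} ≤ v₀)
    (hs : SGSInv zf mf c' N' ρ v₀ s) (hp : Passes zf mf c' ρ τ s a i)
    (hl : ∃ j, 1 < s.load i j + c' j a) : SGSInv zf mf c' N' ρ v₀ { s with viol := true } := by
  have hna : a ∉ s.sol i := fun h => Finset.disjoint_left.1 (hs.avail_disj i) h hp.1
  refine { hs with viol := fun _ => ⟨i, ?_⟩ }
  have h1 : zf (insert a (s.sol i)) - zf (s.sol i) ≤ v₀ := by
    refine le_trans ?_ (hv a (hs.avail_sub hp.1))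
    have := hsub ∅ (s.sol i) (by simp) a hna
    simpa [h0] using this
  suffices h : ρ ≤ zf (insert a (s.sol i)) by simp only; linarith
  have hz0 : 0 ≤ zf (insert a (s.sol i)) := by linarith [hs.nonneg i, hp.2.2.1]
  obtain ⟨j, hj⟩ := hl
  rw [← ENNReal.ofReal_le_ofReal_iff hz0]
  refine le_trans ?_ (hp.density_add hτ hs)
  refine le_mul_of_one_le_right (by simp) (hj.le.trans ?_)
  exact Finset.single_le_sum (f := fun j => s.load i j + c' j a) (fun _ _ => by simp)
    (Finset.mem_univ j)

theorem SGSInv.step (hz : ∀ S, (z S).eval f om = zf S) (hm : ∀ S, (mem S).eval f om = mf S)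
    (hτ : 0 ≤ τ) (hsub : IsSubmodular zf) (h0 : zf ∅ = 0) (hv : ∀ e ∈ N', zf {e} ≤ v₀)
    {s : SGSState n m ℓ} (hs : SGSInv zf mf c' N' ρ v₀ s) (q : Fin n × Fin ℓ) :
    SGSInv zf mf c' N' ρ v₀ ((sgsStep z mem c' ρ τ s q).eval f om) := by
  rcases sgsStep_cases (c' := c') (ρ := ρ) (τ := τ) hz hm s q with ⟨-, h⟩ | ⟨hp, hl, h⟩ | ⟨hp, hl, h⟩
  · rwa [h]
  · rw [h]; exact hs.add hτ hp hl
  · rw [h]; exact hs.violate hτ hsub h0 hv hp hl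

/-! #### Counting blocked elements -/

/-- Elements of `O` that can no longer be added to the `i`-th candidate solution, being either
used or in conflict with it. -/
def SGSState.blocked (mf : Finset (Fin n) → Bool) (O : Finset (Fin n)) (s : SGSState n m ℓ)
    (i : Fin ℓ) : Finset (Fin n) :=
  O.filter fun o => o ∉ s.sol i ∧ (o ∉ s.avail ∨ mf (insert o (s.sol i)) = false)

/-- `O` conflicts with an independent set `S` in at most `k` elements for each member of
`S \ O`. -/
def ConflictBound (mf : Finset (Fin n) → Bool) (N' O : Finset (Fin n)) (k : ℕ) : Prop :=
  ∀ S T : Finset (Fin n), S ⊆ N' → mf S = true → T ⊆ O \ S →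
    (∀ o ∈ T, mf (insert o S) = false) → T.card ≤ k * (S \ O).card

/-- Losses by use are charged to the chosen elements inside `O`, at `ℓ - 1` each, and matroid
conflicts to those outside `O`, at `k` each. These are different elements, so the maximum of the two
rates suffices instead of their sum. -/
theorem SGSInv.sum_card_blocked_le {k : ℕ} (hc : ConflictBound mf N' O k) (hO : O ⊆ N')
    {s : SGSState n m ℓ} (hs : SGSInv zf mf c' N' ρ v₀ s) :
    ∑ i, (s.blocked mf O i).card ≤ max (ℓ - 1) k * ∑ i, (s.sol i).card := by
  have h1 : ∀ i, (s.blocked mf O i).card ≤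
      (O.filter fun o => o ∉ s.sol i ∧ o ∉ s.avail).card + k * (s.sol i \ O).card := by
    intro i
    refine le_trans ?_ (Nat.add_le_add_left (hc (s.sol i)
      (O.filter fun o => o ∉ s.sol i ∧ mf (insert o (s.sol i)) = false) (hs.sub i) (hs.indep i)
      ?_ ?_) _)
    · refine le_trans (Finset.card_le_card ?_) (Finset.card_union_le _ _)
      intro o
      simp only [SGSState.blocked, Finset.mem_filter, Finset.mem_union]
      tauto
    · intro o
      simp only [Finset.mem_filter, Finset.mem_sdiff]
      tauto
    · intro o
      simp only [Finset.mem_filter]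
      tauto
  have h2 : ∀ i, (O.filter fun o => o ∉ s.sol i ∧ o ∉ s.avail).card + (s.sol i ∩ O).card =
      (O \ s.avail).card := by
    intro i
    rw [← Finset.card_union_of_disjoint]
    · congr 1
      ext o
      have : o ∈ s.sol i → o ∉ s.avail := fun h => Finset.disjoint_left.1 (hs.avail_disj i) h
      simp only [Finset.mem_filter, Finset.mem_union, Finset.mem_inter, Finset.mem_sdiff]
      tauto
    · rw [Finset.disjoint_left]
      intro o
      simp only [Finset.mem_filter, Finset.mem_inter]
      tauto
  have h3 : (O \ s.avail).card ≤ ∑ i, (s.sol i ∩ O).card := by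
    refine le_trans (Finset.card_le_card ?_) Finset.card_biUnion_le
    intro o ho
    rw [Finset.mem_sdiff] at ho
    obtain ⟨i, hi⟩ := hs.cover o (hO ho.1) ho.2
    exact Finset.mem_biUnion.2 ⟨i, Finset.mem_univ _, Finset.mem_inter.2 ⟨hi, ho.1⟩⟩
  -- Over all `i`, each used element of `O` is counted `ℓ` times, and the pairs in which the
  -- solution contains it are subtracted; by `h3` the used elements are no more than those pairs.
  have h4 : ∑ i, (O.filter fun o => o ∉ s.sol i ∧ o ∉ s.avail).card ≤
      (ℓ - 1) * ∑ i, (s.sol i ∩ O).card := by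
    have h5 : ∑ i, (O.filter fun o => o ∉ s.sol i ∧ o ∉ s.avail).card +
        ∑ i, (s.sol i ∩ O).card = ℓ * (O \ s.avail).card := by
      rw [← Finset.sum_add_distrib, Finset.sum_congr rfl fun i _ => h2 i]
      simp
    rcases ℓ with _ | ℓ
    · simp
    · have := Nat.mul_le_mul_left (ℓ + 1) h3
      rw [Nat.add_sub_cancel]
      rw [add_mul, one_mul] at this h5
      have := Nat.mul_le_mul_left ℓ h3
      omega
  calc ∑ i, (s.blocked mf O i).card
      ≤ (ℓ - 1) * ∑ i, (s.sol i ∩ O).card + k * ∑ i, (s.sol i \ O).card := by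
        refine (Finset.sum_le_sum fun i _ => h1 i).trans ?_
        rw [Finset.sum_add_distrib, ← Finset.mul_sum]
        exact Nat.add_le_add_right h4 _
    _ ≤ max (ℓ - 1) k * ∑ i, (s.sol i ∩ O).card + max (ℓ - 1) k * ∑ i, (s.sol i \ O).card :=
        Nat.add_le_add (Nat.mul_le_mul_right _ (le_max_left _ _))
          (Nat.mul_le_mul_right _ (le_max_right _ _))
    _ = max (ℓ - 1) k * ∑ i, (s.sol i).card := by
        rw [← mul_add, ← Finset.sum_add_distrib]
        congr 1
        exact Finset.sum_congr rfl fun i _ => by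
          rw [add_comm]; exact Finset.card_sdiff_add_card_inter _ _

end SGS

/-! ### The potential argument for runs without violation -/

section Potential

variable {n m ℓ : ℕ} {f : Finset (Fin n) → ℝ} {om : Finset (Fin n) → Bool}
  {z : Finset (Fin n) → Prog n ℝ} {mem : Finset (Fin n) → Prog n Bool}
  {zf : Finset (Fin n) → ℝ} {mf : Finset (Fin n) → Bool}
  {c' : Fin m → Fin n → ℝ≥0∞} {N' O : Finset (Fin n)} {ε ρ τ v₀ : ℝ} {k : ℕ}

/-- The total cost of an element, as a real number. -/
def totalCost (c' : Fin m → Fin n → ℝ≥0∞) (o : Fin n) : ℝ := ∑ j, (c' j o).toReal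

theorem totalCost_nonneg (c' : Fin m → Fin n → ℝ≥0∞) (o : Fin n) : 0 ≤ totalCost c' o :=
  Finset.sum_nonneg fun _ _ => ENNReal.toReal_nonneg

theorem sum_totalCost_le (hO : ∀ j, ∑ o ∈ O, c' j o ≤ 1) : ∑ o ∈ O, totalCost c' o ≤ m := by
  unfold totalCost
  rw [Finset.sum_comm]
  have h : ∀ j, ∑ o ∈ O, (c' j o).toReal ≤ 1 := by
    intro j
    rw [← ENNReal.toReal_sum]
    · exact ENNReal.toReal_le_of_le_ofReal zero_le_one (by simpa using hO j)
    · intro o ho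
      have := (Finset.single_le_sum (f := fun o => c' j o) (fun _ _ => by simp) ho).trans (hO j)
      exact (this.trans_lt ENNReal.one_lt_top).ne
  simpa using Finset.sum_le_sum fun j (_ : j ∈ Finset.univ) => h j

/-- The marginal value of `o` reduced by the price of its cost at density `ρ`. -/
def netGain (zf : Finset (Fin n) → ℝ) (c' : Fin m → Fin n → ℝ≥0∞) (ρ : ℝ)
    (S : Finset (Fin n)) (o : Fin n) : ℝ :=
  zf (insert o S) - zf S - ρ * totalCost c' o

theorem netGain_anti (hsub : IsSubmodular zf) {S T : Finset (Fin n)} (h : S ⊆ T) {o : Fin n}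
    (ho : o ∉ T) : netGain zf c' ρ T o ≤ netGain zf c' ρ S o := by
  have := hsub S T h o ho
  unfold netGain
  linarith

/-- The total net gain of the blocked pairs, and the thresholds the remaining additions may still
be charged with, are paid for by the values of the candidate solutions. -/
structure PotentialInv (zf : Finset (Fin n) → ℝ) (mf : Finset (Fin n) → Bool)
    (c' : Fin m → Fin n → ℝ≥0∞) (O : Finset (Fin n)) (ε ρ : ℝ) (p : ℕ) (τ : ℝ)
    (s : SGSState n m ℓ) : Prop where
  bound : (1 - ε) * ∑ i, ∑ o ∈ s.blocked mf O i, max 0 (netGain zf c' ρ (s.sol i) o) +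
      τ * (p * ∑ i, ((s.sol i).card : ℝ) - ∑ i, ((s.blocked mf O i).card : ℝ)) ≤
    p * ∑ i, zf (s.sol i)
  unblocked : ∀ i, ∀ o ∈ O, o ∉ s.sol i → o ∉ s.blocked mf O i →
    (1 - ε) * netGain zf c' ρ (s.sol i) o ≤ τ

/-- Being blocked is permanent. In the solution that grows, a blocked element differs from `a`,
which was available and compatible, and by downward closure a conflict persists. The other solutions
are unchanged, and availability only shrinks. -/
theorem blocked_subset_add {s : SGSState n m ℓ} {a : Fin n} {i : Fin ℓ}
    (hmf : ∀ S, ∀ e, mf (insert e S) = true → mf S = true)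
    (ha : a ∈ s.avail) (hma : mf (insert a (s.sol i)) = true) (j : Fin ℓ) :
    s.blocked mf O j ⊆ (s.add c' a i).blocked mf O j := by
  intro o
  simp only [SGSState.blocked, Finset.mem_filter, SGSState.add, Finset.mem_erase]
  rintro ⟨h1, h2, h3⟩
  by_cases h : j = i
  · subst h
    have hoa : o ≠ a := by
      rintro rfl
      rcases h3 with h3 | h3
      · exact h3 ha
      · rw [h3] at hma; exact absurd hma (by simp)
    refine ⟨h1, by simp [h2, hoa], ?_⟩
    rcases h3 with h3 | h3
    · exact Or.inl fun h => h3 h.2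
    · refine Or.inr ?_
      rw [Function.update_self, Finset.insert_comm]
      by_contra hcon
      rw [Bool.not_eq_false] at hcon
      rw [hmf _ _ hcon] at h3
      exact absurd h3 (by simp)
  · refine ⟨h1, by simpa [h] using h2, ?_⟩
    rw [Function.update_of_ne h]
    tauto

theorem sum_sol_add (s : SGSState n m ℓ) (a : Fin n) (i : Fin ℓ) (g : Finset (Fin n) → ℝ) :
    ∑ j, g ((s.add c' a i).sol j) = ∑ j, g (s.sol j) + (g (insert a (s.sol i)) - g (s.sol i)) := by
  have h : ∀ j, g ((s.add c' a i).sol j) =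
      g (s.sol j) + if j = i then g (insert a (s.sol i)) - g (s.sol i) else 0 := by
    intro j
    by_cases h : j = i
    · subst h; simp [SGSState.add]
    · simp [SGSState.add, h]
  simp [h, Finset.sum_add_distrib]

/-- The right side gains at least `p * τ`, exactly what the cardinality term on the left gains. A
newly blocked element was unblocked before, so its weighted net gain is at most `τ`; it takes `τ`
out of the second term when it enters the first. Net gains of elements blocked earlier only fall, by
submodularity. -/
theorem PotentialInv.add {p : ℕ} (hε : ε < 1) (hsub : IsSubmodular zf)
    (hmf : ∀ S, ∀ e, mf (insert e S) = true → mf S = true) (hτ : 0 ≤ τ)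
    {s : SGSState n m ℓ} {a : Fin n} {i : Fin ℓ} (hs : SGSInv zf mf c' N' ρ v₀ s)
    (hp : Passes zf mf c' ρ τ s a i) (hP : PotentialInv zf mf c' O ε ρ p τ s) :
    PotentialInv zf mf c' O ε ρ p τ (s.add c' a i) := by
  have hε' : 0 ≤ 1 - ε := by linarith
  have hna : a ∉ s.sol i := fun h => Finset.disjoint_left.1 (hs.avail_disj i) h hp.1
  have hbl := blocked_subset_add (O := O) (c' := c') hmf hp.1 hp.2.1
  have hsol : ∀ j, s.sol j ⊆ (s.add c' a i).sol j := by
    intro j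
    by_cases h : j = i
    · subst h; simp [SGSState.add]
    · simp [SGSState.add, h]
  have hun : ∀ j, ∀ o ∈ O, o ∉ (s.add c' a i).sol j → o ∉ s.blocked mf O j →
      (1 - ε) * netGain zf c' ρ ((s.add c' a i).sol j) o ≤ τ := by
    intro j o ho h1 h2
    refine le_trans ?_ (hP.unblocked j o ho (fun h => h1 (hsol j h)) h2)
    exact mul_le_mul_of_nonneg_left (netGain_anti hsub (hsol j) h1) hε'
  have hnot : ∀ j, ∀ o ∈ (s.add c' a i).blocked mf O j, o ∈ O ∧ o ∉ (s.add c' a i).sol j := by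
    intro j o ho
    rw [SGSState.blocked, Finset.mem_filter] at ho
    exact ⟨ho.1, ho.2.1⟩
  refine ⟨?_, fun j o ho h1 h2 => hun j o ho h1 fun h => h2 (hbl j h)⟩
  have hpot : ∀ j, (1 - ε) * ∑ o ∈ (s.add c' a i).blocked mf O j,
        max 0 (netGain zf c' ρ ((s.add c' a i).sol j) o) ≤
      (1 - ε) * ∑ o ∈ s.blocked mf O j, max 0 (netGain zf c' ρ (s.sol j) o) +
        τ * ((((s.add c' a i).blocked mf O j).card : ℝ) - ((s.blocked mf O j).card : ℝ)) := by
    intro j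
    rw [← Finset.sum_sdiff (hbl j), mul_add, add_comm]
    refine add_le_add (mul_le_mul_of_nonneg_left (Finset.sum_le_sum fun o ho => ?_) hε') ?_
    · exact max_le_max le_rfl (netGain_anti hsub (hsol j) (hnot j o (hbl j ho)).2)
    · rw [Finset.mul_sum, ← Nat.cast_sub (Finset.card_le_card (hbl j)),
        ← Finset.card_sdiff_of_subset (hbl j), mul_comm τ, ← nsmul_eq_mul]
      refine Finset.sum_le_card_nsmul _ _ _ fun o ho => ?_
      rw [Finset.mem_sdiff] at ho
      rw [mul_max_of_nonneg _ _ hε', mul_zero]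
      exact max_le hτ (hun j o (hnot j o ho.1).1 (hnot j o ho.1).2 ho.2)
  have hcard : ∑ j, (((s.add c' a i).sol j).card : ℝ) = ∑ j, ((s.sol j).card : ℝ) + 1 := by
    rw [sum_sol_add s a i fun S => (S.card : ℝ), Finset.card_insert_of_notMem hna]
    push_cast
    ring
  have hval : ∑ j, zf (s.sol j) + τ ≤ ∑ j, zf ((s.add c' a i).sol j) := by
    rw [sum_sol_add s a i zf]
    linarith [hp.2.2.1]
  have h1 := Finset.sum_le_sum fun j (_ : j ∈ Finset.univ) => hpot j
  rw [Finset.sum_add_distrib, ← Finset.mul_sum, ← Finset.mul_sum, ← Finset.mul_sum,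
    Finset.sum_sub_distrib] at h1
  have h2 := hP.bound
  have h3 := mul_le_mul_of_nonneg_left hval (Nat.cast_nonneg (α := ℝ) p)
  rw [hcard]
  linarith

theorem PotentialInv.step {p : ℕ} (hz : ∀ S, (z S).eval f om = zf S)
    (hm : ∀ S, (mem S).eval f om = mf S) (hε : ε < 1) (hsub : IsSubmodular zf)
    (hmf : ∀ S, ∀ e, mf (insert e S) = true → mf S = true) (hτ : 0 ≤ τ)
    {s : SGSState n m ℓ} (hs : SGSInv zf mf c' N' ρ v₀ s)
    (hP : PotentialInv zf mf c' O ε ρ p τ s) (q : Fin n × Fin ℓ) :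
    PotentialInv zf mf c' O ε ρ p τ ((sgsStep z mem c' ρ τ s q).eval f om) := by
  rcases sgsStep_cases (c' := c') (ρ := ρ) (τ := τ) hz hm s q with ⟨-, h⟩ | ⟨hp, -, h⟩ | ⟨-, -, h⟩
  · rwa [h]
  · rw [h]; exact hP.add hε hsub hmf hτ hs hp
  · rw [h]; exact ⟨hP.bound, hP.unblocked⟩

/-- After `q` has been treated, its element is of no further use at the current threshold. -/
def Settled (zf : Finset (Fin n) → ℝ) (mf : Finset (Fin n) → Bool) (c' : Fin m → Fin n → ℝ≥0∞)
    (O : Finset (Fin n)) (ρ τ : ℝ) (s : SGSState n m ℓ) (q : Fin n × Fin ℓ) : Prop :=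
  s.viol = true ∨ q.1 ∉ O ∨ q.1 ∈ s.sol q.2 ∨ q.1 ∈ s.blocked mf O q.2 ∨
    netGain zf c' ρ (s.sol q.2) q.1 ≤ τ

/-- An unblocked element with net gain above `τ ≥ 0` has marginal value above both `τ` and its
price, so it passes the test and is added or causes a violation. Subtracting the price thus merges
the two parts of the test into one quantity. -/
theorem settled_step (hz : ∀ S, (z S).eval f om = zf S)
    (hm : ∀ S, (mem S).eval f om = mf S) (hτ : 0 ≤ τ) (hρ : 0 ≤ ρ)
    (hO : ∀ o ∈ O, ∀ j, c' j o ≠ ∞) (s : SGSState n m ℓ) (q : Fin n × Fin ℓ) :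
    Settled zf mf c' O ρ τ ((sgsStep z mem c' ρ τ s q).eval f om) q := by
  rcases sgsStep_cases (c' := c') (ρ := ρ) (τ := τ) hz hm s q with ⟨hp, h⟩ | ⟨-, -, h⟩ | ⟨-, -, h⟩
  · rw [h]
    by_cases hq : q.1 ∈ O
    · by_cases hsol : q.1 ∈ s.sol q.2
      · exact Or.inr (Or.inr (Or.inl hsol))
      · by_cases hb : q.1 ∈ s.blocked mf O q.2
        · exact Or.inr (Or.inr (Or.inr (Or.inl hb)))
        · refine Or.inr (Or.inr (Or.inr (Or.inr ?_)))
          simp only [SGSState.blocked, Finset.mem_filter, hq, hsol, not_false_eq_true, true_and,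
            not_or, not_not, Bool.not_eq_false] at hb
          have hw : 0 ≤ ρ * totalCost c' q.1 := mul_nonneg hρ (totalCost_nonneg c' _)
          unfold netGain
          by_contra! hlt
          refine hp ⟨hb.1, hb.2, by linarith, ?_⟩
          have hsum : ∑ j, c' j q.1 = ENNReal.ofReal (totalCost c' q.1) := by
            rw [totalCost, ENNReal.ofReal_sum_of_nonneg fun _ _ => ENNReal.toReal_nonneg]
            exact Finset.sum_congr rfl fun j _ => (ENNReal.ofReal_toReal (hO _ hq j)).symm
          rw [hsum, ← ENNReal.ofReal_mul hρ]
          exact ENNReal.ofReal_le_ofReal (by linarith)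
    · exact Or.inr (Or.inl hq)
  · rw [h]
    exact Or.inr (Or.inr (Or.inl (by simp [SGSState.add])))
  · rw [h]
    exact Or.inl rfl

/-- Nothing settled is revived: blocking is permanent and net gains only decrease as solutions grow.
-/
theorem Settled.step (hz : ∀ S, (z S).eval f om = zf S)
    (hm : ∀ S, (mem S).eval f om = mf S) (hsub : IsSubmodular zf)
    (hmf : ∀ S, ∀ e, mf (insert e S) = true → mf S = true)
    {s : SGSState n m ℓ} {r : Fin n × Fin ℓ} (hr : Settled zf mf c' O ρ τ s r)
    (q : Fin n × Fin ℓ) : Settled zf mf c' O ρ τ ((sgsStep z mem c' ρ τ s q).eval f om) r := by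
  rcases sgsStep_cases (c' := c') (ρ := ρ) (τ := τ) hz hm s q with ⟨-, h⟩ | ⟨hp, -, h⟩ | ⟨-, -, h⟩
  · rwa [h]
  · rw [h]
    have hsol : s.sol r.2 ⊆ (s.add c' q.1 q.2).sol r.2 := by
      by_cases h : r.2 = q.2
      · rw [h]; simp [SGSState.add]
      · simp [SGSState.add, h]
    by_cases hr' : r.1 ∈ (s.add c' q.1 q.2).sol r.2
    · exact Or.inr (Or.inr (Or.inl hr'))
    · rcases hr with hr | hr | hr | hr | hr
      · exact Or.inl hr
      · exact Or.inr (Or.inl hr)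
      · exact Or.inr (Or.inr (Or.inl (hsol hr)))
      · exact Or.inr (Or.inr (Or.inr (Or.inl (blocked_subset_add hmf hp.1 hp.2.1 _ hr))))
      · exact Or.inr (Or.inr (Or.inr (Or.inr ((netGain_anti hsub hsol hr').trans hr))))
  · rw [h]
    exact Or.inl rfl

/-- A complete pass that meets no violation lowers the threshold of the potential invariant. -/
theorem PotentialInv.pass (hz : ∀ S, (z S).eval f om = zf S)
    (hm : ∀ S, (mem S).eval f om = mf S) (hε0 : 0 ≤ ε) (hε : ε < 1) (hsub : IsSubmodular zf)
    (hmf : ∀ S, ∀ e, mf (insert e S) = true → mf S = true) (hτ : 0 ≤ τ) (hρ : 0 ≤ ρ)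
    (h0 : zf ∅ = 0) (hv : ∀ e ∈ N', zf {e} ≤ v₀)
    (hO : ∀ o ∈ O, ∀ j, c' j o ≠ ∞) (hON : O ⊆ N') (hc : ConflictBound mf N' O k)
    {pairs : List (Fin n × Fin ℓ)} (hpairs : ∀ q, q ∈ pairs)
    {s : SGSState n m ℓ} (hs : SGSInv zf mf c' N' ρ v₀ s)
    (hP : s.viol = true ∨ PotentialInv zf mf c' O ε ρ (max (ℓ - 1) k) τ s) :
    let s' := (pairs.foldlM (sgsStep z mem c' ρ τ) s).eval f om
    SGSInv zf mf c' N' ρ v₀ s' ∧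
      (s'.viol = true ∨ PotentialInv zf mf c' O ε ρ (max (ℓ - 1) k) ((1 - ε) * τ) s') := by
  intro s'
  have hs' : s' = pairs.foldl (fun s q => (sgsStep z mem c' ρ τ s q).eval f om) s :=
    eval_foldlM _ _ _ _ _
  have hstep : ∀ (s : SGSState n m ℓ) (q : Fin n × Fin ℓ), SGSInv zf mf c' N' ρ v₀ s →
      SGSInv zf mf c' N' ρ v₀ ((sgsStep z mem c' ρ τ s q).eval f om) :=
    fun s q h => h.step hz hm hτ hsub h0 hv q
  have h1 : SGSInv zf mf c' N' ρ v₀ s' ∧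
      (s'.viol = true ∨ PotentialInv zf mf c' O ε ρ (max (ℓ - 1) k) τ s') := by
    rw [hs']
    refine foldl_invariant (fun s => SGSInv zf mf c' N' ρ v₀ s ∧
      (s.viol = true ∨ PotentialInv zf mf c' O ε ρ (max (ℓ - 1) k) τ s)) _ _ _ ⟨hs, hP⟩ ?_
    rintro s q - ⟨h1, h2⟩
    refine ⟨hstep s q h1, ?_⟩
    rcases h2 with h2 | h2
    · left
      rcases sgsStep_cases (c' := c') (ρ := ρ) (τ := τ) hz hm s q
        with ⟨-, h⟩ | ⟨-, -, h⟩ | ⟨-, -, h⟩ <;> rw [h]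
      · exact h2
      · exact h2
    · exact Or.inr (h2.step hz hm hε hsub hmf hτ h1 q)
  have h2 : ∀ q ∈ pairs, Settled zf mf c' O ρ τ s' q := by
    rw [hs']
    exact foldl_forall (fun _ => True) (Settled zf mf c' O ρ τ) _ _ _ trivial
      (fun _ _ _ => trivial) (fun s q _ => settled_step hz hm hτ hρ hO s q)
      (fun s q r _ h => h.step hz hm hsub hmf q)
  refine ⟨h1.1, ?_⟩
  rcases h1.2 with h3 | h3
  · exact Or.inl h3
  · by_cases hviol : s'.viol = true
    · exact Or.inl hviol
    · refine Or.inr ⟨le_trans ?_ h3.bound, fun i o ho hsol hb => ?_⟩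
      -- The factor of `τ` in the potential is nonnegative, so a smaller threshold only weakens the
      -- bound.
      · have h4 := h1.1.sum_card_blocked_le hc hON
        have h5 : (0 : ℝ) ≤ (max (ℓ - 1) k : ℕ) * ∑ i, ((s'.sol i).card : ℝ) -
            ∑ i, ((s'.blocked mf O i).card : ℝ) := by
          rw [sub_nonneg]
          exact_mod_cast h4
        have h6 := mul_nonneg (mul_nonneg hε0 hτ) h5
        linarith
      · refine mul_le_mul_of_nonneg_left ?_ (by linarith)
        have h4 := h2 (o, i) (hpairs _)
        unfold Settled at h4
        tauto

end Potential

/-! ### Guarantees of the subroutine -/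

section Spec

variable {n m ℓ : ℕ} {f : Finset (Fin n) → ℝ} {om : Finset (Fin n) → Bool}
  {z : Finset (Fin n) → Prog n ℝ} {mem : Finset (Fin n) → Prog n Bool}
  {zf : Finset (Fin n) → ℝ} {mf : Finset (Fin n) → Bool}
  {c' : Fin m → Fin n → ℝ≥0∞} {N' O : Finset (Fin n)} {ε ρ τ v₀ V : ℝ} {k : ℕ}

/-- Marginal values of `O` split into net gains and prices. The potential pays for the blocked net
gains, its nonnegative threshold term being dropped. The unblocked ones, at most `n` in number,
contribute at most `ε * V / n` each after weighting. The prices total at most `ρ * m`, since `O`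
fits into `m` unit budgets. -/
theorem PotentialInv.sum_union_le (hε : ε < 1) (hsub : IsSubmodular zf) (hn : 0 < n)
    (hτ : 0 ≤ τ) (hτV : τ ≤ ε * V / n) (hρ : 0 ≤ ρ) (hO : ∀ j, ∑ o ∈ O, c' j o ≤ 1)
    (hON : O ⊆ N') (hc : ConflictBound mf N' O k) {s : SGSState n m ℓ}
    (hs : SGSInv zf mf c' N' ρ v₀ s)
    (hP : PotentialInv zf mf c' O ε ρ (max (ℓ - 1) k) τ s) :
    (1 - ε) * ∑ i, zf (s.sol i ∪ O) ≤
      ((max (ℓ - 1) k : ℕ) + 1 - ε) * ∑ i, zf (s.sol i) + ℓ * (ε * V) +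
        (1 - ε) * (ρ * (ℓ * m)) := by
  have hε' : 0 ≤ 1 - ε := by linarith
  have hn' : (0 : ℝ) < n := by exact_mod_cast hn
  have hi : ∀ i, (1 - ε) * (zf (s.sol i ∪ O) - zf (s.sol i)) ≤
      (1 - ε) * ∑ o ∈ s.blocked mf O i, max 0 (netGain zf c' ρ (s.sol i) o) + ε * V +
        (1 - ε) * (ρ * m) := by
    intro i
    have hbl : s.blocked mf O i ⊆ O \ s.sol i := by
      intro o ho
      rw [SGSState.blocked, Finset.mem_filter] at ho
      exact Finset.mem_sdiff.2 ⟨ho.1, ho.2.1⟩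
    have h1 : ∑ o ∈ O \ s.sol i, (zf (insert o (s.sol i)) - zf (s.sol i)) =
        ∑ o ∈ O \ s.sol i, netGain zf c' ρ (s.sol i) o +
          ρ * ∑ o ∈ O \ s.sol i, totalCost c' o := by
      rw [Finset.mul_sum, ← Finset.sum_add_distrib]
      exact Finset.sum_congr rfl fun o _ => by rw [netGain]; ring
    have h2 : ∑ o ∈ O \ s.sol i, totalCost c' o ≤ m :=
      (Finset.sum_le_sum_of_subset_of_nonneg Finset.sdiff_subset
        fun o _ _ => totalCost_nonneg c' o).trans (sum_totalCost_le hO)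
    have h3 : (1 - ε) * ∑ o ∈ (O \ s.sol i) \ s.blocked mf O i, netGain zf c' ρ (s.sol i) o ≤
        ε * V := by
      rw [Finset.mul_sum]
      refine (Finset.sum_le_card_nsmul _ _ τ fun o ho => ?_).trans ?_
      · simp only [Finset.mem_sdiff] at ho
        exact hP.unblocked i o ho.1.1 ho.1.2 ho.2
      · rw [nsmul_eq_mul]
        calc _ ≤ (n : ℝ) * τ := by
              gcongr
              simpa using Finset.card_le_univ ((O \ s.sol i) \ s.blocked mf O i)
          _ ≤ n * (ε * V / n) := by gcongr
          _ = ε * V := by field_simp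
    have h4 : ∑ o ∈ s.blocked mf O i, netGain zf c' ρ (s.sol i) o ≤
        ∑ o ∈ s.blocked mf O i, max 0 (netGain zf c' ρ (s.sol i) o) :=
      Finset.sum_le_sum fun o _ => le_max_right _ _
    have h5 := hsub.union_sub_le_sum (s.sol i) O
    rw [h1, ← Finset.sum_sdiff hbl] at h5
    have h6 := mul_le_mul_of_nonneg_left h5 hε'
    have h7 := mul_le_mul_of_nonneg_left h4 hε'
    have h8 := mul_le_mul_of_nonneg_left (mul_le_mul_of_nonneg_left h2 hρ) hε'
    linarith
  have h1 := Finset.sum_le_sum fun i (_ : i ∈ Finset.univ) => hi i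
  simp only [Finset.sum_add_distrib, Finset.sum_const, Finset.card_univ, Fintype.card_fin,
    ← Finset.mul_sum, nsmul_eq_mul, Finset.sum_sub_distrib] at h1
  have h2 : (0 : ℝ) ≤ (max (ℓ - 1) k : ℕ) * ∑ i, ((s.sol i).card : ℝ) -
      ∑ i, ((s.blocked mf O i).card : ℝ) := by
    rw [sub_nonneg]
    exact_mod_cast hs.sum_card_blocked_le hc hON
  have h3 := mul_nonneg hτ h2
  have h4 := hP.bound
  linarith

theorem PotentialInv.init {p : ℕ} (hε0 : 0 ≤ ε) (hε : ε < 1) (hV : 0 ≤ V) (hρ : 0 ≤ ρ)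
    (h0 : zf ∅ = 0) (hON : O ⊆ N') (hOm : ∀ o ∈ O, mf {o} = true) (hOV : ∀ o ∈ O, zf {o} ≤ V) :
    PotentialInv (ℓ := ℓ) zf mf c' O ε ρ p V
      { sol := fun _ => ∅, load := fun _ _ => 0, avail := N', viol := false } := by
  have hb : ∀ i, SGSState.blocked (m := m) (ℓ := ℓ) mf O
      { sol := fun _ => ∅, load := fun _ _ => 0, avail := N', viol := false } i = ∅ := by
    intro i
    rw [SGSState.blocked, Finset.filter_eq_empty_iff]
    rintro o ho ⟨-, h | h⟩
    · exact h (hON ho)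
    · simp [hOm o ho] at h
  refine ⟨by simp [hb, h0], fun i o ho _ _ => ?_⟩
  have h1 : netGain zf c' ρ ∅ o ≤ V := by
    have := mul_nonneg hρ (totalCost_nonneg c' o)
    have := hOV o ho
    simp only [netGain, insert_empty_eq, h0]
    linarith
  calc (1 - ε) * netGain zf c' ρ ∅ o ≤ (1 - ε) * V := mul_le_mul_of_nonneg_left h1 (by linarith)
    _ ≤ V := by nlinarith

/-- The infimum is over a nonempty set, so it is attained and is not the default value 0: for `V ≤
0` zero passes qualify, and for `V > 0` the powers of `1 - ε` tend to 0. -/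
theorem sgsPasses_spec (hε0 : 0 < ε) (hε : ε < 1) (hn : 0 < n) (V : ℝ) :
    (1 - ε) ^ sgsPasses n ε V * V ≤ ε * V / n := by
  have hn' : (0 : ℝ) < n := by exact_mod_cast hn
  refine Nat.sInf_mem (s := {r : ℕ | (1 - ε) ^ r * V ≤ ε * V / n}) ?_
  rcases le_or_gt V 0 with hV | hV
  · refine ⟨0, ?_⟩
    have h1 : ε / n ≤ 1 := by
      rw [div_le_one hn']
      have : (1 : ℝ) ≤ n := by exact_mod_cast hn
      linarith
    simp only [Set.mem_ofPred_eq, pow_zero, one_mul]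
    rw [mul_div_right_comm]
    nlinarith
  · obtain ⟨r, hr⟩ := exists_pow_lt_of_lt_one (show 0 < ε / n by positivity)
      (show 1 - ε < 1 by linarith)
    refine ⟨r, ?_⟩
    simp only [Set.mem_ofPred_eq]
    rw [mul_div_right_comm]
    gcongr

/-- Induction over the passes of the loop, up to the point where the loop condition fails. -/
theorem sgsLoop_induction (I : ℝ → SGSState n m ℓ → Prop) (pairs : List (Fin n × Fin ℓ))
    (hpass : ∀ τ s, ε * V / n < τ → I τ s →
      I ((1 - ε) * τ) ((pairs.foldlM (sgsStep z mem c' ρ τ) s).eval f om))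
    (r : ℕ) (τ : ℝ) (s : SGSState n m ℓ) (h0 : I τ s) (hr : (1 - ε) ^ r * τ ≤ ε * V / n) :
    ∃ τ' ≤ ε * V / n, I τ' ((sgsLoop z mem c' pairs ε V ρ (r + 1) τ s).eval f om) := by
  induction r generalizing τ s with
  | zero =>
    rw [pow_zero, one_mul] at hr
    refine ⟨τ, hr, ?_⟩
    unfold sgsLoop
    rw [eval_bind, if_neg (not_lt.2 hr)]
    exact h0
  | succ r ih =>
    unfold sgsLoop
    rw [eval_bind]
    split_ifs with h
    · rw [eval_bind]
      refine ih _ _ (hpass τ s h h0) ?_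
      rwa [← mul_assoc, ← pow_succ]
    · exact ⟨τ, not_lt.1 h, h0⟩

/-- The guarantees of the subroutine. -/
theorem knapsackSGS_spec (hz : ∀ S, (z S).eval f om = zf S)
    (hm : ∀ S, (mem S).eval f om = mf S) (hε0 : 0 < ε) (hε : ε < 1) (hsub : IsSubmodular zf)
    (hmf : ∀ S, ∀ e, mf (insert e S) = true → mf S = true) (hn : 0 < n) (hℓ : 0 < ℓ)
    (h0 : zf ∅ = 0) (hm0 : mf ∅ = true) (hv : ∀ e ∈ N', zf {e} ≤ v₀)
    {pairs : List (Fin n × Fin ℓ)} (hpairs : ∀ q, q ∈ pairs) :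
    let r := (knapsackSGS z mem c' N' pairs ε V ρ).eval f om
    (r.1 ⊆ N' ∧ mf r.1 = true ∧ (∀ j, ∑ e ∈ r.1, c' j e ≤ 1) ∧ 0 ≤ zf r.1) ∧
    (r.2 = true → ρ - v₀ ≤ zf r.1) ∧
    (r.2 = false → 0 ≤ ρ → 0 < V → ∀ (k : ℕ) (O : Finset (Fin n)), O ⊆ N' →
      ConflictBound mf N' O k → (∀ o ∈ O, mf {o} = true) → (∀ o ∈ O, zf {o} ≤ V) →
      (∀ j, ∑ o ∈ O, c' j o ≤ 1) →
      ∃ S : Fin ℓ → Finset (Fin n), (∀ i j, i ≠ j → Disjoint (S i) (S j)) ∧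
        (1 - ε) * ∑ i, zf (S i ∪ O) ≤
          ℓ * (((max (ℓ - 1) k : ℕ) + 1 - ε) * zf r.1 + ε * V + (1 - ε) * (ρ * m))) := by
  intro r
  obtain ⟨s, hs⟩ : ∃ s, s = (sgsLoop z mem c' pairs ε V ρ (sgsPasses n ε V + 1) V
    { sol := fun _ => ∅, load := fun _ _ => 0, avail := N', viol := false }).eval f om := ⟨_, rfl⟩
  have hr : r = (((argmax z ((List.finRange ℓ).map s.sol)).eval f om).getD ∅, s.viol) := by
    simp only [r, knapsackSGS, eval_bind, ← hs, eval_pure]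
  have hpasses := sgsPasses_spec hε0 hε hn V
  have hn' : (0 : ℝ) < n := by exact_mod_cast hn
  -- Without monotonicity `V` may be negative. In that case no pass takes place, so every pass that
  -- does has a nonnegative threshold.
  have hexit : V ≤ 0 → s = { sol := fun _ => ∅, load := fun _ _ => 0, avail := N', viol := false } := by
    intro hV
    have h1 : ¬ ε * V / n < V := by
      rw [not_lt, mul_div_right_comm]
      have h1 : ε / n ≤ 1 := by
        rw [div_le_one hn']
        have : (1 : ℝ) ≤ n := by exact_mod_cast hn
        linarith
      nlinarith
    rw [hs]
    unfold sgsLoop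
    rw [eval_bind, if_neg h1]
    rfl
  have hτpos : ∀ τ, 0 < V → ε * V / n < τ → 0 ≤ τ := fun τ hV h =>
    le_trans (by positivity) h.le
  have hinv : SGSInv zf mf c' N' ρ v₀ s := by
    rcases le_or_gt V 0 with hV | hV
    · rw [hexit hV]
      exact SGSInv.init h0 hm0
    · obtain ⟨τ', -, h⟩ := sgsLoop_induction (z := z) (mem := mem) (f := f) (om := om) (c' := c')
        (ρ := ρ) (ε := ε) (V := V) (fun _ s => SGSInv (ℓ := ℓ) zf mf c' N' ρ v₀ s) pairs
        (fun τ s hτ h => by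
          rw [eval_foldlM]
          exact foldl_invariant _ _ _ _ h fun s q _ hs =>
            hs.step hz hm (hτpos τ hV hτ) hsub h0 hv q)
        _ _ _ (SGSInv.init h0 hm0) hpasses
      rwa [← hs] at h
  obtain ⟨i₀, hi₀, hbest⟩ : ∃ i, r.1 = s.sol i ∧ ∀ j, zf (s.sol j) ≤ zf r.1 := by
    rcases argmax_spec f om z zf hz ((List.finRange ℓ).map s.sol) with ⟨-, h⟩ | ⟨S, hS, h, hmax⟩
    · rw [List.map_eq_nil_iff, List.finRange_eq_nil_iff] at h
      omega
    · have hrS : r.1 = S := by rw [hr, h]; rfl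
      simp only [List.mem_map, List.mem_finRange, true_and] at hS
      obtain ⟨i, hi⟩ := hS
      refine ⟨i, by rw [hrS, hi], fun j => ?_⟩
      rw [hrS]
      exact hmax _ (List.mem_map_of_mem (List.mem_finRange j))
  have hr2 : r.2 = s.viol := by rw [hr]
  refine ⟨⟨?_, ?_, ?_, ?_⟩, ?_, ?_⟩
  · rw [hi₀]; exact hinv.sub i₀
  · rw [hi₀]; exact hinv.indep i₀
  · intro j
    rw [hi₀, ← hinv.load_eq]; exact hinv.load_le i₀ j
  · rw [hi₀]; exact hinv.nonneg i₀
  · intro h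
    obtain ⟨i, hi⟩ := hinv.viol (hr2 ▸ h)
    exact hi.trans (hbest i)
  · intro hr0 hρ hV k O hON hc hOm hOV hO
    have hOfin : ∀ o ∈ O, ∀ j, c' j o ≠ ∞ := by
      intro o ho j
      have := (Finset.single_le_sum (f := fun o => c' j o) (fun _ _ => by simp) ho).trans (hO j)
      exact (this.trans_lt ENNReal.one_lt_top).ne
    -- The potential is carried along only until a violation is recorded; a final flag `false` shows
    -- that it was carried to the end.
    obtain ⟨τ', hτ', h1, h2, h3⟩ := sgsLoop_induction (z := z) (mem := mem) (f := f) (om := om)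
        (c' := c') (ρ := ρ) (ε := ε) (V := V)
        (fun τ s => 0 ≤ τ ∧ SGSInv (ℓ := ℓ) zf mf c' N' ρ v₀ s ∧
          (s.viol = true ∨ PotentialInv zf mf c' O ε ρ (max (ℓ - 1) k) τ s)) pairs
        (fun τ s hτ h => ⟨mul_nonneg (by linarith) h.1,
          PotentialInv.pass hz hm hε0.le hε hsub hmf h.1 hρ h0 hv hOfin hON hc hpairs h.2.1 h.2.2⟩)
        _ _ _ ⟨hV.le, SGSInv.init h0 hm0,
          Or.inr (PotentialInv.init hε0.le hε hV.le hρ h0 hON hOm hOV)⟩ hpasses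
    rw [← hs] at h2 h3
    have hP := h3.resolve_left (by rw [← hr2, hr0]; simp)
    refine ⟨s.sol, h2.disj, (hP.sum_union_le hε hsub hn h1 hτ' hρ hO hON hc h2).trans ?_⟩
    have h4 : ∑ i, zf (s.sol i) ≤ ℓ * zf r.1 := by
      simpa using Finset.sum_le_sum fun i (_ : i ∈ Finset.univ) => hbest i
    have h5 : (0 : ℝ) ≤ (max (ℓ - 1) k : ℕ) + 1 - ε := by
      have : (0 : ℝ) ≤ (max (ℓ - 1) k : ℕ) := Nat.cast_nonneg _
      linarith
    have h6 := mul_le_mul_of_nonneg_left h4 h5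
    linarith

end Spec

/-! ### The binary search over densities -/

section Search

variable {n : ℕ} (f : Finset (Fin n) → ℝ) (om : Finset (Fin n) → Bool)

theorem binarySearch_of_le (sub : ℝ → Prog n (Finset (Fin n) × Bool)) (rho : ℕ → ℝ) (b₁ b₀ : ℕ)
    (h : ¬ 1 < ((b₁ : ℤ) - (b₀ : ℤ)).natAbs) :
    (binarySearch sub rho b₁ b₀).eval f om = [] := by
  rw [binarySearch, if_neg h]
  rfl

theorem eval_binarySearch (sub : ℝ → Prog n (Finset (Fin n) × Bool)) (rho : ℕ → ℝ) (b₁ b₀ b : ℕ)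
    (hb : b = (b₁ + b₀ + 1) / 2) (h : 1 < ((b₁ : ℤ) - (b₀ : ℤ)).natAbs) :
    (binarySearch sub rho b₁ b₀).eval f om =
      ((sub (rho b)).eval f om).1 ::
        if ((sub (rho b)).eval f om).2 = true then
          (binarySearch sub rho b b₀).eval f om
        else (binarySearch sub rho b₁ b).eval f om := by
  subst hb
  rw [binarySearch, if_pos h]
  simp only [eval_bind]
  split_ifs <;> simp

theorem mem_binarySearch (sub : ℝ → Prog n (Finset (Fin n) × Bool)) (rho : ℕ → ℝ) (b₁ b₀ : ℕ)
    {S : Finset (Fin n)} (hS : S ∈ (binarySearch sub rho b₁ b₀).eval f om) :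
    ∃ b, S = ((sub (rho b)).eval f om).1 := by
  by_cases h : 1 < ((b₁ : ℤ) - (b₀ : ℤ)).natAbs
  · rw [eval_binarySearch f om sub rho b₁ b₀ _ rfl h] at hS
    rcases List.mem_cons.1 hS with hS | hS
    · exact ⟨_, hS⟩
    · split_ifs at hS
      · exact mem_binarySearch sub rho _ _ hS
      · exact mem_binarySearch sub rho _ _ hS
  · rw [binarySearch_of_le f om sub rho b₁ b₀ h] at hS
    simp at hS
termination_by ((b₁ : ℤ) - (b₀ : ℤ)).natAbs
decreasing_by all_goals omega

/-- The binary search ends at two consecutive indices, the lower of which is the initial one or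
has met a violation, and the upper of which is the initial one or has met none. -/
theorem binarySearch_spec (sub : ℝ → Prog n (Finset (Fin n) × Bool)) (rho : ℕ → ℝ) (b₁ b₀ : ℕ)
    (hb : b₁ < b₀) :
    ∃ b, b₁ ≤ b ∧ b + 1 ≤ b₀ ∧
      (b = b₁ ∨ (((sub (rho b)).eval f om).2 = true ∧
        ((sub (rho b)).eval f om).1 ∈ (binarySearch sub rho b₁ b₀).eval f om)) ∧
      (b + 1 = b₀ ∨ (((sub (rho (b + 1))).eval f om).2 = false ∧
        ((sub (rho (b + 1))).eval f om).1 ∈ (binarySearch sub rho b₁ b₀).eval f om)) := by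
  by_cases h : 1 < ((b₁ : ℤ) - (b₀ : ℤ)).natAbs
  · obtain ⟨b, hbd⟩ : ∃ b, b = (b₁ + b₀ + 1) / 2 := ⟨_, rfl⟩
    rw [eval_binarySearch f om sub rho b₁ b₀ b hbd h]
    have h1 : b₁ < b := by omega
    have h2 : b < b₀ := by omega
    split_ifs with hE
    · obtain ⟨d, hd1, hd2, hd3, hd4⟩ := binarySearch_spec sub rho b b₀ h2
      refine ⟨d, by omega, hd2, Or.inr ?_, hd4.imp id fun h => ⟨h.1, List.mem_cons_of_mem _ h.2⟩⟩
      rcases hd3 with rfl | hd3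
      · exact ⟨hE, List.mem_cons_self⟩
      · exact ⟨hd3.1, List.mem_cons_of_mem _ hd3.2⟩
    · obtain ⟨d, hd1, hd2, hd3, hd4⟩ := binarySearch_spec sub rho b₁ b h1
      refine ⟨d, hd1, by omega, hd3.imp id fun h => ⟨h.1, List.mem_cons_of_mem _ h.2⟩, Or.inr ?_⟩
      rcases hd4 with hd4 | hd4
      · rw [hd4]
        exact ⟨by simpa using hE, List.mem_cons_self⟩
      · exact ⟨hd4.1, List.mem_cons_of_mem _ hd4.2⟩
  · exact ⟨b₁, le_rfl, hb, Or.inl rfl, Or.inl (by omega)⟩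
termination_by ((b₁ : ℤ) - (b₀ : ℤ)).natAbs
decreasing_by all_goals omega

end Search

/-! ### The reduced ground set -/

section Scan

variable {n m : ℕ} {f : Finset (Fin n) → ℝ} {om : Finset (Fin n) → Bool}
  {z : Finset (Fin n) → Prog n ℝ} {mem : Finset (Fin n) → Prog n Bool}
  {zf : Finset (Fin n) → ℝ} {mf : Finset (Fin n) → Bool}

/-- The reduced ground set, and the maximum of `z` over its feasible elements. -/
theorem scanGround_spec (hz : ∀ S, (z S).eval f om = zf S) (hm : ∀ S, (mem S).eval f om = mf S)
    (c' : Fin m → Fin n → ℝ≥0∞) (A : Finset (Fin n)) (C : ℕ) (fA : ℝ) :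
    let st := (scanGround z mem c' A C fA).eval f om
    (∀ e, e ∈ st.1 ↔ e ∉ A ∧ C * zf {e} ≤ fA) ∧
    (∀ e ∈ st.1, mf {e} = true → (∀ j, c' j e ≤ 1) → zf {e} ≤ st.2.getD 0) ∧
    (st.2.getD 0 = 0 ∨ ∃ e ∈ st.1, mf {e} = true ∧ (∀ j, c' j e ≤ 1) ∧ st.2.getD 0 = zf {e}) := by
  intro st
  let F : Fin n → Prop := fun e => mf {e} = true ∧ ∀ j, c' j e ≤ 1
  let N : Fin n → Prop := fun e => e ∉ A ∧ C * zf {e} ≤ fA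
  obtain ⟨step, hst, hstep⟩ : ∃ step : Finset (Fin n) × Option ℝ → Fin n → Finset (Fin n) × Option ℝ,
      st = (List.finRange n).foldl step (∅, none) ∧ ∀ s e,
        (¬ N e ∧ step s e = s) ∨ (N e ∧ ¬ F e ∧ step s e = (insert e s.1, s.2)) ∨
        (N e ∧ F e ∧ step s e = (insert e s.1, some (max (zf {e}) (s.2.getD (zf {e}))))) := by
    refine ⟨_, eval_foldlM _ _ _ _ _, fun s e => ?_⟩
    by_cases h1 : e ∈ A
    · exact Or.inl ⟨fun h => h.1 h1, by rw [if_pos h1]; rfl⟩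
    · rw [if_neg h1]
      simp only [eval_bind, hz]
      by_cases h2 : (C : ℝ) * zf {e} ≤ fA
      · rw [if_pos h2]
        simp only [eval_bind, hm]
        by_cases h3 : F e
        · exact Or.inr (Or.inr ⟨⟨h1, h2⟩, h3, by rw [if_pos h3]; rfl⟩)
        · exact Or.inr (Or.inl ⟨⟨h1, h2⟩, h3, by rw [if_neg h3]; rfl⟩)
      · exact Or.inl ⟨fun h => h2 h.2, by rw [if_neg h2]; rfl⟩
  -- `I` is soundness, that only admissible elements are collected and the recorded value is
  -- attained; `Q` is completeness for the elements already scanned.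
  let I : Finset (Fin n) × Option ℝ → Prop := fun s => (∀ e ∈ s.1, N e) ∧
    ∀ v, s.2 = some v → ∃ e ∈ s.1, F e ∧ v = zf {e}
  let Q : Finset (Fin n) × Option ℝ → Fin n → Prop := fun s e =>
    N e → e ∈ s.1 ∧ (F e → ∃ v, s.2 = some v ∧ zf {e} ≤ v)
  have hIstep : ∀ s e, I s → I (step s e) := by
    rintro s e ⟨h1, h2⟩
    rcases hstep s e with ⟨-, h⟩ | ⟨hN, hF, h⟩ | ⟨hN, hF, h⟩ <;> rw [h]
    · exact ⟨h1, h2⟩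
    · refine ⟨fun e' he' => ?_, fun v hv => ?_⟩
      · rcases Finset.mem_insert.1 he' with rfl | he'
        exacts [hN, h1 _ he']
      · obtain ⟨e', he', h'⟩ := h2 v hv
        exact ⟨e', Finset.mem_insert_of_mem he', h'⟩
    · refine ⟨fun e' he' => ?_, fun v hv => ?_⟩
      · rcases Finset.mem_insert.1 he' with rfl | he'
        exacts [hN, h1 _ he']
      · simp only [Option.some.injEq] at hv
        rcases hs2 : s.2 with _ | w
        · rw [hs2] at hv
          exact ⟨e, Finset.mem_insert_self _ _, hF, by simpa using hv.symm⟩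
        · rw [hs2, Option.getD_some] at hv
          rcases max_choice (zf {e}) w with hmax | hmax
          · exact ⟨e, Finset.mem_insert_self _ _, hF, by rw [← hv, hmax]⟩
          · obtain ⟨e', he', hF', hw⟩ := h2 w hs2
            exact ⟨e', Finset.mem_insert_of_mem he', hF', by rw [← hv, hmax, hw]⟩
  have hI : I st := by
    rw [hst]
    exact foldl_invariant I _ _ _ ⟨by simp, by simp⟩ fun s e _ => hIstep s e
  have hQ : ∀ e, Q st e := by
    intro e
    rw [hst]
    refine foldl_forall (fun _ => True) Q step _ _ trivial (fun _ _ _ => trivial) ?_ ?_ e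
      (List.mem_finRange e)
    · intro s a _ hN
      rcases hstep s a with ⟨hN', h⟩ | ⟨-, hF, h⟩ | ⟨-, hF, h⟩
      · exact absurd hN hN'
      · rw [h]
        exact ⟨Finset.mem_insert_self _ _, fun hF' => absurd hF' hF⟩
      · rw [h]
        exact ⟨Finset.mem_insert_self _ _, fun _ => ⟨_, rfl, le_max_left _ _⟩⟩
    · intro s a b _ hQ hN
      obtain ⟨h1, h2⟩ := hQ hN
      rcases hstep s a with ⟨-, h⟩ | ⟨-, -, h⟩ | ⟨-, -, h⟩ <;> rw [h]
      · exact ⟨h1, h2⟩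
      · exact ⟨Finset.mem_insert_of_mem h1, h2⟩
      · refine ⟨Finset.mem_insert_of_mem h1, fun hF => ⟨_, rfl, ?_⟩⟩
        obtain ⟨v, hv, hle⟩ := h2 hF
        rw [hv]
        exact hle.trans (le_max_right _ _)
  refine ⟨fun e => ⟨hI.1 e, fun h => (hQ e h).1⟩, fun e he h1 h2 => ?_, ?_⟩
  · obtain ⟨v, hv, hle⟩ := (hQ e (hI.1 e he)).2 ⟨h1, h2⟩
    rw [hv]
    exact hle
  · rcases hst2 : st.2 with _ | v
    · exact Or.inl rfl
    · obtain ⟨e, he, hF, hv⟩ := hI.2 v hst2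
      exact Or.inr ⟨e, he, hF.1, hF.2, hv⟩

end Scan

/-! ### The residual instance over an enumerated set -/

section Instance

variable {n k m : ℕ} {f : Finset (Fin n) → ℝ} {M : Fin k → Matroid (Fin n)}
  {c : Fin m → Fin n → ℝ≥0} {A : Finset (Fin n)}

/-- If `A` exhausts the budget, the conventions for division by 0 make the left sum 0 or `∞`
according to whether `S` is free in this knapsack, so no case has to be excluded. -/
theorem sum_reducedCost_le_one_iff {j : Fin m} (hA : ∑ a ∈ A, c j a ≤ 1) {S : Finset (Fin n)}
    (hS : Disjoint A S) :
    ∑ e ∈ S, reducedCost c A j e ≤ 1 ↔ ∑ e ∈ A ∪ S, c j e ≤ 1 := by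
  have hA' : ∑ a ∈ A, (c j a : ℝ≥0∞) ≤ 1 := by exact_mod_cast hA
  have hsum : ∑ e ∈ S, reducedCost c A j e =
      (∑ e ∈ S, (c j e : ℝ≥0∞)) / (1 - ∑ a ∈ A, (c j a : ℝ≥0∞)) := by
    simp only [reducedCost, div_eq_mul_inv, Finset.sum_mul]
  have hfin : ∑ a ∈ A, (c j a : ℝ≥0∞) ≠ ∞ := (hA'.trans_lt ENNReal.one_lt_top).ne
  have h1 : (∑ e ∈ S, (c j e : ℝ≥0∞)) ≤ 1 - ∑ a ∈ A, (c j a : ℝ≥0∞) ↔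
      ∑ e ∈ A ∪ S, c j e ≤ 1 := by
    rw [Finset.sum_union hS, ENNReal.le_sub_iff_add_le_left hfin hA']
    norm_cast
  rw [hsum, ← h1]
  by_cases hd : 1 - ∑ a ∈ A, (c j a : ℝ≥0∞) = 0
  · rw [hd]
    by_cases hx : (∑ e ∈ S, (c j e : ℝ≥0∞)) = 0
    · rw [hx]; simp
    · rw [ENNReal.div_zero hx]
      simpa using hx
  · rw [ENNReal.div_le_iff hd (by finiteness), one_mul]

theorem Feasible.subset {S T : Finset (Fin n)} (hT : Feasible M c T) (h : S ⊆ T) :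
    Feasible M c S :=
  ⟨fun i => (hT.1 i).subset (by exact_mod_cast h),
    fun j => (Finset.sum_le_sum_of_subset h).trans (hT.2 j)⟩

theorem memOracle_eq_true_iff (S : Finset (Fin n)) :
    memOracle M S = true ↔ ∀ i, (M i).Indep (S : Set (Fin n)) := by
  simp [memOracle]

theorem feasible_union_iff (hA : Feasible M c A) {S : Finset (Fin n)} (hS : Disjoint A S) :
    Feasible M c (A ∪ S) ↔
      memOracle M (A ∪ S) = true ∧ ∀ j, ∑ e ∈ S, reducedCost c A j e ≤ 1 := by
  unfold Feasible
  rw [memOracle_eq_true_iff]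
  exact and_congr_right fun _ => forall_congr' fun j =>
    (sum_reducedCost_le_one_iff (hA.2 j) hS).symm

theorem IsSubmodular.residual (hf : IsSubmodular f) (A : Finset (Fin n)) :
    IsSubmodular fun S => f (A ∪ S) - f A := by
  intro S T hST e he
  simp only [Finset.union_insert]
  -- An element of `A` has residual marginal value 0, while the submodularity of `f` is not
  -- applicable to it, as it lies in `A ∪ T`.
  by_cases hA : e ∈ A
  · rw [Finset.insert_eq_of_mem (Finset.mem_union_left _ hA),
      Finset.insert_eq_of_mem (Finset.mem_union_left _ hA)]
    simp
  · have := hf (A ∪ S) (A ∪ T) (Finset.union_subset_union_right hST) e (by simp [he, hA])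
    linarith

theorem memOracle_mono {S T : Finset (Fin n)} (h : S ⊆ T) (hT : memOracle M T = true) :
    memOracle M S = true := by
  rw [memOracle_eq_true_iff] at *
  exact fun i => (hT i).subset (by exact_mod_cast h)

/-- Every conflict is due to at least one matroid, and exchange in that matroid allows at most `(S \
O).card` of them; the factor `k` is a union bound. -/
theorem conflictBound_memOracle {N' O : Finset (Fin n)} (hN : Disjoint A N') (hAO : Disjoint A O)
    (hO : memOracle M (A ∪ O) = true) :
    ConflictBound (fun S => memOracle M (A ∪ S)) N' O k := by
  classical
  intro S T hSN hS hT hdep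
  simp only [memOracle, decide_eq_true_iff, decide_eq_false_iff_not, not_forall] at hS hdep hO
  have h1 : T ⊆ Finset.univ.biUnion fun i =>
      T.filter fun o => ¬ (M i).Indep (↑(A ∪ insert o S) : Set (Fin n)) := by
    intro o ho
    obtain ⟨i, hi⟩ := hdep o ho
    exact Finset.mem_biUnion.2 ⟨i, Finset.mem_univ _, Finset.mem_filter.2 ⟨ho, hi⟩⟩
  refine (Finset.card_le_card h1).trans (Finset.card_biUnion_le.trans ?_)
  refine (Finset.sum_le_card_nsmul _ _ (S \ O).card fun i _ => ?_).trans (by simp)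
  exact card_blocked_le (M i) A O S _ (hO i) (hS i) hAO (hN.mono_right hSN)
    ((Finset.filter_subset _ _).trans hT) fun o ho => (Finset.mem_filter.1 ho).2

end Instance

/-! ### Arithmetic of the densities -/

/-- The two guarantees at consecutive densities combine to a bound free of the density. -/
theorem combine_densities {ε P m θ β γ D F a X V t w : ℝ} (hε0 : 0 < ε) (hε : ε < 1) (hP : 0 ≤ P)
    (hm : 1 ≤ m) (hD : D = P + 1 + m * (1 - ε)) (hγ : γ = (P + 1) / D) (hβ : 0 ≤ β) (ha : 0 ≤ a)
    (hV : 0 ≤ V) (hVa : V ≤ a) (hFX : F ≤ X) (ht : 0 ≤ t) (hw : 0 ≤ w)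
    (h1 : β * V * t + γ * a - a ≤ w)
    (h0 : (1 - ε) * (θ * X - F) ≤
      (P + 1 - ε) * w + ε * V + (1 - ε) * ((β * V * (t * (1 + ε)) + γ * a) * m)) :
    (1 - ε) ^ 2 * ((θ - ε) * X - (1 - ε) * F) - m * (1 - ε) * a - ε * (P + 1) * a ≤ D * w := by
  have he : 0 < 1 - ε := by linarith
  have hDpos : 0 < D := by rw [hD]; positivity
  have hγ0 : 0 ≤ γ := by rw [hγ]; positivity
  -- `y` is the variable part of the upper density, and `(1 - ε) * y` is at most that of the lower
  -- one. With weight `m * (1 - ε)` on `h1` and `1 - ε` on `h0`, the terms in `y` cancel.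
  obtain ⟨y, hy⟩ : ∃ y, y = β * V * (t * (1 + ε)) := ⟨_, rfl⟩
  have hy0 : 0 ≤ y := by rw [hy]; positivity
  have hy1 : (1 - ε) * y ≤ β * V * t := by
    have : 0 ≤ β * V * t * ε ^ 2 := by positivity
    rw [hy]; nlinarith
  rw [← hy] at h0
  have h2 : m * (1 - ε) * ((1 - ε) * y + γ * a - a) ≤ m * (1 - ε) * w :=
    mul_le_mul_of_nonneg_left (by linarith) (by positivity)
  have h3 := mul_le_mul_of_nonneg_left h0 he.le
  have h4 : 0 ≤ ε * (P + 1 + (1 - ε)) * w := by positivity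
  have h5 : 0 ≤ (1 - ε) ^ 2 * ε * (X - F) := mul_nonneg (by positivity) (by linarith)
  have h6 : 0 ≤ m * (1 - ε) * ε * γ * a := by positivity
  have h7 : (1 - ε) * ε * V ≤ ε * (P + 1) * a := by
    have : ε * V ≤ ε * a := mul_le_mul_of_nonneg_left hVa hε0.le
    have h8 : 0 ≤ ε * P * a := by positivity
    have h9 : 0 ≤ ε * ε * V := by positivity
    nlinarith
  rw [hD]
  linarith

/-- The guarantee at a density too large to be checked from above. -/
theorem bound_of_large_density {ε P m θ β γ D F a X V t w N : ℝ} (hε0 : 0 < ε) (hε : ε < 1)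
    (hP : 0 ≤ P) (hm : 1 ≤ m) (hD : D = P + 1 + m * (1 - ε)) (hγ : γ = (P + 1) / D)
    (hβ : β = (1 - ε) * (θ - ε) / D) (hθ : ε ≤ θ) (hθ1 : θ ≤ 1) (hF : 0 ≤ F) (ha : 0 ≤ a)
    (hV : 0 ≤ V) (hXN : X - F ≤ N * V) (htN : N ≤ t * (1 + ε)) (ht : 0 ≤ t)
    (h1 : β * V * t + γ * a - a ≤ w) :
    (1 - ε) ^ 2 * ((θ - ε) * X - (1 - ε) * F) - m * (1 - ε) * a - ε * (P + 1) * a ≤ D * w := by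
  have he : 0 < 1 - ε := by linarith
  have hDpos : 0 < D := by rw [hD]; positivity
  have hDβ : D * β = (1 - ε) * (θ - ε) := by rw [hβ]; field_simp
  have hDγ : D * γ = P + 1 := by rw [hγ]; field_simp
  have h2 : (1 - ε) * (X - F) ≤ V * t := by
    have h3 : X - F ≤ t * (1 + ε) * V := hXN.trans (mul_le_mul_of_nonneg_right htN hV)
    have h4 := mul_le_mul_of_nonneg_left h3 he.le
    have h5 : 0 ≤ t * V * ε ^ 2 := by positivity
    nlinarith
  have h3 := mul_le_mul_of_nonneg_left h2 (mul_nonneg he.le (sub_nonneg.2 hθ))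
  have h4 := mul_le_mul_of_nonneg_left h1 hDpos.le
  -- This is what `β` and `γ` are tuned for: `D * β = (1 - ε) * (θ - ε)` supplies the main term, and
  -- `D * γ - D = -m * (1 - ε)` the loss.
  have h5 : D * (β * V * t + γ * a - a) =
      (1 - ε) * (θ - ε) * (V * t) - m * (1 - ε) * a := by
    linear_combination V * t * hDβ + a * hDγ - a * hD
  have h6 : 0 ≤ (1 - ε) ^ 2 * ((1 - θ) * F) := by
    have : 0 ≤ 1 - θ := by linarith
    positivity
  have h7 : 0 ≤ ε * (P + 1) * a := by positivity
  nlinarith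

/-- Bernoulli gives `(1 + ε) ^ (1 / ε) ≥ 2`. Thus the top index of the search covers the residual
optimum, which is at most `N * V`. -/
theorem le_one_add_pow_ceil {ε : ℝ} (hε0 : 0 < ε) (hε : ε < 1) {N : ℕ} (hN : 0 < N) :
    (N : ℝ) ≤ (1 + ε) ^ ⌈Real.logb 2 (N : ℝ) / ε⌉₊ := by
  have hN' : (0 : ℝ) < N := by exact_mod_cast hN
  have hL : 0 ≤ Real.logb 2 (N : ℝ) :=
    Real.logb_nonneg (by norm_num) (by exact_mod_cast hN)
  have h2 : (2 : ℝ) ≤ (1 + ε) ^ (1 / ε) := by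
    have := one_add_mul_self_le_rpow_one_add (s := ε) (p := 1 / ε) (by linarith)
      (by rw [le_div_iff₀ hε0]; linarith)
    rw [one_div, inv_mul_cancel₀ hε0.ne'] at this
    rw [one_div]
    linarith
  calc (N : ℝ) = 2 ^ Real.logb 2 (N : ℝ) :=
        (Real.rpow_logb (by norm_num) (by norm_num) hN').symm
    _ ≤ ((1 + ε) ^ (1 / ε)) ^ Real.logb 2 (N : ℝ) := by gcongr
    _ = (1 + ε) ^ (Real.logb 2 (N : ℝ) / ε) := by
        rw [← Real.rpow_mul (by linarith)]; congr 1; ring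
    _ ≤ (1 + ε) ^ ((⌈Real.logb 2 (N : ℝ) / ε⌉₊ : ℕ) : ℝ) :=
        Real.rpow_le_rpow_of_exponent_le (by linarith) (Nat.le_ceil _)
    _ = (1 + ε) ^ ⌈Real.logb 2 (N : ℝ) / ε⌉₊ := Real.rpow_natCast _ _

theorem two_le_ceil_logb_div {ε : ℝ} (hε0 : 0 < ε) (hε : ε < 1) {N : ℕ} (hN : 2 ≤ N) :
    2 ≤ ⌈Real.logb 2 (N : ℝ) / ε⌉₊ := by
  refine Nat.lt_ceil.2 ?_
  rw [Nat.cast_one, lt_div_iff₀ hε0, one_mul]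
  refine hε.trans_le ?_
  rw [Real.le_logb_iff_rpow_le (by norm_num) (by positivity), Real.rpow_one]
  exact_mod_cast hN

/-! ### The gain over one enumerated set -/

section Extension

variable {n k m ℓ : ℕ} {f : Finset (Fin n) → ℝ} {M : Fin k → Matroid (Fin n)}
  {c : Fin m → Fin n → ℝ≥0} {A : Finset (Fin n)}

/-- `θ` is the share of `f O` that survives averaging over the candidates; leaving it open serves
general and monotone objectives at once. When `θ < ε`, `V ≤ 0` or at most one element remains, the
left side is nonpositive and `f A ≤ f T` suffices; otherwise the two final densities are compared.
-/
theorem extendSet_spec (hf : IsSubmodular f) (hf0 : ∀ S, 0 ≤ f S) (hm : 1 ≤ m) (hn : 0 < n)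
    (hℓ : 0 < ℓ) {p : Params} (hC : 1 ≤ p.C) (hε0 : 0 < p.ε) (hε : p.ε < 1) (hδ : p.δ = p.ε)
    {pairs : List (Fin n × Fin ℓ)} (hpairs : ∀ q, q ∈ pairs) (hA : Feasible M c A) :
    let T := (extendSet c p pairs A).eval f (memOracle M)
    Feasible M c T ∧ f A ≤ f T ∧
    ∀ (θ D : ℝ) (O : Finset (Fin n)), IsOptimal f M c O → A ⊆ O →
      (∀ e ∈ O \ A, p.C * (f (insert e A) - f A) ≤ f A) → θ ≤ 1 →
      (∀ S : Fin ℓ → Finset (Fin n), (∀ i j, i ≠ j → Disjoint (S i) (S j)) →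
        ℓ * (θ * f O) ≤ ∑ i, f (O ∪ S i)) →
      D = (max (ℓ - 1) k : ℕ) + 1 + m * (1 - p.ε) →
      p.β = (1 - p.ε) * (θ - p.ε) / D → p.γ = ((max (ℓ - 1) k : ℕ) + 1) / D →
      (1 - p.ε) ^ 2 * ((θ - p.ε) * f O - (1 - p.ε) * f A) - m * (1 - p.ε) * (f A / p.C) -
        p.ε * ((max (ℓ - 1) k : ℕ) + 1) * (f A / p.C) ≤ D * (f T - f A) := by
  intro T
  obtain ⟨C, δ, ε, β, γ⟩ := p
  simp only at hC hε0 hε hδ ⊢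
  subst hδ
  obtain ⟨z, hzdef⟩ : ∃ z : Finset (Fin n) → Prog n ℝ, z = fun S => (do
    let v ← queryValue (A ∪ S)
    charge 1
    pure (v - f A)) := ⟨_, rfl⟩
  obtain ⟨mem, hmemdef⟩ : ∃ mem : Finset (Fin n) → Prog n Bool,
    mem = fun S => queryMember (A ∪ S) := ⟨_, rfl⟩
  have hz : ∀ S, (z S).eval f (memOracle M) = (fun S => f (A ∪ S) - f A) S := by simp [hzdef]
  have hmem : ∀ S, (mem S).eval f (memOracle M) = (fun S => memOracle M (A ∪ S)) S := by
    simp [hmemdef]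
  obtain ⟨st, hst⟩ : ∃ st, st = (scanGround z mem (reducedCost c A) A C (f A)).eval f
    (memOracle M) := ⟨_, rfl⟩
  obtain ⟨hN, hVmax, hVex⟩ := scanGround_spec hz hmem (reducedCost c A) A C (f A)
  rw [← hst] at hN hVmax hVex
  obtain ⟨V, hV⟩ : ∃ V, V = st.2.getD 0 := ⟨_, rfl⟩
  rw [← hV] at hVmax hVex
  obtain ⟨rho, hrho⟩ : ∃ rho : ℕ → ℝ, rho = fun b => β * V * (1 + δ) ^ b + γ * f A / C := ⟨_, rfl⟩
  obtain ⟨b₀, hb₀⟩ : ∃ b₀, b₀ = ⌈Real.logb 2 (st.1.card : ℝ) / δ⌉₊ := ⟨_, rfl⟩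
  obtain ⟨sub, hsubdef⟩ : ∃ sub : ℝ → Prog n (Finset (Fin n) × Bool),
    sub = knapsackSGS z mem (reducedCost c A) st.1 pairs δ V := ⟨_, rfl⟩
  obtain ⟨found, hfound⟩ : ∃ found, found = (binarySearch sub rho 1 b₀).eval f (memOracle M) :=
    ⟨_, rfl⟩
  have hT : T = A ∪ ((argmax z found).eval f (memOracle M)).getD ∅ := by
    simp only [T, extendSet, eval_bind, eval_queryValue, eval_pure]
    rw [hfound, hrho, hb₀, hsubdef, hV, hst, hzdef, hmemdef]
  have hCpos : (0 : ℝ) < C := by exact_mod_cast hC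
  have hAind : memOracle M A = true := (memOracle_eq_true_iff A).2 hA.1
  have hAN : Disjoint A st.1 :=
    Finset.disjoint_left.2 fun e he he' => ((hN e).1 he').1 he
  have hspec := fun ρ => knapsackSGS_spec (c' := reducedCost c A) (N' := st.1) (v₀ := f A / C)
    (ρ := ρ) (V := V) hz hmem hε0 hε
    (hf.residual A) (fun S e h => memOracle_mono (Finset.union_subset_union_right
      (Finset.subset_insert e S)) h) hn hℓ (by simp) (by simpa using hAind)
    (fun e he => by
      rw [le_div_iff₀ hCpos, mul_comm]
      exact ((hN e).1 he).2) hpairs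
  rw [← hsubdef] at hspec
  have hmemfound : ∀ S ∈ found, S ⊆ st.1 ∧ Feasible M c (A ∪ S) ∧ 0 ≤ f (A ∪ S) - f A := by
    intro S hS
    rw [hfound] at hS
    obtain ⟨b, hb⟩ := mem_binarySearch f (memOracle M) sub rho 1 b₀ hS
    obtain ⟨⟨h1, h2, h3, h4⟩, -⟩ := hspec (rho b)
    rw [← hb] at h1 h2 h3 h4
    exact ⟨h1, (feasible_union_iff hA (hAN.mono_right h1)).2 ⟨h2, h3⟩, h4⟩
  obtain ⟨hTfeas, hTA, hTmax⟩ :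
      Feasible M c T ∧ f A ≤ f T ∧ ∀ S ∈ found, f (A ∪ S) ≤ f T := by
    rw [hT]
    rcases argmax_spec f (memOracle M) z _ hz found with ⟨h, h'⟩ | ⟨S, hS, h, hmax⟩
    · rw [h, h']
      simpa using hA
    · rw [h]
      obtain ⟨-, h1, h2⟩ := hmemfound S hS
      exact ⟨h1, by simpa using h2, fun S' hS' => by simpa using hmax S' hS'⟩
  refine ⟨hTfeas, hTA, ?_⟩
  intro θ D O hO hAO hsmall hθ1 havg hD hβ hγ
  have hm' : (1 : ℝ) ≤ m := by exact_mod_cast hm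
  obtain ⟨P, hP⟩ : ∃ P : ℕ, P = max (ℓ - 1) k := ⟨_, rfl⟩
  rw [← hP] at hD hγ ⊢
  have hP0 : (0 : ℝ) ≤ P := Nat.cast_nonneg _
  have he : 0 < 1 - δ := by linarith
  have hDpos : 0 < D := by rw [hD]; positivity
  obtain ⟨a, ha⟩ : ∃ a, a = f A / C := ⟨_, rfl⟩
  have ha0 : 0 ≤ a := by rw [ha]; exact div_nonneg (hf0 A) hCpos.le
  have hrho' : ∀ b, rho b = β * V * (1 + δ) ^ b + γ * a := by
    intro b; rw [hrho, ha]; ring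
  rw [← ha] at hspec ⊢
  have hw0 : 0 ≤ f T - f A := by linarith
  have hFX : f A ≤ f O := hO.2 A hA
  have hOA : A ∪ O \ A = O := Finset.union_sdiff_of_subset hAO
  have hOdisj : Disjoint A (O \ A) := Finset.disjoint_sdiff
  have hOfeas : Feasible M c (A ∪ O \ A) := by rw [hOA]; exact hO.1
  have hOmem := (feasible_union_iff hA hOdisj).1 hOfeas
  have hON : O \ A ⊆ st.1 := by
    intro e he
    refine (hN e).2 ⟨(Finset.mem_sdiff.1 he).2, ?_⟩
    simpa [Finset.union_insert] using hsmall e he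
  have hOsing : ∀ o ∈ O \ A, memOracle M (A ∪ {o}) = true ∧ ∀ j, reducedCost c A j o ≤ 1 := by
    intro o ho
    have h1 : {o} ⊆ O \ A := Finset.singleton_subset_iff.2 ho
    have := (feasible_union_iff hA (hOdisj.mono_right h1)).1
      (hOfeas.subset (Finset.union_subset_union_right h1))
    simpa using this
  have hOV : ∀ o ∈ O \ A, f (A ∪ {o}) - f A ≤ V := fun o ho =>
    hVmax o (hON ho) (hOsing o ho).1 (hOsing o ho).2
  have hXcard : f O - f A ≤ (O \ A).card * V := by
    have h1 := hf.union_sub_le_sum A O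
    rw [Finset.union_eq_right.2 hAO] at h1
    refine h1.trans ((Finset.sum_le_card_nsmul _ _ V fun e he => ?_).trans (by simp))
    simpa [Finset.union_insert] using hOV e he
  have htriv : (θ - δ) * (f O - f A) ≤ 0 →
      (1 - δ) ^ 2 * ((θ - δ) * f O - (1 - δ) * f A) - m * (1 - δ) * a - δ * (P + 1) * a ≤
        D * (f T - f A) := by
    intro h
    have h1 : 0 ≤ D * (f T - f A) := mul_nonneg hDpos.le hw0
    have h2 : 0 ≤ m * (1 - δ) * a := by positivity
    have h3 : 0 ≤ δ * (P + 1) * a := by positivity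
    have h4 : 0 ≤ (1 - θ) * f A := mul_nonneg (by linarith) (hf0 A)
    have h5 : (1 - δ) ^ 2 * ((θ - δ) * f O - (1 - δ) * f A) ≤ 0 :=
      mul_nonpos_of_nonneg_of_nonpos (by positivity) (by linarith)
    linarith
  rcases lt_or_ge θ δ with hθ | hθ
  · exact htriv (mul_nonpos_of_nonpos_of_nonneg (by linarith) (by linarith))
  rcases le_or_gt V 0 with hV0 | hV0
  · refine htriv (mul_nonpos_of_nonneg_of_nonpos (by linarith) (hXcard.trans ?_))
    exact mul_nonpos_of_nonneg_of_nonpos (Nat.cast_nonneg _) hV0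
  have hVa : V ≤ a := by
    rcases hVex with h | ⟨e, he, -, -, h⟩
    · linarith
    · rw [ha, le_div_iff₀ hCpos, mul_comm, h]
      exact ((hN e).1 he).2
  have hβ0 : 0 ≤ β := by
    rw [hβ]; exact div_nonneg (mul_nonneg he.le (by linarith)) hDpos.le
  have hγ0 : 0 ≤ γ := by rw [hγ]; positivity
  have hXN : f O - f A ≤ st.1.card * V := by
    refine hXcard.trans (mul_le_mul_of_nonneg_right ?_ hV0.le)
    exact_mod_cast Finset.card_le_card hON
  -- With at most one element, `f O` exceeds `f A` by at most `V ≤ a`, and the loss `m * (1 - δ) *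
  -- a` absorbs this because `m ≥ 1`.
  rcases le_or_gt st.1.card 1 with hcard | hcard
  · have h1 : f O - f A ≤ a := by
      refine hXN.trans (le_trans ?_ hVa)
      exact mul_le_of_le_one_left hV0.le (by exact_mod_cast hcard)
    have h2 : (1 - δ) ^ 2 * ((θ - δ) * (f O - f A)) ≤ m * (1 - δ) * a := by
      have h3 : (θ - δ) * (f O - f A) ≤ 1 * a :=
        mul_le_mul (by linarith) h1 (by linarith) zero_le_one
      calc (1 - δ) ^ 2 * ((θ - δ) * (f O - f A)) ≤ (1 - δ) ^ 2 * (1 * a) := by gcongr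
        _ ≤ m * (1 - δ) * a := by
          have h4 : (1 - δ) * (1 - δ) ≤ 1 * (1 - δ) :=
            mul_le_mul_of_nonneg_right (by linarith) he.le
          have h5 : 1 * (1 - δ) ≤ m * (1 - δ) := mul_le_mul_of_nonneg_right hm' he.le
          have h6 := mul_le_mul_of_nonneg_right (h4.trans h5) ha0
          linarith
    have h4 : 0 ≤ (1 - δ) ^ 2 * ((1 - θ) * f A) :=
      mul_nonneg (by positivity) (mul_nonneg (by linarith) (hf0 A))
    have h3 : 0 ≤ δ * (P + 1) * a := by positivity
    have h5 : 0 ≤ D * (f T - f A) := mul_nonneg hDpos.le hw0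
    linarith
  have hb₀2 : 2 ≤ b₀ := by rw [hb₀]; exact two_le_ceil_logb_div hε0 hε hcard
  obtain ⟨b, hb1, hb2, hE1, hE0⟩ := binarySearch_spec f (memOracle M) sub rho 1 b₀ (by omega)
  rw [← hfound] at hE1 hE0
  have ht0 : 0 ≤ (1 + δ) ^ b := by positivity
  have hlow : β * V * (1 + δ) ^ b + γ * a - a ≤ f T - f A := by
    -- At the initial index the density is at most `a`, by `β * (1 + δ) + γ ≤ 1` and `V ≤ a`, so the
    -- inequality holds without any run.
    rcases hE1 with rfl | ⟨hv, hmemb⟩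
    · refine le_trans ?_ hw0
      have h1 : β * (1 + δ) + γ ≤ 1 := by
        rw [hβ, hγ, div_mul_eq_mul_div, ← add_div, div_le_one hDpos, hD]
        have h2 : (θ - δ) * (1 + δ) ≤ (1 - δ) * (1 + δ) := by gcongr
        have h3 : (θ - δ) * (1 + δ) ≤ 1 := by nlinarith
        have h4 : (1 - δ) * ((θ - δ) * (1 + δ)) ≤ (1 - δ) * m :=
          mul_le_mul_of_nonneg_left (h3.trans hm') he.le
        linarith
      have h2 : β * (1 + δ) * V ≤ β * (1 + δ) * a := by gcongr
      have h3 := mul_le_mul_of_nonneg_right h1 ha0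
      rw [pow_one]
      linarith
    · have h1 := (hspec (rho b)).2.1 hv
      have h2 := hTmax _ hmemb
      rw [hrho' b] at h1
      rw [hrho' b] at h2
      linarith
  rcases hE0 with hbb | ⟨hv, hmemb⟩
  -- The upper index is the initial `b₀`, where no run is available; the power `(1 + δ) ^ b₀` is at
  -- least the number of remaining elements.
  · refine bound_of_large_density hε0 hε hP0 hm' hD hγ hβ hθ hθ1 (hf0 A) ha0 hV0.le hXN ?_ ht0 hlow
    rw [← pow_succ, hbb, hb₀]
    exact le_one_add_pow_ceil hε0 hε (by omega)
  · have hρ : 0 ≤ rho (b + 1) := by rw [hrho']; positivity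
    obtain ⟨S, hSdisj, hS⟩ := (hspec (rho (b + 1))).2.2 hv hρ hV0 k (O \ A) hON
      (conflictBound_memOracle hAN hOdisj hOmem.1) (fun o ho => (hOsing o ho).1) hOV hOmem.2
    have h2 := hTmax _ hmemb
    refine combine_densities hε0 hε hP0 hm' hD hγ hβ0 ha0 hV0.le hVa hFX ht0 hw0 hlow ?_
    have h3 := havg S hSdisj
    have h4 : ∑ i, (f (A ∪ (S i ∪ O \ A)) - f A) = ∑ i, f (O ∪ S i) - ℓ * f A := by
      rw [Finset.sum_sub_distrib]
      congr 1
      · refine Finset.sum_congr rfl fun i _ => ?_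
        rw [Finset.union_comm (S i), ← Finset.union_assoc, hOA]
      · simp
    rw [h4, ← hP] at hS
    have hℓ' : (0 : ℝ) < ℓ := by exact_mod_cast hℓ
    refine le_of_mul_le_mul_left ?_ hℓ'
    rw [hrho' (b + 1), pow_succ] at hS
    rw [hrho' (b + 1), pow_succ] at h2
    have h5 : (P + 1 - δ) * (f (A ∪ ((sub (β * V * ((1 + δ) ^ b * (1 + δ)) + γ * a)).eval f
        (memOracle M)).1) - f A) ≤ (P + 1 - δ) * (f T - f A) :=
      mul_le_mul_of_nonneg_left (by linarith) (by linarith)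
    have h6 := mul_le_mul_of_nonneg_left h5 hℓ'.le
    have h7 := mul_le_mul_of_nonneg_left h3 he.le
    linarith

end Extension

/-! ### Approximation ratios -/

section Approximation

variable {n k m ℓ : ℕ} {f : Finset (Fin n) → ℝ} {M : Fin k → Matroid (Fin n)}
  {c : Fin m → Fin n → ℝ≥0}

theorem sprout_eval (p : Params) (sets : List (Finset (Fin n))) (pairs : List (Fin n × Fin ℓ)) :
    ((sprout c p sets pairs).eval f (memOracle M) = none ∧ ∀ A ∈ sets, ¬ Feasible M c A) ∨
    ∃ A ∈ sets, Feasible M c A ∧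
      (sprout c p sets pairs).eval f (memOracle M) =
        some ((extendSet c p pairs A).eval f (memOracle M)) ∧
      ∀ B ∈ sets, Feasible M c B →
        f ((extendSet c p pairs B).eval f (memOracle M)) ≤
          f ((extendSet c p pairs A).eval f (memOracle M)) := by
  have hfeas : ∀ A, Feasible M c A ↔ memOracle M A = true ∧ ∀ j, ∑ e ∈ A, c j e ≤ 1 := by
    intro A
    rw [memOracle_eq_true_iff]
    rfl
  have H : ∀ step : List (Finset (Fin n)) → Finset (Fin n) → List (Finset (Fin n)),
      (∀ acc A, Feasible M c A →
        step acc A = (extendSet c p pairs A).eval f (memOracle M) :: acc) →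
      (∀ acc A, ¬ Feasible M c A → step acc A = acc) →
      ∀ T, T ∈ sets.foldl step [] ↔
        ∃ A ∈ sets, Feasible M c A ∧ T = (extendSet c p pairs A).eval f (memOracle M) := by
    intro step h1 h2 T
    suffices h : ∀ acc, T ∈ sets.foldl step acc ↔ T ∈ acc ∨
        ∃ A ∈ sets, Feasible M c A ∧ T = (extendSet c p pairs A).eval f (memOracle M) by
      simpa using h []
    induction sets with
    | nil => simp
    | cons A L ih =>
      intro acc
      rw [List.foldl_cons, ih]
      by_cases hA : Feasible M c A
      · simp [h1 _ _ hA, hA]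
        tauto
      · simp [h2 _ _ hA, hA]
  obtain ⟨cands, hsp, hcands⟩ : ∃ cands : List (Finset (Fin n)),
      (sprout c p sets pairs).eval f (memOracle M) =
        (argmax queryValue cands).eval f (memOracle M) ∧
      ∀ T, T ∈ cands ↔
        ∃ A ∈ sets, Feasible M c A ∧ T = (extendSet c p pairs A).eval f (memOracle M) := by
    refine ⟨_, by rw [sprout, eval_bind, eval_foldlM], H _ ?_ ?_⟩
    · intro acc A hA
      have hA' : (queryMember A).eval f (memOracle M) = true ∧ ∀ j, ∑ e ∈ A, c j e ≤ 1 :=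
        (hfeas A).1 hA
      rw [eval_bind, eval_bind, if_pos hA', eval_bind, eval_pure]
    · intro acc A hA
      have hA' : ¬ ((queryMember A).eval f (memOracle M) = true ∧ ∀ j, ∑ e ∈ A, c j e ≤ 1) :=
        fun h => hA ((hfeas A).2 h)
      rw [eval_bind, eval_bind, if_neg hA', eval_pure]
  rw [hsp]
  rcases argmax_spec f (memOracle M) queryValue f (fun S => eval_queryValue f _ S) cands
    with ⟨h, h'⟩ | ⟨S, hS, h, hmax⟩
  · refine Or.inl ⟨h, fun A hA hAf => ?_⟩
    have := (hcands _).2 ⟨A, hA, hAf, rfl⟩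
    rw [h'] at this
    simp at this
  · obtain ⟨A, hA, hAf, rfl⟩ := (hcands S).1 hS
    exact Or.inr ⟨A, hA, hAf, h, fun B hB hBf => hmax _ ((hcands _).2 ⟨B, hB, hBf, rfl⟩)⟩

theorem pos_of_listsSets {C : ℕ} {sets : List (Finset (Fin n))} (hC : 1 ≤ C)
    (hsets : ListsSets C sets) {A : Finset (Fin n)} (hA : A ∈ sets) : 0 < n := by
  have h1 := (hsets.2 A).1 hA
  have h2 := Finset.card_le_univ A
  rw [Fintype.card_fin] at h2
  omega

/-- Every set that the algorithm returns is feasible. -/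
theorem sprout_feasible (hf : IsSubmodular f) (hf0 : ∀ S, 0 ≤ f S) (hm : 1 ≤ m) (hℓ : 0 < ℓ)
    {p : Params} (hC : 1 ≤ p.C) (hε0 : 0 < p.ε) (hε : p.ε < 1) (hδ : p.δ = p.ε)
    {sets : List (Finset (Fin n))} (hsets : ListsSets p.C sets)
    {pairs : List (Fin n × Fin ℓ)} (hpairs : ListsPairs pairs) {S : Finset (Fin n)}
    (hS : (sprout c p sets pairs).eval f (memOracle M) = some S) : Feasible M c S := by
  rcases sprout_eval (f := f) (M := M) (c := c) p sets pairs with ⟨h, -⟩ | ⟨A, hA, hAf, h, -⟩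
  · rw [h] at hS
    exact absurd hS (by simp)
  · rw [h, Option.some.injEq] at hS
    rw [← hS]
    exact (extendSet_spec hf hf0 hm (pos_of_listsSets hC hsets hA) hℓ hC hε0 hε hδ hpairs.2 hAf).1

/-- The value of the returned set in terms of that of a proportional part of an optimal solution. -/
theorem sprout_value (hf : IsSubmodular f) (hf0 : ∀ S, 0 ≤ f S) (hm : 1 ≤ m) (hℓ : 0 < ℓ)
    {p : Params} (hC : 1 ≤ p.C) (hε0 : 0 < p.ε) (hε : p.ε < 1) (hδ : p.δ = p.ε)
    {sets : List (Finset (Fin n))} (hsets : ListsSets p.C sets)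
    {pairs : List (Fin n × Fin ℓ)} (hpairs : ListsPairs pairs) {θ D : ℝ} {O : Finset (Fin n)}
    (hO : IsOptimal f M c O) (hCO : p.C ≤ O.card) (hθ1 : θ ≤ 1)
    (havg : ∀ S : Fin ℓ → Finset (Fin n), (∀ i j, i ≠ j → Disjoint (S i) (S j)) →
      ℓ * (θ * f O) ≤ ∑ i, f (O ∪ S i))
    (hD : D = (max (ℓ - 1) k : ℕ) + 1 + m * (1 - p.ε))
    (hβ : p.β = (1 - p.ε) * (θ - p.ε) / D) (hγ : p.γ = ((max (ℓ - 1) k : ℕ) + 1) / D) :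
    ∃ S, (sprout c p sets pairs).eval f (memOracle M) = some S ∧ Feasible M c S ∧
      ∃ F, 0 ≤ F ∧ p.C * f O ≤ O.card * F ∧ F ≤ f S ∧
        (1 - p.ε) ^ 2 * ((θ - p.ε) * f O - (1 - p.ε) * F) - m * (1 - p.ε) * (F / p.C) -
          p.ε * ((max (ℓ - 1) k : ℕ) + 1) * (F / p.C) ≤ D * (f S - F) := by
  obtain ⟨A, hAO, hAcard, hshare, hsmall⟩ := hf.exists_share hf0 O p.C hCO
  have hAf : Feasible M c A := hO.1.subset hAO
  have hAsets : A ∈ sets := (hsets.2 A).2 hAcard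
  have hn := pos_of_listsSets hC hsets hAsets
  rcases sprout_eval (f := f) (M := M) (c := c) p sets pairs with ⟨-, h⟩ | ⟨B, hB, hBf, h, hmax⟩
  · exact absurd hAf (h A hAsets)
  · obtain ⟨-, h1, h2⟩ := extendSet_spec hf hf0 hm hn hℓ hC hε0 hε hδ hpairs.2 hAf
    have h3 := hmax A hAsets hAf
    have hDpos : 0 ≤ D := by
      have : 0 ≤ 1 - p.ε := by linarith
      rw [hD]; positivity
    refine ⟨_, h, (extendSet_spec hf hf0 hm hn hℓ hC hε0 hε hδ hpairs.2 hBf).1, f A, hf0 A,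
      hshare, h1.trans h3, (h2 θ D O hO hAO hsmall hθ1 havg hD hβ hγ).trans ?_⟩
    exact mul_le_mul_of_nonneg_left (by linarith) hDpos

/-- The sign allows the lower bound `X / r` for `F / C` to be inserted, and the whole term to be
dropped when `C = 1`. -/
theorem enumeration_bonus_nonneg {C P m ε : ℝ} (hC : 1 ≤ C) (hP : 0 ≤ P) (hm : 0 ≤ m)
    (hε0 : 0 < ε) (hε : ε < 1) :
    0 ≤ (C - ε) * (P + 1) + (C - 1) * m * (1 - ε) - C * (1 - ε) ^ 3 := by
  have he : 0 < 1 - ε := by linarith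
  have h1 : 0 ≤ (C - 1) * m * (1 - ε) :=
    mul_nonneg (mul_nonneg (by linarith) hm) he.le
  have h2 : C * (1 - ε) ≤ C - ε := by nlinarith
  have h3 : (C - ε) * 1 ≤ (C - ε) * (P + 1) :=
    mul_le_mul_of_nonneg_left (by linarith) (by linarith)
  have h4 : (1 - ε) ^ 3 ≤ 1 - ε := by
    have : (1 - ε) ^ 2 ≤ 1 := by nlinarith
    nlinarith
  have h5 : C * (1 - ε) ^ 3 ≤ C * (1 - ε) := mul_le_mul_of_nonneg_left h4 (by linarith)
  linarith

/-- The guarantee of `sprout_value` as an approximation ratio. -/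
theorem ratio_of_value {C P m ε θ D F X Y r : ℝ} (hC : 1 ≤ C) (hP : 0 ≤ P) (hm : 0 ≤ m)
    (hε0 : 0 < ε) (hε : ε < 1) (hr : 0 < r) (hD : D = P + 1 + m * (1 - ε))
    (hF : C * X ≤ r * F)
    (h : (1 - ε) ^ 2 * ((θ - ε) * X - (1 - ε) * F) - m * (1 - ε) * (F / C) -
      ε * (P + 1) * (F / C) ≤ D * (Y - F)) :
    ((1 - ε) ^ 2 * ((θ - ε) / D) +
      ((C - ε) * (P + 1) + (C - 1) * m * (1 - ε) - C * (1 - ε) ^ 3) / (r * D)) * X ≤ Y := by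
  have hB := enumeration_bonus_nonneg hC hP hm hε0 hε
  obtain ⟨B, hBdef⟩ : ∃ B, B = (C - ε) * (P + 1) + (C - 1) * m * (1 - ε) - C * (1 - ε) ^ 3 :=
    ⟨_, rfl⟩
  have he : 0 < 1 - ε := by linarith
  have hDpos : 0 < D := by rw [hD]; positivity
  have hCpos : 0 < C := by linarith
  obtain ⟨a, ha⟩ : ∃ a, a = F / C := ⟨_, rfl⟩
  have hFa : F = C * a := by rw [ha]; field_simp
  have hXa : X / r ≤ a := by
    rw [div_le_iff₀ hr]
    rw [hFa] at hF
    have : C * X ≤ C * (a * r) := by linarith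
    exact le_of_mul_le_mul_left this hCpos
  rw [← hBdef] at hB ⊢
  have h1 := mul_le_mul_of_nonneg_left hXa hB
  -- With `F = C * a`, the coefficients of `a` collect to `C * D - C * (1 - ε) ^ 3 - m * (1 - ε) - ε
  -- * (P + 1)`, which is `B`.
  have h2 : (1 - ε) ^ 2 * (θ - ε) * X + B * a ≤ D * Y := by
    rw [← ha, hFa] at h
    rw [hD] at h ⊢
    rw [hBdef]
    linarith
  have h3 : ((1 - ε) ^ 2 * ((θ - ε) / D) + B / (r * D)) * X =
      ((1 - ε) ^ 2 * (θ - ε) * X + B * (X / r)) / D := by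
    field_simp
  rw [h3, div_le_iff₀ hDpos]
  linarith

theorem numP_bounds (k m : ℕ) (hm : 1 ≤ m) :
    2 ≤ numP k m ∧ √((m : ℝ) + 1) ≤ numP k m ∧ k ≤ numP k m ∧
      ((numP k m : ℝ) ≤ √((m : ℝ) + 1) + 1 ∨ numP k m = k) := by
  have h1 : numP k m = max ⌈√((m : ℝ) + 1)⌉₊ k := by rw [numP, add_comm]
  have h2 : 2 ≤ ⌈√((m : ℝ) + 1)⌉₊ := by
    refine Nat.lt_ceil.2 ?_
    rw [Nat.cast_one, Real.lt_sqrt zero_le_one]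
    have : (1 : ℝ) ≤ m := by exact_mod_cast hm
    linarith
  rw [h1]
  refine ⟨h2.trans (le_max_left _ _), (Nat.le_ceil _).trans (by exact_mod_cast le_max_left _ _),
    le_max_right _ _, ?_⟩
  rcases le_total ⌈√((m : ℝ) + 1)⌉₊ k with h | h
  · exact Or.inr (max_eq_right h)
  · rw [max_eq_left h]
    exact Or.inl (Nat.ceil_lt_add_one (Real.sqrt_nonneg _)).le

/-- The choice of `P` balances the loss of `1 / (P + 1)` against the denominator `P + 1 + m`. -/
theorem numP_balance (k m : ℕ) (hm : 1 ≤ m) :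
    ((numP k m : ℝ) + 1) * (numP k m + 1 + m) ≤
      numP k m * (k + m + 3 + 2 * √((m : ℝ) + 1)) := by
  obtain ⟨-, h2, h3, h4⟩ := numP_bounds k m hm
  have hs := Real.sq_sqrt (show (0 : ℝ) ≤ (m : ℝ) + 1 by positivity)
  have hs0 := Real.sqrt_nonneg ((m : ℝ) + 1)
  obtain ⟨s, hs'⟩ : ∃ s, s = √((m : ℝ) + 1) := ⟨_, rfl⟩
  rw [← hs'] at h2 h4 hs hs0 ⊢
  have hP0 : (0 : ℝ) ≤ numP k m := Nat.cast_nonneg _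
  -- Since `m + 1 = s ^ 2`, the claim expands to `s * s ≤ P * (k + 1 + 2 * s - P)`, and each factor
  -- on the right is at least `s`.
  have h5 : s ≤ k + 1 + 2 * s - numP k m := by
    rcases h4 with h4 | h4
    · have : (0 : ℝ) ≤ k := Nat.cast_nonneg _
      linarith
    · rw [h4]; linarith
  have h6 : s * s ≤ numP k m * (k + 1 + 2 * s - numP k m) :=
    mul_le_mul h2 h5 hs0 hP0
  nlinarith

/-- As `P / (P + 1) ≥ 1 / 2`, subtracting `ε` from it costs at most a factor `1 - 2 * ε`; the rest
is `numP_balance`. -/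
theorem ratio_le (k m : ℕ) (hm : 1 ≤ m) {ε : ℝ} (hε0 : 0 < ε) (hε : ε < 1)
    (hθ : ε ≤ 1 - 1 / ((numP k m : ℝ) + 1)) :
    (1 - 2 * ε) / (k + m + 3 + 2 * √((m : ℝ) + 1)) ≤
      (1 - 1 / ((numP k m : ℝ) + 1) - ε) / (numP k m + 1 + m * (1 - ε)) := by
  obtain ⟨h1, -⟩ := numP_bounds k m hm
  have hbal := numP_balance k m hm
  obtain ⟨P, hP⟩ : ∃ P : ℝ, P = numP k m := ⟨_, rfl⟩
  obtain ⟨Q, hQ⟩ : ∃ Q : ℝ, Q = k + m + 3 + 2 * √((m : ℝ) + 1) := ⟨_, rfl⟩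
  have hP2 : 2 ≤ P := by rw [hP]; exact_mod_cast h1
  have hQpos : 0 < Q := by rw [hQ]; positivity
  rw [← hP, ← hQ] at hbal
  rw [← hP] at hθ
  rw [← hP, ← hQ]
  have he : 0 < 1 - ε := by linarith
  have hm0 : (0 : ℝ) ≤ m := Nat.cast_nonneg _
  have hDpos : 0 < P + 1 + m * (1 - ε) := by positivity
  have hθ' : 0 ≤ 1 - 1 / (P + 1) - ε := by linarith
  rcases le_or_gt (1 - 2 * ε) 0 with h | h
  · exact (div_nonpos_of_nonpos_of_nonneg h hQpos.le).trans (div_nonneg hθ' hDpos.le)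
  · have h3 : (1 - 2 * ε) * (P / (P + 1)) ≤ 1 - 1 / (P + 1) - ε := by
      have h4 : P / (P + 1) = 1 - 1 / (P + 1) := by field_simp; ring
      have h5 : 1 / (P + 1) ≤ 1 / 2 := one_div_le_one_div_of_le (by norm_num) (by linarith)
      rw [h4]
      nlinarith
    calc (1 - 2 * ε) / Q ≤ (1 - 2 * ε) * (P / (P + 1)) / (P + 1 + m) := by
          rw [div_le_div_iff₀ hQpos (by positivity), ← mul_div_assoc, div_mul_eq_mul_div,
            le_div_iff₀ (by positivity)]
          have := mul_le_mul_of_nonneg_left hbal h.le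
          linarith
      _ ≤ (1 - 1 / (P + 1) - ε) / (P + 1 + m) := by gcongr
      _ ≤ (1 - 1 / (P + 1) - ε) / (P + 1 + m * (1 - ε)) := by
          apply div_le_div_of_nonneg_left hθ' hDpos
          have : (m : ℝ) * (1 - ε) ≤ m := mul_le_of_le_one_right hm0 (by linarith)
          linarith

/-- The approximation guarantee for a general objective. -/
theorem sprout_general (hf : IsSubmodular f) (hf0 : ∀ S, 0 ≤ f S) (hm : 1 ≤ m) {C : ℕ}
    (hC : 1 ≤ C) {ε : ℝ} (hε0 : 0 < ε) (hε : ε < 1) {sets : List (Finset (Fin n))}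
    (hsets : ListsSets C sets) {pairs : List (Fin n × Fin (numP k m + 1))}
    (hpairs : ListsPairs pairs) {O : Finset (Fin n)} (hO : IsOptimal f M c O) (hCO : C ≤ O.card) :
    ∃ S, (sprout c (generalParams k m (numP k m + 1) C ε) sets pairs).eval f (memOracle M) = some S ∧
      Feasible M c S ∧
      ((1 - ε) ^ 2 * (1 - 2 * ε) / (k + m + 3 + 2 * √((m : ℝ) + 1)) +
        ((C - ε) * (numP k m + 1) + (C - 1) * m * (1 - ε) - C * (1 - ε) ^ 3) /
          (O.card * (numP k m + 1 + m * (1 - ε)))) * f O ≤ f S := by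
  obtain ⟨hP2, -, hkP, -⟩ := numP_bounds k m hm
  have hmax : max (numP k m + 1 - 1) k = numP k m := by
    rw [Nat.add_sub_cancel]; exact max_eq_left hkP
  have hcast : ((numP k m + 1 : ℕ) : ℝ) = (numP k m : ℝ) + 1 := by push_cast; rfl
  obtain ⟨S, hS, hSf, F, hF0, hF, hFS, hval⟩ := sprout_value (c := c) (M := M) hf hf0 hm
    (Nat.succ_pos (numP k m)) (p := generalParams k m (numP k m + 1) C ε) hC hε0 hε rfl hsets hpairs
    (θ := 1 - 1 / ((numP k m + 1 : ℕ) : ℝ))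
    (D := (max (numP k m + 1 - 1) k : ℕ) + 1 + m * (1 - ε)) hO hCO
    (by
      have : (0 : ℝ) ≤ 1 / ((numP k m + 1 : ℕ) : ℝ) := by positivity
      linarith)
    (fun S hS => by
      have := hf.card_mul_le_sum_union hf0 Finset.univ O S hS
      rw [Finset.card_univ, Fintype.card_fin] at this
      refine le_of_eq_of_le ?_ this
      field_simp) rfl rfl rfl
  refine ⟨S, hS, hSf, ?_⟩
  rw [hmax, hcast] at hval
  simp only [generalParams] at hval hF
  have he : 0 < 1 - ε := by linarith
  have hC' : (1 : ℝ) ≤ C := by exact_mod_cast hC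
  have hr : (0 : ℝ) < O.card := by exact_mod_cast hC.trans hCO
  have hP0 : (0 : ℝ) ≤ numP k m := Nat.cast_nonneg _
  have hm0 : (0 : ℝ) ≤ m := Nat.cast_nonneg _
  rcases le_or_gt ε (1 - 1 / ((numP k m : ℝ) + 1)) with hθ | hθ
  · refine le_trans ?_ (ratio_of_value hC' hP0 hm0 hε0 hε hr rfl hF hval)
    refine mul_le_mul_of_nonneg_right (add_le_add_left ?_ _) (hf0 O)
    rw [mul_div_assoc]
    exact mul_le_mul_of_nonneg_left (ratio_le k m hm hε0 hε hθ) (by positivity)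
  -- Now `ε > 1 / 2`, so the first summand of the ratio is nonpositive, while the second is at most
  -- `C / r`, a share that the greedy part of `O` attains alone.
  · have h1 : 1 / ((numP k m : ℝ) + 1) ≤ 1 / 2 :=
      one_div_le_one_div_of_le (by norm_num) (by
        have : (2 : ℝ) ≤ numP k m := by exact_mod_cast hP2
        linarith)
    have h2 : (1 - ε) ^ 2 * (1 - 2 * ε) / (k + m + 3 + 2 * √((m : ℝ) + 1)) ≤ 0 :=
      div_nonpos_of_nonpos_of_nonneg
        (mul_nonpos_of_nonneg_of_nonpos (by positivity) (by linarith)) (by positivity)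
    have h3 : ((C - ε) * (numP k m + 1) + (C - 1) * m * (1 - ε) - C * (1 - ε) ^ 3) /
        (O.card * (numP k m + 1 + m * (1 - ε))) ≤ C / O.card := by
      rw [div_le_div_iff₀ (by positivity) hr]
      have h4 : (C - ε) * (numP k m + 1) + (C - 1) * m * (1 - ε) - C * (1 - ε) ^ 3 ≤
          C * (numP k m + 1 + m * (1 - ε)) := by
        have h5 : 0 ≤ ε * ((numP k m : ℝ) + 1) := by positivity
        have h6 : 0 ≤ (m : ℝ) * (1 - ε) := by positivity
        have h7 : 0 ≤ (C : ℝ) * (1 - ε) ^ 3 := by positivity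
        linarith
      have := mul_le_mul_of_nonneg_right h4 hr.le
      linarith
    refine (mul_le_mul_of_nonneg_right (add_le_add h2 h3) (hf0 O)).trans (le_trans ?_ hFS)
    rw [zero_add, div_mul_eq_mul_div, div_le_iff₀ hr]
    linarith

/-- The approximation guarantee for a monotone objective. -/
theorem sprout_monotone (hf : IsSubmodular f) (hf0 : ∀ S, 0 ≤ f S) (hmono : Monotone f)
    (hm : 1 ≤ m) (hℓ : 1 ≤ ℓ) (hℓk : ℓ ≤ k + 1) {ε : ℝ} (hε0 : 0 < ε) (hε : ε < 1)
    {sets : List (Finset (Fin n))} (hsets : ListsSets 1 sets) {pairs : List (Fin n × Fin ℓ)}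
    (hpairs : ListsPairs pairs) {O : Finset (Fin n)} (hO : IsOptimal f M c O)
    (hne : O.Nonempty) :
    ∃ S, (sprout c (monotoneParams k m ℓ 1 ε) sets pairs).eval f (memOracle M) = some S ∧
      Feasible M c S ∧ (1 - ε) ^ 3 / (k + m + 1) * f O ≤ f S := by
  have hmax : max (ℓ - 1) k = k := max_eq_right (by omega)
  obtain ⟨S, hS, hSf, F, hF0, hF, hFS, hval⟩ := sprout_value (c := c) (M := M) hf hf0 hm
    (Nat.lt_of_lt_of_le zero_lt_one hℓ) (p := monotoneParams k m ℓ 1 ε) le_rfl hε0 hε rfl hsets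
    hpairs (θ := 1) (D := (max (ℓ - 1) k : ℕ) + 1 + m * (1 - ε)) hO hne.card_pos le_rfl
    (fun S hS => by
      have : ∑ i : Fin ℓ, f O ≤ ∑ i, f (O ∪ S i) :=
        Finset.sum_le_sum fun i _ => hmono Finset.subset_union_left
      simpa using this) rfl rfl rfl
  refine ⟨S, hS, hSf, ?_⟩
  rw [hmax] at hval
  simp only [monotoneParams] at hval hF
  have he : 0 < 1 - ε := by linarith
  have hr : (0 : ℝ) < O.card := by exact_mod_cast hne.card_pos
  have hk0 : (0 : ℝ) ≤ k := Nat.cast_nonneg _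
  have hm0 : (0 : ℝ) ≤ m := Nat.cast_nonneg _
  have hDpos : 0 < (k : ℝ) + 1 + m * (1 - ε) := by positivity
  refine le_trans ?_ (ratio_of_value (by simp) hk0 hm0 hε0 hε hr rfl hF hval)
  refine mul_le_mul_of_nonneg_right ?_ (hf0 O)
  have hB := enumeration_bonus_nonneg (C := ((1 : ℕ) : ℝ)) (by simp) hk0 hm0 hε0 hε
  refine le_trans ?_ (le_add_of_nonneg_right (div_nonneg hB (mul_nonneg hr.le hDpos.le)))
  rw [pow_succ, mul_div_assoc]
  refine mul_le_mul_of_nonneg_left ?_ (by positivity)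
  apply div_le_div_of_nonneg_left he.le hDpos
  have : (m : ℝ) * (1 - ε) ≤ m := mul_le_of_le_one_right hm0 (by linarith)
  linarith

/-- For `x = ε / 8`, `(1 - x) ^ 2 * (1 - 2 * x) ≥ 1 - 4 * x = 1 - ε / 2`, and `(1 + ε) * (1 - ε / 2)
≥ 1`. -/
theorem one_le_one_add_mul_of_eighth {ε : ℝ} (hε0 : 0 < ε) (hε : ε < 1) :
    1 ≤ (1 + ε) * ((1 - ε / 8) ^ 2 * (1 - 2 * (ε / 8))) ∧
      1 ≤ (1 + ε) * (1 - ε / 8) ^ 3 := by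
  have h1 : 1 - ε / 2 ≤ (1 - ε / 8) ^ 2 * (1 - 2 * (ε / 8)) := by
    have : 0 ≤ ε ^ 2 * (20 - 2 * ε) := mul_nonneg (by positivity) (by linarith)
    nlinarith
  have h2 : (1 - ε / 8) ^ 2 * (1 - 2 * (ε / 8)) ≤ (1 - ε / 8) ^ 3 := by
    rw [pow_succ (1 - ε / 8) 2]
    exact mul_le_mul_of_nonneg_left (by linarith) (by positivity)
  have h3 : 1 ≤ (1 + ε) * (1 - ε / 2) := by nlinarith
  have h4 := h3.trans (mul_le_mul_of_nonneg_left h1 (by linarith))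
  exact ⟨h4, h4.trans (mul_le_mul_of_nonneg_left h2 (by linarith))⟩

/-- A lower bound `α / Q * X ≤ Y`, with `α` close to one, as an upper bound on `X`. -/
theorem le_mul_of_ratio_le {ε α Q X Y : ℝ} (hε0 : 0 < ε) (hα : 1 ≤ (1 + ε) * α) (hQ : 0 < Q)
    (hX : 0 ≤ X) (h : α / Q * X ≤ Y) : X ≤ (1 + ε) * Q * Y := by
  have h1 := mul_le_mul_of_nonneg_left h (show 0 ≤ (1 + ε) * Q by positivity)
  have h2 : (1 + ε) * Q * (α / Q * X) = (1 + ε) * α * X := by field_simp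
  have h3 := mul_le_mul_of_nonneg_right hα hX
  linarith

end Approximation

/-! ### Costs of the subroutine, the scan and the search -/

section Cost

variable {n m ℓ : ℕ} {f : Finset (Fin n) → ℝ} {om : Finset (Fin n) → Bool}
  {z : Finset (Fin n) → Prog n ℝ} {mem : Finset (Fin n) → Prog n Bool}

theorem oracleCalls_ite {β : Type} (P : Prop) [Decidable P] (p q : Prog n β) :
    (if P then p else q).oracleCalls f om =
      if P then p.oracleCalls f om else q.oracleCalls f om := by
  split_ifs <;> rfl

theorem arithOps_ite {β : Type} (P : Prop) [Decidable P] (p q : Prog n β) :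
    (if P then p else q).arithOps f om = if P then p.arithOps f om else q.arithOps f om := by
  split_ifs <;> rfl

theorem oracleCalls_sgsStep_le (hz : ∀ S, (z S).oracleCalls f om ≤ 1)
    (hm : ∀ S, (mem S).oracleCalls f om ≤ 1) (c' : Fin m → Fin n → ℝ≥0∞) (ρ τ : ℝ)
    (s : SGSState n m ℓ) (q : Fin n × Fin ℓ) :
    (sgsStep z mem c' ρ τ s q).oracleCalls f om ≤ 3 := by
  have h1 := hm (insert q.1 (s.sol q.2))
  have h2 := hz (insert q.1 (s.sol q.2))
  have h3 := hz (s.sol q.2)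
  unfold sgsStep
  simp only [oracleCalls_ite, oracleCalls_bind, oracleCalls_charge, oracleCalls_pure]
  split_ifs <;> omega

theorem arithOps_sgsStep_le (hz : ∀ S, (z S).arithOps f om ≤ 1)
    (hm : ∀ S, (mem S).arithOps f om ≤ 0) (c' : Fin m → Fin n → ℝ≥0∞) (ρ τ : ℝ)
    (s : SGSState n m ℓ) (q : Fin n × Fin ℓ) :
    (sgsStep z mem c' ρ τ s q).arithOps f om ≤ 3 * m + 6 := by
  have h1 := hm (insert q.1 (s.sol q.2))
  have h2 := hz (insert q.1 (s.sol q.2))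
  have h3 := hz (s.sol q.2)
  unfold sgsStep
  simp only [arithOps_ite, arithOps_bind, arithOps_charge, arithOps_pure]
  split_ifs <;> omega

theorem oracleCalls_sgsLoop_le (hz : ∀ S, (z S).oracleCalls f om ≤ 1)
    (hm : ∀ S, (mem S).oracleCalls f om ≤ 1) (c' : Fin m → Fin n → ℝ≥0∞)
    (pairs : List (Fin n × Fin ℓ)) (ε V ρ : ℝ) (r : ℕ) (τ : ℝ) (s : SGSState n m ℓ) :
    (sgsLoop z mem c' pairs ε V ρ r τ s).oracleCalls f om ≤ r * (pairs.length * 3) := by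
  induction r generalizing τ s with
  | zero => simp [sgsLoop]
  | succ r ih =>
    rw [sgsLoop]
    simp only [oracleCalls_bind, oracleCalls_charge]
    split_ifs
    · have h1 := oracleCalls_foldlM_le f om (sgsStep z mem c' ρ τ) pairs s 3
        fun s q _ => oracleCalls_sgsStep_le hz hm c' ρ τ s q
      have h2 := ih ((1 - ε) * τ) ((pairs.foldlM (sgsStep z mem c' ρ τ) s).eval f om)
      rw [oracleCalls_bind, add_mul, one_mul]
      omega
    · simp

theorem arithOps_sgsLoop_le (hz : ∀ S, (z S).arithOps f om ≤ 1)
    (hm : ∀ S, (mem S).arithOps f om ≤ 0) (c' : Fin m → Fin n → ℝ≥0∞)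
    (pairs : List (Fin n × Fin ℓ)) (ε V ρ : ℝ) (r : ℕ) (τ : ℝ) (s : SGSState n m ℓ) :
    (sgsLoop z mem c' pairs ε V ρ r τ s).arithOps f om ≤
      r * (4 + pairs.length * (3 * m + 6)) := by
  induction r generalizing τ s with
  | zero => simp [sgsLoop]
  | succ r ih =>
    rw [sgsLoop]
    simp only [arithOps_bind, arithOps_charge]
    rw [add_mul, one_mul]
    split_ifs
    · have h1 := arithOps_foldlM_le f om (sgsStep z mem c' ρ τ) pairs s (3 * m + 6)
        fun s q _ => arithOps_sgsStep_le hz hm c' ρ τ s q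
      have h2 := ih ((1 - ε) * τ) ((pairs.foldlM (sgsStep z mem c' ρ τ) s).eval f om)
      rw [arithOps_bind]
      omega
    · simp only [arithOps_pure]
      omega

theorem oracleCalls_knapsackSGS_le (hz : ∀ S, (z S).oracleCalls f om ≤ 1)
    (hm : ∀ S, (mem S).oracleCalls f om ≤ 1) (c' : Fin m → Fin n → ℝ≥0∞) (N' : Finset (Fin n))
    (pairs : List (Fin n × Fin ℓ)) (ε V ρ : ℝ) :
    (knapsackSGS z mem c' N' pairs ε V ρ).oracleCalls f om ≤
      (sgsPasses n ε V + 1) * (pairs.length * 3) + ℓ := by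
  unfold knapsackSGS
  simp only [oracleCalls_bind, oracleCalls_pure]
  refine Nat.add_le_add (oracleCalls_sgsLoop_le hz hm c' pairs ε V ρ _ _ _) ?_
  simpa using oracleCalls_argmax_le f om z ((List.finRange ℓ).map _) 1 hz

theorem arithOps_knapsackSGS_le (hz : ∀ S, (z S).arithOps f om ≤ 1)
    (hm : ∀ S, (mem S).arithOps f om ≤ 0) (c' : Fin m → Fin n → ℝ≥0∞) (N' : Finset (Fin n))
    (pairs : List (Fin n × Fin ℓ)) (ε V ρ : ℝ) :
    (knapsackSGS z mem c' N' pairs ε V ρ).arithOps f om ≤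
      (sgsPasses n ε V + 1) * (4 + pairs.length * (3 * m + 6)) + ℓ * 2 := by
  unfold knapsackSGS
  simp only [arithOps_bind, arithOps_pure]
  refine Nat.add_le_add (arithOps_sgsLoop_le hz hm c' pairs ε V ρ _ _ _) ?_
  simpa using arithOps_argmax_le f om z ((List.finRange ℓ).map _) 1 hz

theorem oracleCalls_scanGround_le (hz : ∀ S, (z S).oracleCalls f om ≤ 1)
    (hm : ∀ S, (mem S).oracleCalls f om ≤ 1) (c' : Fin m → Fin n → ℝ≥0∞) (A : Finset (Fin n))
    (C : ℕ) (fA : ℝ) : (scanGround z mem c' A C fA).oracleCalls f om ≤ n * 2 := by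
  unfold scanGround
  refine (oracleCalls_foldlM_le f om _ _ _ 2 fun s e _ => ?_).trans (by simp)
  have h1 := hz {e}
  have h2 := hm {e}
  simp only [oracleCalls_ite, oracleCalls_bind, oracleCalls_charge, oracleCalls_pure]
  split_ifs <;> omega

theorem arithOps_scanGround_le (hz : ∀ S, (z S).arithOps f om ≤ 1)
    (hm : ∀ S, (mem S).arithOps f om ≤ 0) (c' : Fin m → Fin n → ℝ≥0∞) (A : Finset (Fin n))
    (C : ℕ) (fA : ℝ) : (scanGround z mem c' A C fA).arithOps f om ≤ n * (m + 4) := by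
  unfold scanGround
  refine (arithOps_foldlM_le f om _ _ _ (m + 4) fun s e _ => ?_).trans (by simp)
  have h1 := hz {e}
  have h2 := hm {e}
  simp only [arithOps_ite, arithOps_bind, arithOps_charge, arithOps_pure]
  split_ifs <;> omega

/-- One search step reduces the gap `d` to at most `⌈d / 2⌉`; the logarithm rounded up counts the
steps exactly under such halving. -/
theorem clog_half_add_one_le {d e : ℕ} (hd : 1 < d) (he : e ≤ (d + 1) / 2) :
    Nat.clog 2 e + 1 ≤ Nat.clog 2 d := by
  have h := Nat.clog_of_two_le (b := 2) (n := d) one_lt_two hd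
  rw [h]
  exact Nat.succ_le_succ (Nat.clog_mono_right 2 (by omega))

/-- `B` bounds all indices met, hence the charge for the power in each density. -/
theorem binarySearch_cost (sub : ℝ → Prog n (Finset (Fin n) × Bool)) (rho : ℕ → ℝ) (t u B : ℕ)
    (ht : ∀ ρ, (sub ρ).oracleCalls f om ≤ t) (hu : ∀ ρ, (sub ρ).arithOps f om ≤ u) (b₁ b₀ : ℕ)
    (h₁ : b₁ ≤ B) (h₀ : b₀ ≤ B) :
    (binarySearch sub rho b₁ b₀).oracleCalls f om ≤
        Nat.clog 2 ((b₁ : ℤ) - (b₀ : ℤ)).natAbs * t ∧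
      (binarySearch sub rho b₁ b₀).arithOps f om ≤
        Nat.clog 2 ((b₁ : ℤ) - (b₀ : ℤ)).natAbs * (B + 12 + u) + 2 ∧
      ((binarySearch sub rho b₁ b₀).eval f om).length ≤
        Nat.clog 2 ((b₁ : ℤ) - (b₀ : ℤ)).natAbs := by
  by_cases h : 1 < ((b₁ : ℤ) - (b₀ : ℤ)).natAbs
  · obtain ⟨b, hb⟩ : ∃ b, b = (b₁ + b₀ + 1) / 2 := ⟨_, rfl⟩
    have key : ∀ (p : Prog n (List (Finset (Fin n)))) (e : ℕ),
        e ≤ (((b₁ : ℤ) - (b₀ : ℤ)).natAbs + 1) / 2 →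
        p.oracleCalls f om ≤ Nat.clog 2 e * t ∧
          p.arithOps f om ≤ Nat.clog 2 e * (B + 12 + u) + 2 ∧
          (p.eval f om).length ≤ Nat.clog 2 e →
        (sub (rho b)).oracleCalls f om + p.oracleCalls f om ≤
            Nat.clog 2 ((b₁ : ℤ) - (b₀ : ℤ)).natAbs * t ∧
          b + 12 + ((sub (rho b)).arithOps f om + p.arithOps f om) ≤
            Nat.clog 2 ((b₁ : ℤ) - (b₀ : ℤ)).natAbs * (B + 12 + u) + 2 ∧
          (p.eval f om).length + 1 ≤ Nat.clog 2 ((b₁ : ℤ) - (b₀ : ℤ)).natAbs := by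
      rintro p e he ⟨h1, h2, h3⟩
      have h4 := clog_half_add_one_le h he
      have h5 := Nat.mul_le_mul_right t h4
      have h6 := Nat.mul_le_mul_right (B + 12 + u) h4
      have h7 := ht (rho b)
      have h8 := hu (rho b)
      rw [add_mul, one_mul] at h5 h6
      refine ⟨by omega, by omega, by omega⟩
    have hA := key _ _ (by omega)
      (binarySearch_cost sub rho t u B ht hu b b₀ (by omega) h₀)
    have hB := key _ _ (by omega)
      (binarySearch_cost sub rho t u B ht hu b₁ b h₁ (by omega))
    rw [binarySearch, if_pos h]
    simp only [oracleCalls_bind, arithOps_bind, eval_bind, oracleCalls_charge, arithOps_charge,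
      ← hb, zero_add]
    split_ifs <;>
      simp only [oracleCalls_bind, arithOps_bind, eval_bind, oracleCalls_pure, arithOps_pure,
        eval_pure, List.length_cons, add_zero]
    · exact hA
    · exact hB
  · rw [binarySearch, if_neg h]
    simp
termination_by ((b₁ : ℤ) - (b₀ : ℤ)).natAbs
decreasing_by all_goals omega

end Cost

/-! ### Costs of the whole algorithm -/

section SproutCost

variable {n k m ℓ : ℕ} {f : Finset (Fin n) → ℝ} {om : Finset (Fin n) → Bool}
  {c : Fin m → Fin n → ℝ≥0}

theorem extendSet_cost (p : Params) (pairs : List (Fin n × Fin ℓ)) (A : Finset (Fin n))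
    (C R B : ℕ) (hA : A.card = C) (hR : ∀ V, sgsPasses n p.ε V ≤ R) (hB1 : 1 ≤ B)
    (hB : ∀ N : ℕ, N ≤ n → ⌈Real.logb 2 (N : ℝ) / p.δ⌉₊ ≤ B) :
    (extendSet c p pairs A).oracleCalls f om ≤
        1 + (n * 2 + (Nat.clog 2 B * ((R + 1) * (pairs.length * 3) + ℓ) + Nat.clog 2 B)) ∧
      (extendSet c p pairs A).arithOps f om ≤
        m * (C + 1) + m * n + (n * (m + 4) + (3 + (Nat.clog 2 B * (B + 12 +
          ((R + 1) * (4 + pairs.length * (3 * m + 6)) + ℓ * 2)) + 2 + Nat.clog 2 B * 2))) := by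
  subst hA
  have hzc : ∀ S : Finset (Fin n), ((do
      let v ← queryValue (A ∪ S)
      charge 1
      pure (v - f A) : Prog n ℝ)).oracleCalls f om ≤ 1 := by simp
  have hza : ∀ S : Finset (Fin n), ((do
      let v ← queryValue (A ∪ S)
      charge 1
      pure (v - f A) : Prog n ℝ)).arithOps f om ≤ 1 := by simp
  have hmc : ∀ S : Finset (Fin n), (queryMember (A ∪ S)).oracleCalls f om ≤ 1 := by simp
  have hma : ∀ S : Finset (Fin n), (queryMember (A ∪ S)).arithOps f om ≤ 0 := by simp
  unfold extendSet
  simp only [oracleCalls_bind, arithOps_bind, oracleCalls_charge, arithOps_charge,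
    oracleCalls_pure, arithOps_pure, eval_queryValue, oracleCalls_queryValue,
    arithOps_queryValue, zero_add, add_zero]
  obtain ⟨st, hst⟩ : ∃ st, st = (scanGround (fun S => (do
      let v ← queryValue (A ∪ S)
      charge 1
      pure (v - f A) : Prog n ℝ)) (fun S => queryMember (A ∪ S)) (reducedCost c A) A p.C
        (f A)).eval f om := ⟨_, rfl⟩
  rw [← hst]
  have hcard : st.1.card ≤ n := by simpa using Finset.card_le_univ st.1
  have hb₀ := hB _ hcard
  obtain ⟨h1, h2, h3⟩ := binarySearch_cost (f := f) (om := om)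
    (knapsackSGS (fun S => (do
      let v ← queryValue (A ∪ S)
      charge 1
      pure (v - f A) : Prog n ℝ)) (fun S => queryMember (A ∪ S)) (reducedCost c A) st.1 pairs p.ε
      (st.2.getD 0))
    (fun b => p.β * st.2.getD 0 * (1 + p.δ) ^ b + p.γ * f A / p.C)
    ((R + 1) * (pairs.length * 3) + ℓ) ((R + 1) * (4 + pairs.length * (3 * m + 6)) + ℓ * 2) B
    (fun ρ => (oracleCalls_knapsackSGS_le hzc hmc _ _ _ _ _ _).trans (by gcongr; exact hR _))
    (fun ρ => (arithOps_knapsackSGS_le hza hma _ _ _ _ _ _).trans (by gcongr; exact hR _))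
    1 _ hB1 hb₀
  have hclog : Nat.clog 2 (((1 : ℕ) : ℤ) -
      ((⌈Real.logb 2 (st.1.card : ℝ) / p.δ⌉₊ : ℕ) : ℤ)).natAbs ≤ Nat.clog 2 B :=
    Nat.clog_mono_right 2 (by omega)
  constructor
  · refine Nat.add_le_add_left (Nat.add_le_add (oracleCalls_scanGround_le hzc hmc _ _ _ _)
      (Nat.add_le_add (h1.trans (Nat.mul_le_mul_right _ hclog)) ?_)) _
    refine (oracleCalls_argmax_le f om _ _ 1 hzc).trans ?_
    rw [mul_one]
    exact h3.trans hclog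
  · refine Nat.add_le_add_left (Nat.add_le_add (arithOps_scanGround_le hza hma _ _ _ _)
      (Nat.add_le_add_left (Nat.add_le_add (h2.trans ?_) ?_) _)) _
    · exact Nat.add_le_add_right (Nat.mul_le_mul_right _ hclog) _
    · exact (arithOps_argmax_le f om _ _ 1 hza).trans (Nat.mul_le_mul_right _ (h3.trans hclog))

theorem sprout_cost (p : Params) (sets : List (Finset (Fin n))) (pairs : List (Fin n × Fin ℓ))
    (t u : ℕ) (hcard : ∀ A ∈ sets, A.card = p.C)
    (ht : ∀ A ∈ sets, (extendSet c p pairs A).oracleCalls f om ≤ t)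
    (hu : ∀ A ∈ sets, (extendSet c p pairs A).arithOps f om ≤ u) :
    (sprout c p sets pairs).oracleCalls f om ≤ sets.length * (t + 2) ∧
      (sprout c p sets pairs).arithOps f om ≤ sets.length * (m * (p.C + 1) + u + 1) := by
  unfold sprout
  simp only [oracleCalls_bind, arithOps_bind]
  have hlen : ∀ step : List (Finset (Fin n)) → Finset (Fin n) → Prog n (List (Finset (Fin n))),
      (∀ acc A, ((step acc A).eval f om).length ≤ acc.length + 1) →
      ((sets.foldlM step []).eval f om).length ≤ sets.length := by
    intro step hstep
    rw [eval_foldlM]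
    suffices h : ∀ acc, (sets.foldl (fun s a => (step s a).eval f om) acc).length ≤
        acc.length + sets.length by simpa using h []
    clear hcard ht hu
    induction sets with
    | nil => simp
    | cons A L ih =>
      intro acc
      have h1 := ih ((step acc A).eval f om)
      have h2 := hstep acc A
      simp only [List.foldl_cons, List.length_cons]
      omega
  constructor
  · rw [show sets.length * (t + 2) = sets.length * (1 + t) + sets.length * 1 by ring]
    refine Nat.add_le_add (oracleCalls_foldlM_le f om _ _ _ _ fun acc A hA => ?_)
      ((oracleCalls_argmax_le f om _ _ 1 (by simp)).trans (Nat.mul_le_mul_right _ (hlen _ ?_)))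
    · have := ht A hA
      simp only [oracleCalls_bind, oracleCalls_queryMember, oracleCalls_charge]
      split_ifs
      · simp only [oracleCalls_bind, oracleCalls_pure]; omega
      · simp
    · intro acc A
      simp only [eval_bind]
      split_ifs <;> simp
  · rw [mul_add]
    refine Nat.add_le_add (arithOps_foldlM_le f om _ _ _ _ fun acc A hA => ?_)
      ((arithOps_argmax_le f om _ _ 0 (by simp)).trans (Nat.mul_le_mul_right _ (hlen _ ?_)))
    · have := hu A hA
      simp only [arithOps_bind, arithOps_queryMember, arithOps_charge, hcard A hA]
      split_ifs
      · simp only [arithOps_bind, arithOps_pure]; omega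
      · simp only [arithOps_pure]; omega
    · intro acc A
      simp only [eval_bind]
      split_ifs <;> simp

end SproutCost

/-! ### Explicit bounds on the costs -/

section Asymptotics

variable {n k m ℓ : ℕ} {ε : ℝ}

theorem log_div_nonneg (hn : 0 < n) (hε0 : 0 < ε) (hε : ε < 1) : 0 ≤ Real.log (n / ε) := by
  apply Real.log_nonneg
  rw [le_div_iff₀ hε0]
  have : (1 : ℝ) ≤ n := by exact_mod_cast hn
  linarith

theorem sgsPasses_le (hn : 0 < n) (hε0 : 0 < ε) (hε : ε < 1) (V : ℝ) :
    sgsPasses n ε V ≤ ⌈Real.log (n / ε) / ε⌉₊ := by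
  have hn' : (0 : ℝ) < n := by exact_mod_cast hn
  rcases le_or_gt V 0 with hV | hV
  · refine (Nat.sInf_le ?_).trans (Nat.zero_le _)
    have h1 : ε / n ≤ 1 := by
      rw [div_le_one hn']
      have : (1 : ℝ) ≤ n := by exact_mod_cast hn
      linarith
    simp only [Set.mem_ofPred_eq, pow_zero, one_mul]
    rw [mul_div_right_comm]
    nlinarith
  · refine Nat.sInf_le ?_
    simp only [Set.mem_ofPred_eq]
    rw [mul_div_right_comm]
    refine mul_le_mul_of_nonneg_right ?_ hV.le
    obtain ⟨r, hr⟩ : ∃ r, r = ⌈Real.log (n / ε) / ε⌉₊ := ⟨_, rfl⟩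
    have h1 : Real.log (n / ε) ≤ r * ε := by
      rw [← div_le_iff₀ hε0, hr]
      exact Nat.le_ceil _
    rw [← hr]
    calc (1 - ε) ^ r ≤ Real.exp (-ε) ^ r :=
          pow_le_pow_left₀ (by linarith) (Real.one_sub_le_exp_neg ε) r
      _ = Real.exp (-(r * ε)) := by rw [← Real.exp_nat_mul]; congr 1; ring
      _ ≤ Real.exp (-Real.log (n / ε)) := Real.exp_le_exp.2 (by linarith)
      _ = ε / n := by
          rw [Real.exp_neg, Real.exp_log (by positivity), inv_div]

/-- `log₂ N ≤ N - 1` leaves room for rounding up, because `1 ≤ 1 / ε`. So crude a bound is enough: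
it enters the number of search steps only through a logarithm, and the charge for powers only
linearly. -/
theorem ceil_logb_div_le (hε0 : 0 < ε) (hε : ε < 1) {N : ℕ} (hN : N ≤ n) (hn : 0 < n) :
    ⌈Real.logb 2 (N : ℝ) / ε⌉₊ ≤ ⌊n / ε⌋₊ := by
  have hn1 : (1 : ℝ) ≤ n := by exact_mod_cast hn
  rcases Nat.eq_zero_or_pos N with rfl | hN0
  · simp
  · refine Nat.le_floor ?_
    have hN1 : (1 : ℝ) ≤ N := by exact_mod_cast hN0
    have h1 : Real.logb 2 (N : ℝ) ≤ N - 1 := by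
      obtain ⟨K, rfl⟩ : ∃ K, N = K + 1 := ⟨N - 1, by omega⟩
      rw [Real.logb_le_iff_le_rpow (by norm_num) (by positivity)]
      push_cast
      rw [add_sub_cancel_right, Real.rpow_natCast]
      exact_mod_cast Nat.lt_two_pow_self
    have hL : 0 ≤ Real.logb 2 (N : ℝ) := Real.logb_nonneg (by norm_num) hN1
    have h2 := (Nat.ceil_lt_add_one (div_nonneg hL hε0.le)).le
    refine h2.trans ?_
    rw [le_div_iff₀ hε0, add_mul, div_mul_cancel₀ _ hε0.ne']
    have : (N : ℝ) ≤ n := by exact_mod_cast hN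
    linarith

theorem clog_floor_le (hn : 0 < n) (hε0 : 0 < ε) (hε : ε < 1) :
    (Nat.clog 2 ⌊n / ε⌋₊ : ℝ) ≤ 2 * (1 + Real.log (n / ε)) := by
  have hn1 : (1 : ℝ) ≤ n := by exact_mod_cast hn
  have hx : 1 ≤ n / ε := by rw [le_div_iff₀ hε0]; linarith
  have hB1 : (1 : ℝ) ≤ ⌊n / ε⌋₊ := by exact_mod_cast Nat.le_floor (by simpa using hx)
  have hlog := log_div_nonneg hn hε0 hε
  rw [← Real.natCeil_logb_natCast]
  refine (Nat.ceil_lt_add_one (Real.logb_nonneg (by norm_num) hB1)).le.trans ?_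
  have h1 : Real.logb (2 : ℕ) (⌊n / ε⌋₊ : ℝ) ≤ 2 * Real.log (n / ε) := by
    rw [Real.logb, Nat.cast_ofNat, div_le_iff₀ (Real.log_pos (by norm_num))]
    have h2 : Real.log (⌊n / ε⌋₊ : ℝ) ≤ Real.log (n / ε) :=
      Real.log_le_log (by linarith) (Nat.floor_le (by linarith))
    have h3 := Real.log_two_gt_d9
    nlinarith
  linarith

theorem length_le_of_listsSets {C : ℕ} {sets : List (Finset (Fin n))} (h : ListsSets C sets) :
    sets.length ≤ n ^ C := by
  rw [← List.toFinset_card_of_nodup h.1]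
  have : sets.toFinset = Finset.powersetCard C Finset.univ := by
    ext A
    simp [h.2, Finset.mem_powersetCard]
  rw [this, Finset.card_powersetCard, Finset.card_univ, Fintype.card_fin]
  exact Nat.choose_le_pow n C

theorem length_of_listsPairs {pairs : List (Fin n × Fin ℓ)} (h : ListsPairs pairs) :
    pairs.length = n * ℓ := by
  rw [← List.toFinset_card_of_nodup h.1]
  have : pairs.toFinset = Finset.univ := by
    ext q
    simp [h.2]
  rw [this, Finset.card_univ, Fintype.card_prod, Fintype.card_fin, Fintype.card_fin]

/-- The oracle calls made for one enumerated set. -/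
theorem oracle_bound {n P ℓ L ε R T : ℝ} (hn : 1 ≤ n) (hP : 1 ≤ P) (hℓ0 : 0 ≤ ℓ)
    (hℓ : ℓ ≤ 2 * P) (hL : 1 ≤ L) (hε0 : 0 < ε) (hε : ε < 1) (hR0 : 0 ≤ R) (hR : R ≤ 2 * L / ε)
    (hT : T ≤ 2 * L) :
    1 + (n * 2 + (T * (R * (n * ℓ * 3) + ℓ) + T)) + 2 ≤ 150 * (P * n / ε) * L ^ 2 := by
  obtain ⟨w, hw⟩ : ∃ w, w = 1 / ε := ⟨_, rfl⟩
  have hw1 : 1 ≤ w := by rw [hw, le_div_iff₀ hε0]; linarith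
  have hRw : R ≤ 2 * L * w := by rw [hw]; simpa [div_eq_mul_inv] using hR
  have e1 : 1 ≤ P * n := by nlinarith
  have e2 : n ≤ P * n := by nlinarith
  have e3 : P ≤ P * n := by nlinarith
  have e4 : 1 ≤ L * w := by nlinarith
  have h1 : R * (n * ℓ * 3) ≤ (2 * L * w) * (n * (2 * P) * 3) := by gcongr
  have h2 : R * (n * ℓ * 3) + ℓ ≤ 14 * ((P * n) * (L * w)) := by nlinarith
  have h3 : T * (R * (n * ℓ * 3) + ℓ) ≤ (2 * L) * (14 * ((P * n) * (L * w))) :=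
    mul_le_mul hT h2 (by positivity) (by linarith)
  have e5 : P * n * 1 ≤ (P * n) * (L * w) := by gcongr
  have e6 : (P * n) * (L * w) ≤ L * ((P * n) * (L * w)) :=
    le_mul_of_one_le_left (by positivity) hL
  have e7 : L * 1 ≤ L * ((P * n) * (L * w)) := by gcongr; linarith
  have e8 : 150 * (P * n / ε) * L ^ 2 = 150 * (L * ((P * n) * (L * w))) := by rw [hw]; ring
  rw [e8]
  linarith

/-- The arithmetic operations performed for one enumerated set. -/
theorem arith_bound {n P ℓ m C L ε R T B : ℝ} (hn : 1 ≤ n) (hP : 1 ≤ P) (hℓ0 : 0 ≤ ℓ)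
    (hℓ : ℓ ≤ 2 * P) (hm : 1 ≤ m) (hC : C ≤ n) (hL : 1 ≤ L) (hε0 : 0 < ε) (hε : ε < 1)
    (hR0 : 0 ≤ R) (hR : R ≤ 2 * L / ε) (hT : T ≤ 2 * L) (hB0 : 0 ≤ B) (hB : B ≤ n / ε) :
    m * (C + 1) + (m * (C + 1) + m * n + (n * (m + 4) + (3 + (T * (B + 12 +
      (R * (4 + n * ℓ * (3 * m + 6)) + ℓ * 2)) + 2 + T * 2)))) + 1 ≤
      150 * (m * (P * n) / ε) * L ^ 2 := by
  obtain ⟨w, hw⟩ : ∃ w, w = 1 / ε := ⟨_, rfl⟩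
  have hw1 : 1 ≤ w := by rw [hw, le_div_iff₀ hε0]; linarith
  have hRw : R ≤ 2 * L * w := by rw [hw]; simpa [div_eq_mul_inv] using hR
  have hBw : B ≤ n * w := by rw [hw]; simpa [div_eq_mul_inv] using hB
  obtain ⟨u, hu⟩ : ∃ u, u = m * (P * n) := ⟨_, rfl⟩
  have e1 : 1 ≤ P * n := by nlinarith
  have e2 : n ≤ P * n := by nlinarith
  have e3 : P ≤ P * n := by nlinarith
  have e4 : 1 ≤ L * w := by nlinarith
  have f0 : P * n ≤ u := by rw [hu]; exact le_mul_of_one_le_left (by linarith) hm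
  have f1 : m * n ≤ u := by rw [hu]; gcongr
  have f2 : m ≤ m * n := by nlinarith
  have f3 : m * C ≤ m * n := by gcongr
  have h0 : 4 + n * ℓ * (3 * m + 6) ≤ 22 * u := by
    have : n * ℓ * (3 * m + 6) ≤ n * (2 * P) * (9 * m) := by gcongr; linarith
    have h' : n * (2 * P) * (9 * m) = 18 * u := by rw [hu]; ring
    linarith
  have h1 : R * (4 + n * ℓ * (3 * m + 6)) ≤ (2 * L * w) * (22 * u) := by gcongr
  have u1 : 1 ≤ u := e1.trans f0
  have g1 : u * 1 ≤ u * (L * w) := by gcongr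
  have g2 : n * w ≤ u * (L * w) := by
    have : n * (1 * w) ≤ u * (L * w) := by gcongr; linarith
    linarith
  have h2 : B + 12 + (R * (4 + n * ℓ * (3 * m + 6)) + ℓ * 2) ≤ 61 * (u * (L * w)) := by
    linarith
  have h3 : T * (B + 12 + (R * (4 + n * ℓ * (3 * m + 6)) + ℓ * 2)) ≤
      (2 * L) * (61 * (u * (L * w))) :=
    mul_le_mul hT h2 (by positivity) (by linarith)
  have g3 : u * (L * w) ≤ L * (u * (L * w)) := le_mul_of_one_le_left (by positivity) hL
  have g4 : L * 1 ≤ L * (u * (L * w)) := by gcongr; linarith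
  have g5 : 150 * (m * (P * n) / ε) * L ^ 2 = 150 * (L * (u * (L * w))) := by rw [hw, hu]; ring
  rw [g5]
  linarith

variable {f : Finset (Fin n) → ℝ} {M : Fin k → Matroid (Fin n)} {c : Fin m → Fin n → ℝ≥0}

/-- The square of the logarithm comes from the search steps and the passes. An empty enumeration is
treated apart, since `0 < n` and `C ≤ n` are read off an enumerated set. -/
theorem sprout_costBound {P : ℕ} (hP : 1 ≤ P) (hm : 1 ≤ m) (hℓ : ℓ ≤ 2 * P) {p : Params}
    (hC : 1 ≤ p.C) (hε0 : 0 < p.ε) (hε : p.ε < 1) (hδ : p.δ = p.ε)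
    {sets : List (Finset (Fin n))} (hsets : ListsSets p.C sets)
    {pairs : List (Fin n × Fin ℓ)} (hpairs : ListsPairs pairs) :
    CostBound f M m p.ε 150 2 (P * (n : ℝ) ^ (p.C + 1)) (sprout c p sets pairs) := by
  obtain ⟨C, δ, ε, β, γ⟩ := p
  simp only at hC hε0 hε hδ hsets ⊢
  subst hδ
  obtain ⟨p, hp⟩ : ∃ p : Params, p = ⟨C, δ, δ, β, γ⟩ := ⟨_, rfl⟩
  rw [← hp]
  have hpC : p.C = C := by rw [hp]
  have hpε : p.ε = δ := by rw [hp]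
  have hpδ : p.δ = δ := by rw [hp]
  have hcardC : ∀ A ∈ sets, A.card = p.C := fun A hA => by rw [hpC]; exact (hsets.2 A).1 hA
  rcases sets.eq_nil_or_concat with rfl | ⟨L₀, A₀, hA₀⟩
  · obtain ⟨h1, h2⟩ := sprout_cost (f := f) (om := memOracle M) (c := c) p [] pairs 0 0
      (by simp) (by simp) (by simp)
    rw [List.length_nil, zero_mul, Nat.le_zero] at h1 h2
    constructor
    · rw [h1, Nat.cast_zero]; positivity
    · rw [h2, Nat.cast_zero]; positivity
  have hA₀mem : A₀ ∈ sets := by rw [hA₀]; simp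
  have hn : 0 < n := pos_of_listsSets hC hsets hA₀mem
  have hCn : C ≤ n := by
    have h1 := (hsets.2 A₀).1 hA₀mem
    have h2 := Finset.card_le_univ A₀
    rw [Fintype.card_fin] at h2
    omega
  have hn1 : (1 : ℝ) ≤ n := by exact_mod_cast hn
  have hx : (1 : ℝ) ≤ n / δ := by rw [le_div_iff₀ hε0]; linarith
  have hlog := log_div_nonneg hn hε0 hε
  obtain ⟨R, hRdef⟩ : ∃ R, R = ⌈Real.log (n / δ) / δ⌉₊ := ⟨_, rfl⟩
  obtain ⟨B, hBdef⟩ : ∃ B, B = ⌊(n : ℝ) / δ⌋₊ := ⟨_, rfl⟩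
  have hR : ((R + 1 : ℕ) : ℝ) ≤ 2 * (1 + Real.log (n / δ)) / δ := by
    have h1 := (Nat.ceil_lt_add_one (div_nonneg hlog hε0.le)).le
    rw [← hRdef] at h1
    have h2 : Real.log (n / δ) / δ + 1 + 1 ≤ 2 * (1 + Real.log (n / δ)) / δ := by
      rw [le_div_iff₀ hε0, add_mul, add_mul, div_mul_cancel₀ _ hε0.ne']
      linarith
    push_cast
    linarith
  have hB : (B : ℝ) ≤ n / δ := by rw [hBdef]; exact Nat.floor_le (by linarith)
  have hT : (Nat.clog 2 B : ℝ) ≤ 2 * (1 + Real.log (n / δ)) := by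
    rw [hBdef]; exact clog_floor_le hn hε0 hε
  have hext := fun A hA => extendSet_cost (f := f) (om := memOracle M) (c := c) p pairs A C R B
    ((hsets.2 A).1 hA)
    (by rw [hpε, hRdef]; exact sgsPasses_le hn hε0 hε)
    (by rw [hBdef]; exact Nat.le_floor (by simpa using hx))
    (by rw [hpδ, hBdef]; exact fun N hN => ceil_logb_div_le hε0 hε hN hn)
  rw [length_of_listsPairs hpairs] at hext
  obtain ⟨h1, h2⟩ := sprout_cost (f := f) (om := memOracle M) (c := c) p sets pairs _ _ hcardC
    (fun A hA => (hext A hA).1) (fun A hA => (hext A hA).2)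
  rw [hpC] at h2
  have hlen := length_le_of_listsSets hsets
  have hP' : (1 : ℝ) ≤ P := by exact_mod_cast hP
  have hℓ' : (ℓ : ℝ) ≤ 2 * P := by exact_mod_cast hℓ
  have hm' : (1 : ℝ) ≤ m := by exact_mod_cast hm
  have hC' : (C : ℝ) ≤ n := by exact_mod_cast hCn
  constructor
  · have h3 := oracle_bound hn1 hP' (Nat.cast_nonneg ℓ) hℓ'
      (show 1 ≤ 1 + Real.log (n / δ) by linarith) hε0 hε (Nat.cast_nonneg _) hR hT
    have h4 := h1.trans (Nat.mul_le_mul_right _ hlen)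
    have h5 : ((sprout c p sets pairs).oracleCalls f (memOracle M) : ℝ) ≤
        (n : ℝ) ^ C * (150 * (P * n / δ) * (1 + Real.log (n / δ)) ^ 2) := by
      refine (Nat.cast_le.2 h4).trans ?_
      push_cast at h3 ⊢
      gcongr
    refine h5.trans (le_of_eq ?_)
    rw [pow_succ (n : ℝ) C]
    ring
  · have h3 := arith_bound hn1 hP' (Nat.cast_nonneg ℓ) hℓ' hm' hC'
      (show 1 ≤ 1 + Real.log (n / δ) by linarith) hε0 hε (Nat.cast_nonneg _) hR hT
      (Nat.cast_nonneg _) hB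
    have h4 := h2.trans (Nat.mul_le_mul_right _ hlen)
    have h5 : ((sprout c p sets pairs).arithOps f (memOracle M) : ℝ) ≤
        (n : ℝ) ^ C * (150 * (m * (P * n) / δ) * (1 + Real.log (n / δ)) ^ 2) := by
      refine (Nat.cast_le.2 h4).trans ?_
      push_cast at h3 ⊢
      gcongr
    refine h5.trans (le_of_eq ?_)
    rw [pow_succ (n : ℝ) C]
    ring

theorem one_add_log_eighth_le (hε0 : 0 < ε) (hε : ε < 1) :
    1 + Real.log (n / (ε / 8)) ≤ 4 * (1 + Real.log (n / ε)) := by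
  rcases Nat.eq_zero_or_pos n with rfl | hn
  · norm_num
  · have hlog := log_div_nonneg hn hε0 hε
    have hn' : (0 : ℝ) < n := by exact_mod_cast hn
    have h8 : Real.log 8 ≤ 3 := by
      rw [show (8 : ℝ) = 2 ^ 3 by norm_num, Real.log_pow]
      have := Real.log_two_lt_d9
      push_cast
      linarith
    rw [show (n : ℝ) / (ε / 8) = 8 * (n / ε) by field_simp,
      Real.log_mul (by norm_num) (by positivity)]
    linarith

/-- The factor `1 / ε` contributes 8 and the squared logarithm `4 ^ 2`, and `150 * 8 * 16 = 19200`.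
-/
theorem CostBound.of_eighth {β : Type} {prog : Prog n β} {base : ℝ} (hbase : 0 ≤ base)
    (hε0 : 0 < ε) (hε : ε < 1) (h : CostBound f M m (ε / 8) 150 2 base prog) :
    CostBound f M m ε 19200 2 base prog := by
  have key : ∀ x : ℝ, 0 ≤ x → 150 * (x / (ε / 8)) * (1 + Real.log (n / (ε / 8))) ^ 2 ≤
      19200 * (x / ε) * (1 + Real.log (n / ε)) ^ 2 := by
    intro x hx
    have h0 : 0 ≤ 1 + Real.log (n / (ε / 8)) := by
      rcases Nat.eq_zero_or_pos n with rfl | hn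
      · norm_num
      · have := log_div_nonneg hn (ε := ε / 8) (by linarith) (by linarith)
        linarith
    have h1 := pow_le_pow_left₀ h0 (one_add_log_eighth_le (n := n) hε0 hε) 2
    calc 150 * (x / (ε / 8)) * (1 + Real.log (n / (ε / 8))) ^ 2
        ≤ 150 * (x / (ε / 8)) * (4 * (1 + Real.log (n / ε))) ^ 2 := by gcongr
      _ = 19200 * (x / ε) * (1 + Real.log (n / ε)) ^ 2 := by field_simp; ring
  exact ⟨h.1.trans (key _ hbase), h.2.trans (key _ (by positivity))⟩

theorem CostBound.weaken {β : Type} {prog : Prog n β} {base : ℝ} (hbase : 0 ≤ base)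
    (hε0 : 0 < ε) (h : CostBound f M m ε 150 2 base prog) :
    CostBound f M m ε 19200 2 base prog := by
  refine ⟨h.1.trans ?_, h.2.trans ?_⟩ <;> gcongr <;> norm_num

end Asymptotics

end Sprout

end

/-! ### The theorem -/

theorem theorem1 :
    ∃ (K : ℝ) (d : ℕ), ∀ (n k m : ℕ) (f : Finset (Fin n) → ℝ) (M : Fin k → Matroid (Fin n))
      (c : Fin m → Fin n → ℝ≥0),
      1 ≤ m → (∀ S, 0 ≤ f S) → Sprout.IsSubmodular f → (∀ i, (M i).E = Set.univ) →
      -- general objective, `ℓ = P + 1`, any enumeration parameter `C ≥ 1`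
      (∀ (C : ℕ) (ε : ℝ) (sets : List (Finset (Fin n)))
        (pairs : List (Fin n × Fin (Sprout.numP k m + 1))),
        1 ≤ C → 0 < ε → ε < 1 → Sprout.ListsSets C sets → Sprout.ListsPairs pairs →
        let P := Sprout.numP k m
        let prog := Sprout.sprout c (Sprout.generalParams k m (P + 1) C ε) sets pairs
        Sprout.CostBound f M m ε K d (P * (n : ℝ) ^ (C + 1)) prog ∧
        (∀ S, prog.eval f (Sprout.memOracle M) = some S → Sprout.Feasible M c S) ∧
        ∀ O, Sprout.IsOptimal f M c O → C ≤ O.card →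
          ∃ S, prog.eval f (Sprout.memOracle M) = some S ∧
            ((1 - ε) ^ 2 * (1 - 2 * ε) / (k + m + 3 + 2 * √((m : ℝ) + 1)) +
              ((C - ε) * (P + 1) + (C - 1) * m * (1 - ε) - C * (1 - ε) ^ 3) /
                (O.card * (P + 1 + m * (1 - ε)))) * f O ≤ f S) ∧
      -- general objective, `C = 1`: ratio `(1 + ε)(k + m + 3 + 2√(m + 1))`
      (∀ (ε : ℝ) (sets : List (Finset (Fin n)))
        (pairs : List (Fin n × Fin (Sprout.numP k m + 1))),
        0 < ε → ε < 1 → Sprout.ListsSets 1 sets → Sprout.ListsPairs pairs →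
        let P := Sprout.numP k m
        let prog := Sprout.sprout c (Sprout.generalParams k m (P + 1) 1 (ε / 8)) sets pairs
        Sprout.CostBound f M m ε K d (P * (n : ℝ) ^ 2) prog ∧
        ∀ O, Sprout.IsOptimal f M c O → O.Nonempty →
          ∃ S, prog.eval f (Sprout.memOracle M) = some S ∧ Sprout.Feasible M c S ∧
            f O ≤ (1 + ε) * (k + m + 3 + 2 * √((m : ℝ) + 1)) * f S) ∧
      -- monotone objective, `C = 1`, `ℓ ≤ k + 1`
      (Monotone f → ∀ (ℓ : ℕ) (ε : ℝ) (sets : List (Finset (Fin n)))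
        (pairs : List (Fin n × Fin ℓ)),
        1 ≤ ℓ → ℓ ≤ k + 1 → 0 < ε → ε < 1 → Sprout.ListsSets 1 sets → Sprout.ListsPairs pairs →
        let P := Sprout.numP k m
        let prog := fun η : ℝ => Sprout.sprout c (Sprout.monotoneParams k m ℓ 1 η) sets pairs
        Sprout.CostBound f M m ε K d (P * (n : ℝ) ^ 2) (prog ε) ∧
        Sprout.CostBound f M m ε K d (P * (n : ℝ) ^ 2) (prog (ε / 8)) ∧
        ∀ O, Sprout.IsOptimal f M c O → O.Nonempty →
          (∃ S, (prog ε).eval f (Sprout.memOracle M) = some S ∧ Sprout.Feasible M c S ∧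
            (1 - ε) ^ 3 / (k + m + 1) * f O ≤ f S) ∧
          (∃ S, (prog (ε / 8)).eval f (Sprout.memOracle M) = some S ∧ Sprout.Feasible M c S ∧
            f O ≤ (1 + ε) * (k + m + 1) * f S)) := by
  refine ⟨19200, 2, ?_⟩
  intro n k m f M c hm hf0 hf _
  obtain ⟨hP2, -, hkP, -⟩ := Sprout.numP_bounds k m hm
  have hmk : (0 : ℝ) ≤ k ∧ (0 : ℝ) ≤ m := ⟨Nat.cast_nonneg _, Nat.cast_nonneg _⟩
  have hQ : (0 : ℝ) < k + m + 3 + 2 * √((m : ℝ) + 1) := by positivity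
  refine ⟨?_, ?_, ?_⟩
  · intro C ε sets pairs hC hε0 hε hsets hpairs P prog
    refine ⟨(Sprout.sprout_costBound (p := Sprout.generalParams k m (P + 1) C ε) (P := P)
      (by omega) hm (by omega) hC hε0 hε rfl hsets hpairs).weaken (by positivity) hε0, ?_, ?_⟩
    · intro S hS
      exact Sprout.sprout_feasible (p := Sprout.generalParams k m (P + 1) C ε) hf hf0 hm
        (Nat.succ_pos P) hC hε0 hε rfl hsets hpairs hS
    · intro O hO hCO
      obtain ⟨S, hS, -, hval⟩ := Sprout.sprout_general hf hf0 hm hC hε0 hε hsets hpairs hO hCO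
      exact ⟨S, hS, hval⟩
  · intro ε sets pairs hε0 hε hsets hpairs P prog
    have hε8 : 0 < ε / 8 := by linarith
    have hε8' : ε / 8 < 1 := by linarith
    refine ⟨(Sprout.sprout_costBound (p := Sprout.generalParams k m (P + 1) 1 (ε / 8)) (P := P)
      (by omega) hm (by omega) le_rfl hε8 hε8' rfl hsets hpairs).of_eighth (by positivity)
        hε0 hε, ?_⟩
    intro O hO hne
    obtain ⟨S, hS, hSf, hval⟩ :=
      Sprout.sprout_general hf hf0 hm le_rfl hε8 hε8' hsets hpairs hO hne.card_pos
    refine ⟨S, hS, hSf, ?_⟩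
    refine Sprout.le_mul_of_ratio_le hε0 (Sprout.one_le_one_add_mul_of_eighth hε0 hε).1 hQ
      (hf0 O) (le_trans ?_ hval)
    refine mul_le_mul_of_nonneg_right (le_add_of_nonneg_right (div_nonneg ?_ ?_)) (hf0 O)
    · exact Sprout.enumeration_bonus_nonneg (by simp) (Nat.cast_nonneg _) hmk.2 hε8 hε8'
    · have : 0 ≤ 1 - ε / 8 := by linarith
      positivity
  · intro hmono ℓ ε sets pairs hℓ hℓk hε0 hε hsets hpairs P prog
    have hε8 : 0 < ε / 8 := by linarith
    have hε8' : ε / 8 < 1 := by linarith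
    have hP : 2 ≤ P := hP2
    have hkP' : k ≤ P := hkP
    refine ⟨(Sprout.sprout_costBound (p := Sprout.monotoneParams k m ℓ 1 ε) (P := P)
      (by omega) hm (by omega) le_rfl hε0 hε rfl hsets hpairs).weaken (by positivity) hε0,
      (Sprout.sprout_costBound (p := Sprout.monotoneParams k m ℓ 1 (ε / 8)) (P := P)
      (by omega) hm (by omega) le_rfl hε8 hε8' rfl hsets hpairs).of_eighth (by positivity)
        hε0 hε, ?_⟩
    intro O hO hne
    refine ⟨Sprout.sprout_monotone hf hf0 hmono hm hℓ hℓk hε0 hε hsets hpairs hO hne, ?_⟩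
    obtain ⟨S, hS, hSf, hval⟩ :=
      Sprout.sprout_monotone hf hf0 hmono hm hℓ hℓk hε8 hε8' hsets hpairs hO hne
    exact ⟨S, hS, hSf, Sprout.le_mul_of_ratio_le hε0
      (Sprout.one_le_one_add_mul_of_eighth hε0 hε).2 (by positivity) (hf0 O) hval⟩
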